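/- Notation. Let $\Phi(x)=\tfrac12\bigl(1-\mathrm{erf}(x/\sqrt2)\bigr)$ be the upper tail of the standard normal distribution, $I(p,1-p)=-p\log p-(1-p)\log(1-p)$ with logarithms to base $2$, $\alpha=\int_0^\infty I(\Phi(x),1-\Phi(x))\,dx$, and for $D>0$ let $$g=1-\frac1D\sqrt{\frac2\pi}\,\bigl(1-e^{-D^2/2}\bigr),\qquad \rho=\rho(c,D)=\frac{2\alpha}{c\,D\,\log(1/g)} .$$ The problem is the decision version of the $c$-approximate nearest neighbor problem in Euclidean space: for a database of $n$ points in $\mathbb R^d$ and a given $r>0$, find, for a query point $q$ that has a point of the database at distance at most $r$, a point of the database at distance at most $cr$ from $q$. The algorithm. Take $cr$ as the unit of length. A random hash function is $h(x)=\lfloor (v\cdot x+\beta)/D\rfloor$ with $v$ a standard normal vector and $\beta$ uniform on $[0,D]$ (Gaussian random projection, discretized into randomly shifted intervals of width $D$), and $H=(h_1,\dots,h_k)$ with $k=\lceil \log n/\log(1/g)\rceil$ independent such functions. The data structure stores the database and several independent tables; each table holds its hash functions and the values $H(p)$ of all points $p$ of the database, sorted. Points of $\mathbb R^d$ may be embedded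 isometrically in a space of higher dimension by appending zero coordinates. To answer a query $q$, for each table draw random points on spheres around $q$ of radii $jr/J$, $j=1,\dots,J$, and scan the bucket of each of them for a point of the database at distance at most $cr$ from $q$; stop at the first such point, and abandon a table when a given number of far points have been visited in it. The number of tables, of radii $J$, of random points, of appended coordinates, and the bound on the far points visited are parameters that may depend on $c,D,n$ only. Time is counted in elementary steps of a real RAM (arithmetic, square root, floor, comparison, memory access, drawing a normal random number), space in memory cells. Statement. For all $D>0$ and $c>1$ there is a constant $K$ such that for every $n\ge2$ the parameters can be chosen so that, for every $d\ge1$, every database of $n$ points in $\mathbb R^d$ and every $r>0$: * the data structure has size at most $K\,d\,(\log n)^K\,n$; * every query is answered in time at most $K\,d\,(\log n)^K\,n^{\rho}$; * whenever a point is returned, its distance from the query point is at most $cr$; * for every query point that has a point of the database at distance at most $r$, a point is returned with probability at least $1-1/n$ over the random choices of the construction and the search. In particular, for $d$ polylogarithmic in $n$, the search takes time $\tilde O(n^\rho)$ and the data structure has size $\tilde O(n)$. Moreover, for $D=3$ and all $c>1$, $\ |c\,\rho(c,3)-1.97|<0.01$; thus $\rho\approx1.97/c$. -/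

import Mathlib

open MeasureTheory ProbabilityTheory

noncomputable section

namespace EntropyNN

/-! ### The constants `Φ`, `α`, `g` and the exponent `ρ` -/

/-- The error function. -/
def erf (x : ℝ) : ℝ := 2 / √Real.pi * ∫ t in (0 : ℝ)..x, Real.exp (-t ^ 2)

/-- The upper tail of the standard normal distribution. -/
def Phi (x : ℝ) : ℝ := (1 - erf (x / √2)) / 2

/-- The entropy (in bits) of a distribution with probabilities `w 0, …, w (N - 1)`. -/
def entropy {N : ℕ} (w : Fin N → ℝ) : ℝ := ∑ i, -(w i * Real.logb 2 (w i))

/-- The constant `α`: the integral over `(0, ∞)` of the entropy of `(Φ x, 1 - Φ x)`. -/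
def alpha : ℝ := ∫ x in Set.Ioi (0 : ℝ), entropy ![Phi x, 1 - Phi x]

/-- The bound on the collision probability, under one hash function of width `D`, of two points
at distance at least one. -/
def collisionBound (D : ℝ) : ℝ := 1 - 1 / D * √(2 / Real.pi) * (1 - Real.exp (-D ^ 2 / 2))

/-- The exponent `ρ` of the search time. -/
def rho (c D : ℝ) : ℝ := 2 * alpha / (c * D * Real.logb 2 (1 / collisionBound D))

/-! ### Step counting

The search procedure is written in the monad `Timed`, which carries the number of elementary steps
along with the value. It is built only from the unit-cost operations below (the operations of a
real RAM with square root, floor and random normal numbers), the two `for` loops `tabulate` and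
`sum`, branching and recursion. -/

/-- A value together with the number of elementary steps spent on computing it. -/
structure Timed (A : Type) where
  val : A
  steps : ℕ

namespace Timed

instance : Monad Timed where
  pure a := ⟨a, 0⟩
  bind x f := ⟨(f x.val).val, x.steps + (f x.val).steps⟩

/-- A result that takes one elementary step. -/
abbrev step {A : Type} (a : A) : Timed A := ⟨a, 1⟩

/-- Reading one cell (or the pointer to one row) of an array. -/
abbrev readCell {ι A : Type} (a : ι → A) (i : ι) : Timed A := step (a i)

abbrev addR (x y : ℝ) : Timed ℝ := step (x + y)
abbrev subR (x y : ℝ) : Timed ℝ := step (x - y)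
abbrev mulR (x y : ℝ) : Timed ℝ := step (x * y)
abbrev divR (x y : ℝ) : Timed ℝ := step (x / y)
abbrev sqrtR (x : ℝ) : Timed ℝ := step (√x)
abbrev floorR (x : ℝ) : Timed ℤ := step ⌊x⌋
abbrev natToR (x : ℕ) : Timed ℝ := step (x : ℝ)
abbrev leR (x y : ℝ) : Timed Bool := step (decide (x ≤ y))
abbrev ltZ (x y : ℤ) : Timed Bool := step (decide (x < y))
abbrev eqZ (x y : ℤ) : Timed Bool := step (decide (x = y))
abbrev addN (x y : ℕ) : Timed ℕ := step (x + y)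

/-- Charging `m` further steps. -/
abbrev charge (m : ℕ) : Timed Unit := ⟨(), m⟩

/-- A `for` loop that writes an array; each round costs its body, one step for the counter, and
one step for writing the cell. -/
def tabulate {ι A : Type} [Fintype ι] (f : ι → Timed A) : Timed (ι → A) :=
  ⟨fun i => (f i).val, ∑ i, ((f i).steps + 2)⟩

/-- A `for` loop that accumulates a sum; each round costs its body, one step for the counter, and
one step for the addition. -/
def sum {ι : Type} [Fintype ι] (f : ι → Timed ℝ) : Timed ℝ :=
  ⟨∑ i, (f i).val, ∑ i, ((f i).steps + 2)⟩

end Timed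

open Timed

/-! ### The hash functions -/

/-- The data of one hash function on `ℝ^ι`: a direction of projection and a shift. -/
abbrev HashFn (ι : Type) := (ι → ℝ) × ℝ

/-- The hash value `⌊(v · x / w + β) / D⌋`: the point is rescaled by the unit of length `w`,
projected to the line, shifted by `β`, and mapped to the index of its interval of width `D`. -/
def hash {ι : Type} [Fintype ι] (w D : ℝ) (h : HashFn ι) (x : ι → ℝ) : ℤ :=
  ⌊((∑ i, h.1 i * x i) / w + h.2) / D⌋

/-- The hash vector `H x = (h₁ x, …, h_k x)`. -/
def hashVec {ι : Type} [Fintype ι] {k : ℕ} (w D : ℝ) (h : Fin k → HashFn ι) (x : ι → ℝ) :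
    Fin k → ℤ := fun a => hash w D (h a) x

/-- Computing the hash vector. -/
def computeHash {ι : Type} [Fintype ι] {k : ℕ} (w D : ℝ) (h : Fin k → HashFn ι) (x : ι → ℝ) :
    Timed (Fin k → ℤ) :=
  tabulate fun a => do
    let f ← readCell h a
    let s ← Timed.sum fun i => do
      let u ← readCell f.1 i
      let y ← readCell x i
      mulR u y
    let s ← divR s w
    let s ← addR s f.2
    let s ← divR s D
    floorR s

/-! ### The data structure -/

/-- One hash table for `n` points: the hash functions, and the (nonempty) buckets, stored as the
list of all hash keys in lexicographic order, each with the index of its point. -/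
structure Table (n k : ℕ) (ι : Type) where
  fn : Fin k → HashFn ι
  key : Fin n → Fin k → ℤ
  idx : Fin n → Fin n

/-- The number of memory cells of a table. -/
def Table.size {n k : ℕ} {ι : Type} [Fintype ι] (_ : Table n k ι) : ℕ :=
  k * (Fintype.card ι + 1) + n * k + n

/-- The table of the points `x 0, …, x (n - 1)` under the hash functions `fn`. -/
def buildTable {n k : ℕ} {ι : Type} [Fintype ι] (w D : ℝ) (fn : Fin k → HashFn ι)
    (x : Fin n → ι → ℝ) : Table n k ι :=
  let σ := Tuple.sort fun i => toLex (hashVec w D fn (x i))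
  { fn := fn
    key := fun j => hashVec w D fn (x (σ j))
    idx := fun j => σ j }

/-- Numerical parameters of the algorithm: `pad` zero coordinates are appended to every point (an
isometric embedding into a space of higher dimension), `tables` hash tables are used, in each of
them `samples` points are drawn on each of `radii` concentric spheres around the query point, and
at most `budget` points of the database that are far from the query point are visited. -/
structure Params where
  pad : ℕ
  tables : ℕ
  radii : ℕ
  samples : ℕ
  budget : ℕ

/-- The coordinates of `ℝ^d` followed by `e` further coordinates. -/
abbrev Coord (d e : ℕ) := Fin d ⊕ Fin e

/-- Appending zero coordinates to a point. -/
def padded {d : ℕ} (e : ℕ) (x : Fin d → ℝ) : Coord d e → ℝ := Sum.elim x fun _ => 0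

/-- The data structure: the points of the database and the hash tables. -/
structure DataStructure (n d k : ℕ) (prm : Params) where
  points : Fin n → Fin d → ℝ
  tables : Fin prm.tables → Table n k (Coord d prm.pad)

/-- The number of memory cells of the data structure. -/
def DataStructure.size {n d k : ℕ} {prm : Params} (S : DataStructure n d k prm) : ℕ :=
  n * d + ∑ l, (S.tables l).size

/-- The random choices of the construction: the hash functions of each table. -/
abbrev BuildSeed (d k : ℕ) (prm : Params) := Fin prm.tables → Fin k → HashFn (Coord d prm.pad)

/-- The random choices of the search: a vector for each sample point. -/
abbrev SearchSeed (d : ℕ) (prm : Params) :=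
  Fin prm.tables → Fin prm.radii × Fin prm.samples → Coord d prm.pad → ℝ

/-- The construction of the data structure, for interval width `D` and unit of length `w`. -/
def build {n d k : ℕ} {prm : Params} (w D : ℝ) (P : Fin n → EuclideanSpace ℝ (Fin d))
    (ω : BuildSeed d k prm) : DataStructure n d k prm where
  points := fun i j => P i j
  tables := fun l => buildTable w D (ω l) fun i => padded prm.pad fun j => P i j

/-! ### The search procedure -/

/-- Lexicographic comparison `x < y` of two keys, over a list of coordinates. -/
def lexLt {k : ℕ} (x y : Fin k → ℤ) : List (Fin k) → Timed Bool
  | [] => step false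
  | i :: l => do
    let a ← readCell x i
    let b ← readCell y i
    let lt ← ltZ a b
    if lt then pure true
    else do
      let gt ← ltZ b a
      if gt then pure false else lexLt x y l

/-- Equality `x = y` of two keys, over a list of coordinates. -/
def keyEq {k : ℕ} (x y : Fin k → ℤ) : List (Fin k) → Timed Bool
  | [] => step true
  | i :: l => do
    let a ← readCell x i
    let b ← readCell y i
    let eq ← eqZ a b
    if eq then keyEq x y l else pure false

/-- Binary search: the number of keys that are lexicographically smaller than `x`, provided that
this number lies in `[pos, pos + 2 ^ b)`. -/
def binarySearch {n k : ℕ} (key : Fin n → Fin k → ℤ) (x : Fin k → ℤ) : ℕ → ℕ → Timed ℕ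
  | 0, pos => step pos
  | b + 1, pos => do
    -- computing `2 ^ b`, `pos + 2 ^ b` and `pos + 2 ^ b - 1`, and one comparison
    charge 4
    if h : pos + 2 ^ b ≤ n then do
      let y ← readCell key ⟨pos + 2 ^ b - 1, by have := Nat.two_pow_pos b; omega⟩
      let lt ← lexLt y x (List.finRange k)
      if lt then binarySearch key x b (pos + 2 ^ b) else binarySearch key x b pos
    else binarySearch key x b pos

/-- The squared Euclidean distance. -/
def sqDist {d : ℕ} (x y : Fin d → ℝ) : Timed ℝ :=
  Timed.sum fun j => do
    let a ← readCell x j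
    let b ← readCell y j
    let s ← subR a b
    mulR s s

/-- Scanning the bucket with key `x`, from the position `pos` of the table on, for a point whose
squared distance from `q` is at most `R2`. At most `budget` points are visited; the unused budget
is returned along with the result. -/
def scan {n d k : ℕ} (points : Fin n → Fin d → ℝ) {ι : Type} (T : Table n k ι)
    (q : Fin d → ℝ) (R2 : ℝ) (x : Fin k → ℤ) : ℕ → ℕ → Timed (Option (Fin n) × ℕ)
  | 0, _ => step (none, 0)
  | budget + 1, pos => do
    charge 1 -- the comparison of `pos` with `n`
    if h : pos < n then do
      let y ← readCell T.key ⟨pos, h⟩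
      let eq ← keyEq y x (List.finRange k)
      if eq then do
        let i ← readCell T.idx ⟨pos, h⟩
        let p ← readCell points i
        let s ← sqDist p q
        let near ← leR s R2
        if near then pure (some i, budget + 1)
        else do
          let pos' ← addN pos 1
          scan points T q R2 x budget pos'
      else pure (none, budget + 1)
    else pure (none, budget + 1)

/-- The random point `q + (t / ‖u‖) u` of the sphere of radius `t` around `q`; for a standard
normal vector `u` it is uniformly distributed on the sphere. Drawing one coordinate of `u` is one
step. -/
def samplePoint {ι : Type} [Fintype ι] (q : ι → ℝ) (t : ℝ) (u : ι → ℝ) : Timed (ι → ℝ) := do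
  let z ← tabulate fun i => readCell u i
  let s ← Timed.sum fun i => do
    let a ← readCell z i
    mulR a a
  let s ← sqrtR s
  let f ← divR t s
  tabulate fun i => do
    let a ← readCell z i
    let b ← readCell q i
    let a ← mulR f a
    addR b a

/-- Searching one table: for every pair `(j, t)` of the list, the `t`-th random point on the sphere
of radius `r (j + 1) / radii` around the query point is hashed, and its bucket is scanned. -/
def searchTable {n d k : ℕ} {prm : Params} (w D r R2 : ℝ) (points : Fin n → Fin d → ℝ)
    (T : Table n k (Coord d prm.pad)) (q : Fin d → ℝ) (q' : Coord d prm.pad → ℝ)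
    (u : Fin prm.radii × Fin prm.samples → Coord d prm.pad → ℝ) :
    List (Fin prm.radii × Fin prm.samples) → ℕ → Timed (Option (Fin n))
  | [], _ => step none
  | a :: l, budget => do
    let j ← natToR (a.1.val + 1)
    let m ← natToR prm.radii
    let t ← mulR r j
    let t ← divR t m
    let v ← samplePoint q' t (u a)
    let x ← computeHash w D T.fn v
    let pos ← binarySearch T.key x n.size 0
    let res ← scan points T q R2 x budget pos
    match res.1 with
    | some i => pure (some i)
    | none => searchTable w D r R2 points T q q' u l res.2

/-- Searching the tables of a list one after the other, each with the full budget. -/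
def searchTables {n d k : ℕ} {prm : Params} (w D r R2 : ℝ) (S : DataStructure n d k prm)
    (q : Fin d → ℝ) (q' : Coord d prm.pad → ℝ) (ω : SearchSeed d prm) :
    List (Fin prm.tables) → Timed (Option (Fin n))
  | [] => step none
  | l :: ls => do
    let T ← readCell S.tables l
    let res ← searchTable w D r R2 S.points T q q' (ω l)
      (List.finRange prm.radii ×ˢ List.finRange prm.samples) prm.budget
    match res with
    | some i => pure (some i)
    | none => searchTables w D r R2 S q q' ω ls

/-- The search for a point of the database at distance at most `c * r` from the query point. The
unit of length is `c * r`. -/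
def search {n d k : ℕ} {prm : Params} (c D r : ℝ) (S : DataStructure n d k prm)
    (q : EuclideanSpace ℝ (Fin d)) (ω : SearchSeed d prm) : Timed (Option (Fin n)) := do
  let x ← tabulate fun j : Fin d => readCell (fun j => q j) j
  let x' ← tabulate fun a : Coord d prm.pad => step (padded prm.pad x a)
  let w ← mulR c r
  let R2 ← mulR w w
  searchTables w D r R2 S x x' ω (List.finRange prm.tables)

/-! ### The random choices -/

/-- The standard normal distribution on `ℝ^ι`. -/
def normalVec (ι : Type) [Fintype ι] : Measure (ι → ℝ) := Measure.pi fun _ => gaussianReal 0 1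

/-- The law of a random hash function: an independent pair of a standard normal vector and a shift
that is uniformly distributed on `[0, D]`. -/
def hashLaw (ι : Type) [Fintype ι] (D : ℝ) : Measure (HashFn ι) :=
  (normalVec ι).prod (ProbabilityTheory.cond volume (Set.Icc 0 D))

/-- Independent random hash functions. -/
def buildLaw (d k : ℕ) (prm : Params) (D : ℝ) : Measure (BuildSeed d k prm) :=
  Measure.pi fun _ => Measure.pi fun _ => hashLaw (Coord d prm.pad) D

/-- Independent standard normal vectors. -/
def searchLaw (d : ℕ) (prm : Params) : Measure (SearchSeed d prm) :=
  Measure.pi fun _ => Measure.pi fun _ => normalVec (Coord d prm.pad)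

/-- The number `k` of hash functions per table: `log n / log (1 / g)`, rounded up. -/
def numHash (n : ℕ) (D : ℝ) : ℕ := ⌈Real.logb 2 n / Real.logb 2 (1 / collisionBound D)⌉₊

end EntropyNN

end

/-! ### Deterministic analysis of the search: step counts and correctness. -/

noncomputable section

namespace EntropyNN

open Timed

/-! ### Values and steps of the operations -/

namespace Timed

/-! Far points. With `c * r` as unit of length, one hash function makes two points at distance at
least one collide with probability at most `g` (`hashLaw_eq_le`), so `k` functions bring this down
to `g ^ k ≤ 1 / n`. The hashed points are not the query `q` but random points of spheres around `q`.
Thanks to the appended coordinates a random direction is almost orthogonal to the direction of any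
fixed far point, so a sample point is hardly closer to it than `q` is, and the collision probability
stays O(1/n) (`measure_far_collision_le`). A sample point therefore meets O(1) far points on
average, and Markov's inequality justifies a budget proportional, up to logarithms, to the number of
samples (`measure_budget_le`).

Near points. Few tables are stored, so a near point `p` need not share a bucket with `q`; its bucket
is guessed by drawing random points on the sphere around `q` through `p`. The number of guesses is
governed by an entropy. Fix the hash functions, let a random point of the sphere fall into cell `y`
with probability μ(y), and let W be weights of sum at most 1. A second random point falls into a
cell with μ(y) < δ W(y) with probability at most δ (`measure_lt_weight_le`). The law of the hash
functions is invariant under rotations, so the fixed point `p` behaves like that second random point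
(`lightEvent_congr`, `measure_lightEvent_le`).

The weight is 2^(-cost). The cost of a cell sums, over all boundaries of the partition of the line,
minus the logarithm of the probability that a normal variable lies on the same side as the cell.
That these weights have sum at most 1 is a Kraft inequality (`sum_cellWeight_le_one`). A random
shift spreads the boundaries uniformly with density 1/D, so a projection of standard deviation θ ≤
1/c has mean cost (θ/D) times the integral over the line of the entropy of the side, which is 2αθ/D
(`lintegral_cellCost`). For `k` functions this is at most ρ log n + O(1). Markov's inequality with
threshold M = mean + 1 leaves each table a success probability of order 1/M, and polylogarithmically
many independent tables with Õ(n^ρ) samples each reduce the failure probability to 1/n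
(`measure_search_params_none_le`).

The exponent for D = 3. Integration by parts turns α log 2 into the integral of φ²/(Φ(1-Φ)), where φ
is the normal density (`tendsto_integral_psi`). Its tail is controlled by Mills' ratio, and its
integral over [0, 3] is enclosed by integer arithmetic evaluated in the kernel (`lowerCheck_sound`,
`upperCheck_sound`). -/

@[simp] theorem val_bind {A B : Type} (x : Timed A) (f : A → Timed B) :
    (x >>= f).val = (f x.val).val := rfl

@[simp] theorem steps_bind {A B : Type} (x : Timed A) (f : A → Timed B) :
    (x >>= f).steps = x.steps + (f x.val).steps := rfl

@[simp] theorem val_pure {A : Type} (a : A) : (pure a : Timed A).val = a := rfl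

@[simp] theorem steps_pure {A : Type} (a : A) : (pure a : Timed A).steps = 0 := rfl

@[simp] theorem steps_tabulate {ι A : Type} [Fintype ι] (f : ι → Timed A) :
    (tabulate f).steps = ∑ i, ((f i).steps + 2) := rfl

@[simp] theorem steps_sum {ι : Type} [Fintype ι] (f : ι → Timed ℝ) :
    (Timed.sum f).steps = ∑ i, ((f i).steps + 2) := rfl

end Timed

@[simp] theorem val_computeHash {ι : Type} [Fintype ι] {k : ℕ} (w D : ℝ) (h : Fin k → HashFn ι)
    (x : ι → ℝ) : (computeHash w D h x).val = hashVec w D h x := rfl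

theorem steps_computeHash {ι : Type} [Fintype ι] {k : ℕ} (w D : ℝ) (h : Fin k → HashFn ι)
    (x : ι → ℝ) : (computeHash w D h x).steps = k * (5 * Fintype.card ι + 7) := by
  simp [computeHash]
  left; ring

theorem val_sqDist {d : ℕ} (x y : Fin d → ℝ) :
    (sqDist x y).val = ∑ j, (x j - y j) * (x j - y j) := rfl

theorem steps_sqDist {d : ℕ} (x y : Fin d → ℝ) : (sqDist x y).steps = d * 6 := by
  simp [sqDist]

/-- The point drawn by `samplePoint`. -/
def spherePoint {ι : Type} [Fintype ι] (q : ι → ℝ) (t : ℝ) (u : ι → ℝ) : ι → ℝ :=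
  fun i => q i + t / √(∑ i, u i * u i) * u i

@[simp] theorem val_samplePoint {ι : Type} [Fintype ι] (q : ι → ℝ) (t : ℝ) (u : ι → ℝ) :
    (samplePoint q t u).val = spherePoint q t u := rfl

theorem steps_samplePoint {ι : Type} [Fintype ι] (q : ι → ℝ) (t : ℝ) (u : ι → ℝ) :
    (samplePoint q t u).steps = 13 * Fintype.card ι + 2 := by
  simp [samplePoint]
  ring

/-! ### Comparison of keys -/

theorem steps_lexLt {k : ℕ} (x y : Fin k → ℤ) (l : List (Fin k)) :
    (lexLt x y l).steps ≤ 4 * l.length + 1 := by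
  induction l with
  | nil => simp [lexLt]
  | cons i l ih =>
    simp only [lexLt, steps_bind, List.length_cons]
    split
    · simp only [steps_pure]; omega
    · simp only [steps_bind]
      split
      · simp only [steps_pure]; omega
      · omega

theorem steps_keyEq {k : ℕ} (x y : Fin k → ℤ) (l : List (Fin k)) :
    (keyEq x y l).steps ≤ 3 * l.length + 1 := by
  induction l with
  | nil => simp [keyEq]
  | cons i l ih =>
    simp only [keyEq, steps_bind, List.length_cons]
    split
    · omega
    · simp only [steps_pure]; omega

theorem val_keyEq_list {k : ℕ} (x y : Fin k → ℤ) (l : List (Fin k)) :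
    (keyEq x y l).val = true ↔ ∀ i ∈ l, x i = y i := by
  induction l with
  | nil => simp [keyEq]
  | cons i l ih =>
    by_cases h : x i = y i <;> simp [keyEq, h, ih]

theorem val_keyEq {k : ℕ} (x y : Fin k → ℤ) :
    (keyEq x y (List.finRange k)).val = true ↔ x = y := by
  rw [val_keyEq_list]
  simp [funext_iff]

theorem val_lexLt_list {k : ℕ} (x y : Fin k → ℤ) (l : List (Fin k)) (hl : l.Pairwise (· < ·)) :
    (lexLt x y l).val = true ↔ ∃ i ∈ l, (∀ j ∈ l, j < i → x j = y j) ∧ x i < y i := by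
  induction l with
  | nil => simp [lexLt]
  | cons i l ih =>
    obtain ⟨h1, h2⟩ := List.pairwise_cons.1 hl
    have ih := ih h2
    rcases lt_trichotomy (x i) (y i) with h | h | h
    · simp only [lexLt, val_bind]
      simp only [h, decide_true, if_true, val_pure, true_iff]
      refine ⟨i, by simp, ?_, h⟩
      intro j hj hji
      rcases List.mem_cons.1 hj with rfl | hj
      · exact absurd hji (lt_irrefl _)
      · exact absurd (h1 j hj) (not_lt.2 hji.le)
    · simp only [lexLt, val_bind, h, lt_irrefl, decide_false, Bool.false_eq_true, if_false, ih]
      constructor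
      · rintro ⟨a, ha, hb, hc⟩
        refine ⟨a, by simp [ha], ?_, hc⟩
        intro j hj hja
        rcases List.mem_cons.1 hj with rfl | hj
        · exact h
        · exact hb j hj hja
      · rintro ⟨a, ha, hb, hc⟩
        rcases List.mem_cons.1 ha with rfl | ha
        · omega
        · exact ⟨a, ha, fun j hj => hb j (by simp [hj]), hc⟩
    · simp only [lexLt, val_bind]
      simp only [h.not_gt, decide_false, Bool.false_eq_true, if_false, val_bind]
      simp only [h, decide_true, if_true, val_pure, Bool.false_eq_true, false_iff]
      rintro ⟨a, ha, hb, hc⟩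
      rcases List.mem_cons.1 ha with rfl | ha
      · omega
      · have := hb i (by simp) (h1 a ha)
        omega

theorem val_lexLt {k : ℕ} (x y : Fin k → ℤ) :
    (lexLt x y (List.finRange k)).val = true ↔ toLex x < toLex y := by
  rw [val_lexLt_list _ _ _ (List.pairwise_lt_finRange k)]
  simp only [List.mem_finRange, true_and, forall_const]
  rfl

/-! ### Binary search -/

theorem steps_binarySearch {n k : ℕ} (key : Fin n → Fin k → ℤ) (x : Fin k → ℤ) (b pos : ℕ) :
    (binarySearch key x b pos).steps ≤ b * (4 * k + 6) + 1 := by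
  induction b generalizing pos with
  | zero => simp [binarySearch]
  | succ b ih =>
    simp only [binarySearch, steps_bind]
    split
    · have h1 := fun y => steps_lexLt (k := k) y x (List.finRange k)
      simp only [List.length_finRange] at h1
      rename_i hh
      have h1 := h1 (key ⟨pos + 2 ^ b - 1, by have := Nat.two_pow_pos b; omega⟩)
      simp only [steps_bind]
      split
      · have := ih (pos + 2 ^ b)
        linarith
      · have := ih pos
        linarith
    · have := ih pos
      linarith [Nat.zero_le k]

/-- Binary search in a sorted list of keys finds the first key that is not smaller. -/
theorem val_binarySearch {n k : ℕ} (key : Fin n → Fin k → ℤ) (hk : Monotone fun j => toLex (key j))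
    (x : Fin k → ℤ) (b pos : ℕ)
    (h1 : ∀ j : Fin n, j.val < pos → toLex (key j) < toLex x)
    (h2 : ∀ j : Fin n, pos + 2 ^ b ≤ j.val + 1 → toLex x ≤ toLex (key j)) :
    (∀ j : Fin n, j.val < (binarySearch key x b pos).val → toLex (key j) < toLex x) ∧
    ∀ j : Fin n, (binarySearch key x b pos).val ≤ j.val → toLex x ≤ toLex (key j) := by
  induction b generalizing pos with
  | zero =>
    simp only [binarySearch]
    refine ⟨h1, fun j hj => h2 j ?_⟩
    simpa using hj
  | succ b ih =>
    have hb := Nat.two_pow_pos b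
    simp only [binarySearch, val_bind]
    split
    · rename_i hp
      simp only [val_bind]
      split
      · rename_i hlt
        rw [val_lexLt] at hlt
        refine ih _ ?_ ?_
        · intro j hj
          refine lt_of_le_of_lt (hk (?_ : j ≤ ⟨pos + 2 ^ b - 1, by omega⟩)) hlt
          simp only [Fin.le_def]; omega
        · intro j hj
          refine h2 j ?_
          rw [pow_succ]; omega
      · rename_i hlt
        rw [val_lexLt] at hlt
        have hlt := not_lt.1 hlt
        refine ih _ h1 ?_
        intro j hj
        refine le_trans hlt (hk ?_)
        simp only [Fin.le_def]; omega
    · refine ih _ h1 ?_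
      intro j hj
      have := j.2
      omega

/-! ### Scanning a bucket -/

/-- Amortized accounting: a visited point costs at most `3 * k + 6 * d + 7` steps and one unit of
budget, and the unused budget is a credit for later scans. The extra unit in `budget + 1` pays for
the probe that ends the scan. -/
theorem steps_scan {n d k : ℕ} (points : Fin n → Fin d → ℝ) {ι : Type} (T : Table n k ι)
    (q : Fin d → ℝ) (R2 : ℝ) (x : Fin k → ℤ) (budget pos : ℕ) :
    (scan points T q R2 x budget pos).steps + (scan points T q R2 x budget pos).val.2 *
      (3 * k + 6 * d + 7) ≤ (budget + 1) * (3 * k + 6 * d + 7) := by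
  induction budget generalizing pos with
  | zero => simp [scan]
  | succ b ih =>
    simp only [scan, steps_bind, val_bind]
    split
    · rename_i hp
      have h1 := steps_keyEq (T.key ⟨pos, hp⟩) x (List.finRange k)
      simp only [List.length_finRange] at h1
      simp only [steps_bind, val_bind]
      split
      · simp only [steps_bind, val_bind, steps_sqDist]
        split
        · simp only [steps_pure, val_pure]
          nlinarith
        · have := ih (pos + 1)
          simp only [steps_bind, val_bind]
          nlinarith
      · simp only [steps_pure, val_pure]
        nlinarith
    · simp only [steps_pure, val_pure]
      nlinarith

/-- A point that is found by `scan` is near. -/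
theorem scan_sound {n d k : ℕ} (points : Fin n → Fin d → ℝ) {ι : Type} (T : Table n k ι)
    (q : Fin d → ℝ) (R2 : ℝ) (x : Fin k → ℤ) (budget pos : ℕ) (i : Fin n)
    (h : (scan points T q R2 x budget pos).val.1 = some i) :
    (sqDist (points i) q).val ≤ R2 := by
  induction budget generalizing pos with
  | zero => simp [scan] at h
  | succ b ih =>
    simp only [scan, val_bind] at h
    split at h
    · simp only [val_bind] at h
      split at h
      · simp only [val_bind] at h
        split at h
        · rename_i hn
          simp only [val_pure, Option.some.injEq] at h
          subst h
          simpa using hn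
        · exact ih _ h
      · simp at h
    · simp at h

/-- If the scan of a bucket finds nothing although the budget exceeds the number of far points of
the bucket, then all points of the bucket are far, and they are all that is charged. -/
theorem scan_none {n d k : ℕ} (points : Fin n → Fin d → ℝ) {ι : Type} (T : Table n k ι)
    (hT : Monotone fun j => toLex (T.key j)) (q : Fin d → ℝ) (R2 : ℝ) (x : Fin k → ℤ)
    (budget pos : ℕ) (hpos : ∀ j : Fin n, pos ≤ j.val → toLex x ≤ toLex (T.key j))
    (h : (scan points T q R2 x budget pos).val.1 = none)
    (hb : (Finset.univ.filter fun j : Fin n => pos ≤ j.val ∧ T.key j = x ∧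
      R2 < (sqDist (points (T.idx j)) q).val).card < budget) :
    (∀ j : Fin n, pos ≤ j.val → T.key j = x → R2 < (sqDist (points (T.idx j)) q).val) ∧
    budget ≤ (scan points T q R2 x budget pos).val.2 +
      (Finset.univ.filter fun j : Fin n => pos ≤ j.val ∧ T.key j = x ∧
        R2 < (sqDist (points (T.idx j)) q).val).card := by
  induction budget generalizing pos with
  | zero => omega
  | succ b ih =>
    by_cases hp : pos < n
    · by_cases he : T.key ⟨pos, hp⟩ = x
      · have he' := (val_keyEq (T.key ⟨pos, hp⟩) x).2 he
        by_cases hn : (sqDist (points (T.idx ⟨pos, hp⟩)) q).val ≤ R2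
        · simp [scan, hp, he', hn] at h
        · have hs : (scan points T q R2 x (b + 1) pos).val =
              (scan points T q R2 x b (pos + 1)).val := by
            simp [scan, hp, he', hn]
          rw [hs] at h ⊢
          have hc : (Finset.univ.filter fun j : Fin n => pos ≤ j.val ∧ T.key j = x ∧
              R2 < (sqDist (points (T.idx j)) q).val) = insert ⟨pos, hp⟩
              (Finset.univ.filter fun j : Fin n => pos + 1 ≤ j.val ∧ T.key j = x ∧
              R2 < (sqDist (points (T.idx j)) q).val) := by
            ext j
            simp only [Finset.mem_filter, Finset.mem_univ, true_and, Finset.mem_insert]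
            constructor
            · rintro ⟨h1, h2, h3⟩
              rcases eq_or_lt_of_le h1 with h1 | h1
              · left; ext; exact h1.symm
              · right; exact ⟨h1, h2, h3⟩
            · rintro (rfl | ⟨h1, h2, h3⟩)
              · exact ⟨le_refl _, he, not_le.1 hn⟩
              · exact ⟨by omega, h2, h3⟩
          rw [hc, Finset.card_insert_of_notMem (by simp)] at hb
          rw [hc, Finset.card_insert_of_notMem (by simp)]
          obtain ⟨h1, h2⟩ := ih (pos + 1) (fun j hj => hpos j (by omega)) h (by omega)
          refine ⟨?_, by omega⟩
          intro j hj hjx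
          rcases eq_or_lt_of_le hj with hj | hj
          · have : j = ⟨pos, hp⟩ := by ext; exact hj.symm
            subst this
            exact not_le.1 hn
          · exact h1 j hj hjx
      · have he' : (keyEq (T.key ⟨pos, hp⟩) x (List.finRange k)).val = false := by
          rw [← Bool.not_eq_true, val_keyEq]; exact he
        have hs : (scan points T q R2 x (b + 1) pos).val = (none, b + 1) := by
          simp [scan, hp, he']
        rw [hs]
        refine ⟨?_, by simp⟩
        intro j hj hjx
        -- The keys are sorted and none from `pos` on is below `x`, so once a key differs from `x`
        -- no later key equals `x`: nothing is missed by stopping here.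
        have h1 : toLex x ≤ toLex (T.key ⟨pos, hp⟩) := hpos _ le_rfl
        have h2 : toLex (T.key ⟨pos, hp⟩) ≤ toLex (T.key j) :=
          hT (show (⟨pos, hp⟩ : Fin n) ≤ j from hj)
        rw [hjx] at h2
        exact absurd (toLex.injective (le_antisymm h2 h1)) he
    · have hs : (scan points T q R2 x (b + 1) pos).val = (none, b + 1) := by
        simp [scan, hp]
      rw [hs]
      refine ⟨?_, by simp⟩
      intro j hj
      have := j.2
      omega

end EntropyNN

end

noncomputable section

namespace EntropyNN

open Timed

/-! ### Searching a table -/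

/-- The radius of the `j`-th sphere. -/
def sphereRadius (r : ℝ) (J : ℕ) (j : Fin J) : ℝ := r * ((j.val + 1 : ℕ) : ℝ) / (J : ℝ)

theorem monotone_buildTable {n k : ℕ} {ι : Type} [Fintype ι] (w D : ℝ) (fn : Fin k → HashFn ι)
    (x : Fin n → ι → ℝ) : Monotone fun j => toLex ((buildTable w D fn x).key j) :=
  Tuple.monotone_sort fun i => toLex (hashVec w D fn (x i))

/-- The number of far points in the bucket of `v`. -/
def farCount {n k : ℕ} {ι : Type} [Fintype ι] (w D : ℝ) (fn : Fin k → HashFn ι)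
    (x : Fin n → ι → ℝ) (far : Fin n → Prop) (v : ι → ℝ) : ℕ :=
  Nat.card {i : Fin n // far i ∧ hashVec w D fn (x i) = hashVec w D fn v}

/-- The specification of a scan of the bucket of `v` that starts from the position found by binary
search. -/
theorem bucket_none {n d k : ℕ} {ι : Type} [Fintype ι] (w D : ℝ) (fn : Fin k → HashFn ι)
    (x : Fin n → ι → ℝ) (points : Fin n → Fin d → ℝ) (q : Fin d → ℝ) (R2 : ℝ) (v : ι → ℝ)
    (budget : ℕ)
    (h : (scan points (buildTable w D fn x) q R2 (hashVec w D fn v) budget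
      (binarySearch (buildTable w D fn x).key (hashVec w D fn v) n.size 0).val).val.1 = none)
    (hb : farCount w D fn x (fun i => R2 < (sqDist (points i) q).val) v < budget) :
    (∀ i, hashVec w D fn (x i) = hashVec w D fn v → R2 < (sqDist (points i) q).val) ∧
    budget ≤ (scan points (buildTable w D fn x) q R2 (hashVec w D fn v) budget
      (binarySearch (buildTable w D fn x).key (hashVec w D fn v) n.size 0).val).val.2 +
      farCount w D fn x (fun i => R2 < (sqDist (points i) q).val) v := by
  classical
  set T := buildTable w D fn x with hTdef
  have hT : Monotone fun j => toLex (T.key j) := monotone_buildTable w D fn x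
  set y := hashVec w D fn v
  -- The initial range has length `2 ^ n.size > n`, which makes the condition on its right end
  -- vacuous.
  obtain ⟨hp1, hp2⟩ := val_binarySearch T.key hT y n.size 0 (by simp) (by
    intro j hj
    have := n.lt_size_self
    have := j.2
    omega)
  set pos := (binarySearch T.key y n.size 0).val
  set σ := Tuple.sort fun i => toLex (hashVec w D fn (x i)) with hσ
  -- The sorting permutation matches table entries with database points. No entry of the bucket lies
  -- before `pos`, because the keys there are strictly smaller, so the condition `pos ≤ j` loses
  -- nothing.
  have hcard : (Finset.univ.filter fun j : Fin n => pos ≤ j.val ∧ T.key j = y ∧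
      R2 < (sqDist (points (T.idx j)) q).val).card =
      farCount w D fn x (fun i => R2 < (sqDist (points i) q).val) v := by
    rw [farCount, Nat.card_eq_fintype_card, Fintype.card_subtype]
    refine Finset.card_bij (fun j _ => σ j) ?_ ?_ ?_
    · intro j hj
      simp only [Finset.mem_filter, Finset.mem_univ, true_and] at hj ⊢
      exact ⟨hj.2.2, hj.2.1⟩
    · intro a _ b _ hab
      exact σ.injective hab
    · intro i hi
      simp only [Finset.mem_filter, Finset.mem_univ, true_and] at hi
      have hk : T.key (σ.symm i) = y := by
        rw [hTdef]
        simp [buildTable, ← hσ, hi.2, y]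
      refine ⟨σ.symm i, ?_, by simp⟩
      simp only [Finset.mem_filter, Finset.mem_univ, true_and]
      refine ⟨?_, hk, ?_⟩
      · by_contra hlt
        have := hp1 _ (not_le.1 hlt)
        rw [hk] at this
        exact lt_irrefl _ this
      · have : T.idx (σ.symm i) = i := by
          rw [hTdef]; simp [buildTable, hσ]
        rw [this]; exact hi.1
  obtain ⟨h1, h2⟩ := scan_none points T hT q R2 y budget pos hp2 h (by rw [hcard]; exact hb)
  refine ⟨?_, by rw [← hcard]; exact h2⟩
  intro i hi
  have hk : T.key (σ.symm i) = y := by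
    rw [← hi, hTdef]
    simp [buildTable, hσ]
  have hidx : T.idx (σ.symm i) = i := by
    rw [hTdef]; simp [buildTable, hσ]
  have := h1 (σ.symm i) (by
    by_contra hlt
    have := hp1 _ (not_le.1 hlt)
    rw [hk] at this
    exact lt_irrefl _ this) hk
  rwa [hidx] at this

theorem searchTable_sound {n d k : ℕ} {prm : Params} (w D r R2 : ℝ) (points : Fin n → Fin d → ℝ)
    (T : Table n k (Coord d prm.pad)) (q : Fin d → ℝ) (q' : Coord d prm.pad → ℝ)
    (u : Fin prm.radii × Fin prm.samples → Coord d prm.pad → ℝ)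
    (l : List (Fin prm.radii × Fin prm.samples)) (budget : ℕ) (i : Fin n)
    (h : (searchTable w D r R2 points T q q' u l budget).val = some i) :
    (sqDist (points i) q).val ≤ R2 := by
  induction l generalizing budget with
  | nil => simp [searchTable] at h
  | cons a l ih =>
    simp only [searchTable, val_bind] at h
    split at h
    · rename_i i' hi'
      simp only [val_pure, Option.some.injEq] at h
      subst h
      exact scan_sound _ _ _ _ _ _ _ _ hi'
    · exact ih _ h

/-- If the search of a table fails although the budget is not exhausted, then no bucket of a sample
point contains a near point. -/
theorem searchTable_none {n d k : ℕ} {prm : Params} (w D r R2 : ℝ) (points : Fin n → Fin d → ℝ)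
    (fn : Fin k → HashFn (Coord d prm.pad)) (x : Fin n → Coord d prm.pad → ℝ)
    (q : Fin d → ℝ) (q' : Coord d prm.pad → ℝ)
    (u : Fin prm.radii × Fin prm.samples → Coord d prm.pad → ℝ)
    (l : List (Fin prm.radii × Fin prm.samples)) (budget : ℕ)
    (h : (searchTable w D r R2 points (buildTable w D fn x) q q' u l budget).val = none)
    (hb : (l.map fun a => farCount w D fn x (fun i => R2 < (sqDist (points i) q).val)
      (spherePoint q' (sphereRadius r prm.radii a.1) (u a))).sum < budget) :
    ∀ a ∈ l, ∀ i, hashVec w D fn (x i) =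
      hashVec w D fn (spherePoint q' (sphereRadius r prm.radii a.1) (u a)) →
        R2 < (sqDist (points i) q).val := by
  induction l generalizing budget with
  | nil => simp
  | cons a l ih =>
    simp only [List.map_cons, List.sum_cons] at hb
    simp only [searchTable, val_bind, val_samplePoint, val_computeHash] at h
    split at h
    · simp at h
    · rename_i hn
      obtain ⟨h1, h2⟩ := bucket_none w D fn x points q R2
        (spherePoint q' (sphereRadius r prm.radii a.1) (u a)) budget hn (by omega)
      intro b hbl
      rcases List.mem_cons.1 hbl with rfl | hbl
      · exact h1
      · refine ih _ h ?_ b hbl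
        have h2' := h2
        simp only [sphereRadius] at h2' hb ⊢
        have : (buildTable w D fn x).fn = fn := rfl
        rw [this]
        omega

/-- Since unused budget is handed from scan to scan, `steps_scan` telescopes: visited points are
paid once by `budget`, and each sample point adds only its drawing, hashing, binary search and one
final probe. -/
theorem steps_searchTable {n d k : ℕ} {prm : Params} (w D r R2 : ℝ) (points : Fin n → Fin d → ℝ)
    (T : Table n k (Coord d prm.pad)) (q : Fin d → ℝ) (q' : Coord d prm.pad → ℝ)
    (u : Fin prm.radii × Fin prm.samples → Coord d prm.pad → ℝ)
    (l : List (Fin prm.radii × Fin prm.samples)) (budget : ℕ) :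
    (searchTable w D r R2 points T q q' u l budget).steps ≤
      l.length * ((13 * (d + prm.pad) + k * (5 * (d + prm.pad) + 7) + n.size * (4 * k + 6) + 7) +
        (3 * k + 6 * d + 7)) + budget * (3 * k + 6 * d + 7) + 1 := by
  induction l generalizing budget with
  | nil => simp [searchTable]
  | cons a l ih =>
    simp only [searchTable, steps_bind, steps_samplePoint, steps_computeHash,
      List.length_cons, Fintype.card_sum, Fintype.card_fin]
    have h1 := fun y => steps_binarySearch T.key y n.size 0
    have h2 := steps_scan points T q R2
    split
    · simp only [steps_pure]
      have h1' := h1 (hashVec w D T.fn (samplePoint q' (r * ((a.1.val + 1 : ℕ) : ℝ) /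
        (prm.radii : ℝ)) (u a)).val)
      have h2' := h2 (hashVec w D T.fn (samplePoint q' (r * ((a.1.val + 1 : ℕ) : ℝ) /
        (prm.radii : ℝ)) (u a)).val) budget (binarySearch T.key (hashVec w D T.fn (samplePoint q' (r * ((a.1.val + 1 : ℕ) : ℝ) /
        (prm.radii : ℝ)) (u a)).val) n.size 0).val
      simp only [val_computeHash] at h1' h2' ⊢
      have h3 := Nat.zero_le ((scan points T q R2 (hashVec w D T.fn (samplePoint q'
        (r * ((a.1.val + 1 : ℕ) : ℝ) / (prm.radii : ℝ)) (u a)).val) budget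
        (binarySearch T.key (hashVec w D T.fn (samplePoint q' (r * ((a.1.val + 1 : ℕ) : ℝ) /
        (prm.radii : ℝ)) (u a)).val) n.size 0).val).val.2 * (3 * k + 6 * d + 7))
      have h4 := Nat.zero_le (l.length * ((13 * (d + prm.pad) + k * (5 * (d + prm.pad) + 7) +
        n.size * (4 * k + 6) + 7) + (3 * k + 6 * d + 7)))
      linarith
    · have h1' := h1 (hashVec w D T.fn (samplePoint q' (r * ((a.1.val + 1 : ℕ) : ℝ) /
        (prm.radii : ℝ)) (u a)).val)
      have h2' := h2 (hashVec w D T.fn (samplePoint q' (r * ((a.1.val + 1 : ℕ) : ℝ) /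
        (prm.radii : ℝ)) (u a)).val) budget (binarySearch T.key (hashVec w D T.fn (samplePoint q' (r * ((a.1.val + 1 : ℕ) : ℝ) /
        (prm.radii : ℝ)) (u a)).val) n.size 0).val
      simp only [val_computeHash] at h1' h2' ⊢
      refine le_trans (Nat.add_le_add_left (Nat.add_le_add_left (Nat.add_le_add_left
        (Nat.add_le_add_left (Nat.add_le_add_left (Nat.add_le_add_left (Nat.add_le_add_left
        (Nat.add_le_add_left (ih _) _) _) _) _) _) _) _) _) ?_
      nlinarith

/-! ### The search -/

theorem searchTables_sound {n d k : ℕ} {prm : Params} (w D r R2 : ℝ) (S : DataStructure n d k prm)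
    (q : Fin d → ℝ) (q' : Coord d prm.pad → ℝ) (ω : SearchSeed d prm)
    (ls : List (Fin prm.tables)) (i : Fin n)
    (h : (searchTables w D r R2 S q q' ω ls).val = some i) :
    (sqDist (S.points i) q).val ≤ R2 := by
  induction ls with
  | nil => simp [searchTables] at h
  | cons l ls ih =>
    simp only [searchTables, val_bind] at h
    split at h
    · rename_i i' hi'
      simp only [val_pure, Option.some.injEq] at h
      subst h
      exact searchTable_sound _ _ _ _ _ _ _ _ _ _ _ _ hi'
    · exact ih h

theorem searchTables_none {n d k : ℕ} {prm : Params} (w D r R2 : ℝ) (S : DataStructure n d k prm)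
    (q : Fin d → ℝ) (q' : Coord d prm.pad → ℝ) (ω : SearchSeed d prm)
    (ls : List (Fin prm.tables)) (h : (searchTables w D r R2 S q q' ω ls).val = none) :
    ∀ l ∈ ls, (searchTable w D r R2 S.points (S.tables l) q q' (ω l)
      (List.finRange prm.radii ×ˢ List.finRange prm.samples) prm.budget).val = none := by
  induction ls with
  | nil => simp
  | cons l ls ih =>
    simp only [searchTables, val_bind] at h
    split at h
    · simp at h
    · rename_i hn
      intro l' hl'
      rcases List.mem_cons.1 hl' with rfl | hl'
      · exact hn
      · exact ih h l' hl'

theorem steps_searchTables {n d k : ℕ} {prm : Params} (w D r R2 : ℝ) (S : DataStructure n d k prm)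
    (q : Fin d → ℝ) (q' : Coord d prm.pad → ℝ) (ω : SearchSeed d prm)
    (ls : List (Fin prm.tables)) {A : ℕ}
    (hA : ∀ l, (searchTable w D r R2 S.points (S.tables l) q q' (ω l)
      (List.finRange prm.radii ×ˢ List.finRange prm.samples) prm.budget).steps ≤ A) :
    (searchTables w D r R2 S q q' ω ls).steps ≤ ls.length * (A + 1) + 1 := by
  induction ls with
  | nil => simp [searchTables]
  | cons l ls ih =>
    simp only [searchTables, steps_bind, List.length_cons]
    have := hA l
    split
    · simp only [steps_pure]; nlinarith
    · nlinarith

theorem steps_search {n d k : ℕ} {prm : Params} (c D r : ℝ) (S : DataStructure n d k prm)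
    (q : EuclideanSpace ℝ (Fin d)) (ω : SearchSeed d prm) :
    (search c D r S q ω).steps ≤ d * 3 + (d + prm.pad) * 3 + 2 + (prm.tables *
      (prm.radii * prm.samples * ((13 * (d + prm.pad) + k * (5 * (d + prm.pad) + 7) +
        n.size * (4 * k + 6) + 7) + (3 * k + 6 * d + 7)) + prm.budget * (3 * k + 6 * d + 7) + 2)
        + 1) := by
  have h := fun R2 x x' => steps_searchTables (c * r) D r R2 S x x' ω (List.finRange prm.tables)
    (fun l => steps_searchTable (c * r) D r R2 S.points (S.tables l) x x' (ω l) _ _)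
  simp only [List.length_finRange, List.length_product] at h
  simp only [search, steps_bind, steps_tabulate, Finset.sum_const, Finset.card_univ,
    Fintype.card_sum, Fintype.card_fin, smul_eq_mul, Nat.reduceAdd]
  refine le_trans (Nat.add_le_add_left (Nat.add_le_add_left (Nat.add_le_add_left
    (Nat.add_le_add_left (h _ _ _) _) _) _) _) ?_
  simp only [add_assoc, Nat.reduceAdd]
  omega

theorem sqDist_le_iff {d : ℕ} (p q : EuclideanSpace ℝ (Fin d)) {w : ℝ} (hw : 0 ≤ w) :
    (sqDist (fun j => p j) (fun j => q j)).val ≤ w * w ↔ dist p q ≤ w := by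
  rw [EuclideanSpace.dist_eq, Real.sqrt_le_left hw, val_sqDist]
  simp only [Real.dist_eq, sq_abs]
  simp only [sq]

theorem search_sound {n d k : ℕ} {prm : Params} {c D r : ℝ} (hw : 0 ≤ c * r)
    (P : Fin n → EuclideanSpace ℝ (Fin d)) (ω : BuildSeed d k prm)
    (q : EuclideanSpace ℝ (Fin d)) (ω' : SearchSeed d prm) (i : Fin n)
    (h : (search c D r (build (c * r) D P ω) q ω').val = some i) : dist (P i) q ≤ c * r := by
  rw [← sqDist_le_iff _ _ hw]
  exact searchTables_sound _ _ _ _ _ _ _ _ _ _ h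

/-- The event that the search of a table may fail: too many far points collide with sample points,
or no point close to the query collides with a sample point. -/
def tableFail {n d k : ℕ} {prm : Params} (w D r : ℝ) (P : Fin n → EuclideanSpace ℝ (Fin d))
    (q : EuclideanSpace ℝ (Fin d)) (fn : Fin k → HashFn (Coord d prm.pad))
    (u : Fin prm.radii × Fin prm.samples → Coord d prm.pad → ℝ) : Prop :=
  prm.budget ≤ ∑ a, farCount w D fn (fun i => padded prm.pad fun j => P i j)
      (fun i => w < dist (P i) q)
      (spherePoint (padded prm.pad fun j => q j) (sphereRadius r prm.radii a.1) (u a)) ∨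
    ∀ a i, dist (P i) q ≤ w → hashVec w D fn (padded prm.pad fun j => P i j) ≠
      hashVec w D fn (spherePoint (padded prm.pad fun j => q j) (sphereRadius r prm.radii a.1)
        (u a))

/-- The interface between program and probability: from here on only the event `tableFail`, which
involves the random choices of a single table, has to be estimated. -/
theorem search_none {n d k : ℕ} {prm : Params} {c D r : ℝ} (hw : 0 ≤ c * r)
    (P : Fin n → EuclideanSpace ℝ (Fin d)) (ω : BuildSeed d k prm)
    (q : EuclideanSpace ℝ (Fin d)) (ω' : SearchSeed d prm)
    (h : (search c D r (build (c * r) D P ω) q ω').val = none) (l : Fin prm.tables) :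
    tableFail (c * r) D r P q (ω l) (ω' l) := by
  have h1 := searchTables_none _ _ _ _ _ _ _ _ _ h l (List.mem_finRange l)
  rw [tableFail, or_iff_not_imp_left, not_le]
  intro hb a i hi heq
  have hfar : (fun i => (c * r) * (c * r) < (sqDist (fun j => P i j) (fun j => q j)).val) =
      fun i => c * r < dist (P i) q := by
    funext i
    rw [← not_le, sqDist_le_iff _ _ hw, not_le]
  have h2 := searchTable_none (c * r) D r ((c * r) * (c * r)) (fun i j => P i j) (ω l)
    (fun i => padded prm.pad fun j => P i j) (fun j => q j) (padded prm.pad fun j => q j) (ω' l)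
    (List.finRange prm.radii ×ˢ List.finRange prm.samples) prm.budget h1 (by
      rw [hfar]
      refine lt_of_eq_of_lt ?_ hb
      rw [← List.sum_toFinset]
      · refine Finset.sum_congr ?_ fun _ _ => rfl
        ext ⟨a, b⟩; simp
      · exact (List.nodup_finRange _).product (List.nodup_finRange _)) a
      (List.pair_mem_product.2 ⟨List.mem_finRange _, List.mem_finRange _⟩) i heq
  rw [← not_le, sqDist_le_iff _ _ hw] at h2
  exact h2 hi

end EntropyNN

end

/-! ### Normal vectors, random shifts and the collision probability of one hash function. -/

noncomputable section

namespace EntropyNN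

open scoped Matrix ENNReal

/-! ### Standard normal vectors -/

instance (ι : Type) [Fintype ι] : IsProbabilityMeasure (normalVec ι) := by
  unfold normalVec; infer_instance

/-- The Euclidean norm of a vector of `ι → ℝ`. -/
def euclNorm {ι : Type} [Fintype ι] (x : ι → ℝ) : ℝ := √(x ⬝ᵥ x)

variable {ι : Type} [Fintype ι]

theorem euclNorm_eq (x : ι → ℝ) : euclNorm x = ‖WithLp.toLp 2 x‖ := by
  rw [EuclideanSpace.norm_eq, euclNorm, dotProduct]
  simp [sq]

theorem euclNorm_nonneg (x : ι → ℝ) : 0 ≤ euclNorm x := Real.sqrt_nonneg _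

theorem euclNorm_smul (c : ℝ) (x : ι → ℝ) : euclNorm (c • x) = |c| * euclNorm x := by
  rw [euclNorm_eq, euclNorm_eq, WithLp.toLp_smul, norm_smul, Real.norm_eq_abs]

theorem euclNorm_mul_self (x : ι → ℝ) : euclNorm x * euclNorm x = x ⬝ᵥ x :=
  Real.mul_self_sqrt (Finset.sum_nonneg fun i _ => mul_self_nonneg (x i))

/-- The type `ι → ℝ` carries the supremum norm; passing to `EuclideanSpace` gives access to the
invariance of the Gaussian measure under linear isometries. -/
theorem measurePreserving_toLp :
    MeasurePreserving (WithLp.toLp 2 : (ι → ℝ) → EuclideanSpace ℝ ι) (normalVec ι)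
      (stdGaussian (EuclideanSpace ℝ ι)) :=
  ⟨by fun_prop, map_pi_eq_stdGaussian⟩

theorem measurePreserving_ofLp :
    MeasurePreserving (WithLp.ofLp : EuclideanSpace ℝ ι → (ι → ℝ))
      (stdGaussian (EuclideanSpace ℝ ι)) (normalVec ι) := by
  refine ⟨by fun_prop, ?_⟩
  rw [← measurePreserving_toLp.map_eq, Measure.map_map (by fun_prop) (by fun_prop)]
  exact Measure.map_id

/-- Two unit vectors are exchanged by an orthogonal involution. -/
theorem exists_orthogonal_involution {a b : ι → ℝ} (ha : euclNorm a = 1) (hb : euclNorm b = 1) :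
    ∃ R : (ι → ℝ) → (ι → ℝ), MeasurePreserving R (normalVec ι) (normalVec ι) ∧
      (∀ x y, R x ⬝ᵥ y = x ⬝ᵥ R y) ∧ (∀ x, R (R x) = x) ∧ (∀ (c : ℝ) x, R (c • x) = c • R x) ∧
      R a = b := by
  rw [euclNorm_eq] at ha hb
  -- The reflection in the hyperplane orthogonal to `a - b` (the identity if `a = b`) exchanges two
  -- vectors of equal norm.
  set S : EuclideanSpace ℝ ι ≃ₗᵢ[ℝ] EuclideanSpace ℝ ι :=
    ((ℝ ∙ (WithLp.toLp 2 a - WithLp.toLp 2 b))ᗮ).reflection with hS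
  have hSS : ∀ x, S (S x) = x := fun x => Submodule.reflection_reflection _ x
  have hin : ∀ x y : ι → ℝ, inner ℝ (WithLp.toLp 2 x) (WithLp.toLp 2 y) = x ⬝ᵥ y := by
    intro x y
    rw [EuclideanSpace.inner_toLp_toLp, dotProduct_comm]
    simp
  refine ⟨fun x => WithLp.ofLp (S (WithLp.toLp 2 x)), ?_, ?_, ?_, ?_, ?_⟩
  · have hm : MeasurePreserving S (stdGaussian (EuclideanSpace ℝ ι))
      (stdGaussian (EuclideanSpace ℝ ι)) := ⟨S.continuous.measurable, stdGaussian_map S⟩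
    exact (measurePreserving_ofLp.comp hm).comp measurePreserving_toLp
  · intro x y
    rw [← hin, ← hin]
    simp only [WithLp.toLp_ofLp]
    rw [← S.inner_map_map, hSS]
  · intro x
    simp [hSS]
  · intro c x
    simp
  · have : S (WithLp.toLp 2 a) = WithLp.toLp 2 b :=
      Submodule.reflection_sub (by rw [ha, hb])
    simp [this]

/-- A standard normal vector is standard normal in every direction. -/
theorem map_dotProduct_normalVec {a : ι → ℝ} (ha : euclNorm a = 1) :
    (normalVec ι).map (fun v => v ⬝ᵥ a) = gaussianReal 0 1 := by
  set L : StrongDual ℝ (EuclideanSpace ℝ ι) := innerSL ℝ (WithLp.toLp 2 a)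
  have h : (fun v : ι → ℝ => v ⬝ᵥ a) = L ∘ WithLp.toLp 2 := by
    funext v
    simp [L, EuclideanSpace.inner_toLp_toLp]
  rw [h, ← Measure.map_map L.continuous.measurable (by fun_prop),
    measurePreserving_toLp.map_eq, IsGaussian.map_eq_gaussianReal,
    integral_strongDual_stdGaussian, variance_dual_stdGaussian, innerSL_apply_norm, ← euclNorm_eq,
    ha]
  simp

theorem measurable_dotProduct (a : ι → ℝ) : Measurable fun v : ι → ℝ => v ⬝ᵥ a := by
  unfold dotProduct; fun_prop

theorem lintegral_dotProduct_normalVec {f : ℝ → ℝ≥0∞} (hf : Measurable f) {a : ι → ℝ}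
    (ha : euclNorm a = 1) :
    ∫⁻ v, f (v ⬝ᵥ a) ∂(normalVec ι) = ∫⁻ x, f x ∂(gaussianReal 0 1) := by
  rw [← map_dotProduct_normalVec ha, lintegral_map hf (measurable_dotProduct a)]

theorem lintegral_dotProduct_normalVec' {f : ℝ → ℝ≥0∞} (hf : Measurable f) (x : ι → ℝ) :
    ∫⁻ v, f (v ⬝ᵥ x) ∂(normalVec ι) = ∫⁻ g, f (euclNorm x * g) ∂(gaussianReal 0 1) := by
  by_cases hx : euclNorm x = 0
  · have : x = 0 := by
      rw [euclNorm_eq, norm_eq_zero] at hx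
      simpa using congrArg WithLp.ofLp hx
    simp only [hx]
    simp [this]
  · have h1 : euclNorm ((euclNorm x)⁻¹ • x) = 1 := by
      rw [euclNorm_smul, abs_of_nonneg (inv_nonneg.2 (euclNorm_nonneg x)), inv_mul_cancel₀ hx]
    rw [← lintegral_dotProduct_normalVec (f := fun g => f (euclNorm x * g)) (by fun_prop) h1]
    refine lintegral_congr fun v => ?_
    rw [dotProduct_smul, smul_eq_mul, mul_inv_cancel_left₀ hx]

/-! ### Random shifts -/

/-- The uniform distribution of the shift. -/
def shiftLaw (D : ℝ) : Measure ℝ := ProbabilityTheory.cond volume (Set.Icc 0 D)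

theorem isProbabilityMeasure_shiftLaw {D : ℝ} (hD : 0 < D) : IsProbabilityMeasure (shiftLaw D) := by
  refine cond_isProbabilityMeasure_of_finite ?_ ?_
  · simp [hD]
  · simp

theorem lintegral_shiftLaw (D : ℝ) (f : ℝ → ℝ≥0∞) :
    ∫⁻ b, f b ∂(shiftLaw D) = (ENNReal.ofReal D)⁻¹ * ∫⁻ b in Set.Ioc 0 D, f b := by
  rw [shiftLaw, ProbabilityTheory.cond, lintegral_smul_measure, Real.volume_Icc, sub_zero,
    smul_eq_mul, restrict_Ioc_eq_restrict_Icc]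

/-- Both (0, D] and (a, a + D] are fundamental domains for the translations by multiples of `D`. -/
theorem lintegral_Ioc_add_of_periodic {D : ℝ} (hD : 0 < D) {f : ℝ → ℝ≥0∞}
    (hf : Function.Periodic f D) (a : ℝ) :
    ∫⁻ b in Set.Ioc 0 D, f (b + a) = ∫⁻ b in Set.Ioc 0 D, f b := by
  have h1 : ∫⁻ b in Set.Ioc 0 D, f (b + a) = ∫⁻ b in Set.Ioc a (a + D), f b := by
    have := (measurePreserving_add_right volume a).setLIntegral_comp_preimage_emb
      (MeasurableEquiv.addRight a).measurableEmbedding f (Set.Ioc a (a + D))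
    rw [← this]
    congr 2
    ext x
    simp only [Set.mem_Ioc, Set.mem_preimage]
    constructor <;> rintro ⟨h1, h2⟩ <;> constructor <;> linarith
  rw [h1]
  have h2 := (isAddFundamentalDomain_Ioc hD a).setLIntegral_eq (isAddFundamentalDomain_Ioc hD 0) f
    (fun g x => by
      obtain ⟨m, hm⟩ := AddSubgroup.mem_zmultiples_iff.1 g.2
      have : (g +ᵥ x : ℝ) = x + m • D := by
        rw [AddSubgroup.vadd_def, vadd_eq_add, ← hm, add_comm]
      rw [this]
      exact hf.zsmul m x)
  simpa using h2

theorem lintegral_shiftLaw_add {D : ℝ} (hD : 0 < D) {f : ℝ → ℝ≥0∞}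
    (hf : Function.Periodic f D) (a : ℝ) :
    ∫⁻ b, f (b + a) ∂(shiftLaw D) = ∫⁻ b, f b ∂(shiftLaw D) := by
  rw [lintegral_shiftLaw, lintegral_shiftLaw, lintegral_Ioc_add_of_periodic hD hf]

theorem floor_add_div {D : ℝ} (hD : 0 < D) (x : ℝ) : ⌊(x + D) / D⌋ = ⌊x / D⌋ + 1 := by
  rw [add_div, div_self hD.ne', Int.floor_add_one]

end EntropyNN

end

noncomputable section

namespace EntropyNN

open scoped Matrix ENNReal

variable {ι : Type} [Fintype ι]

/-- For a periodic condition the offset `a` is irrelevant under a uniform shift, so it suffices to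
cover its solutions in the single period (0, D]. -/
theorem shiftLaw_add_le {D : ℝ} (hD : 0 < D) {p : ℝ → Prop} (hp : ∀ x, p (x + D) ↔ p x)
    (hm : MeasurableSet {x | p x}) {S : Set ℝ} (hS : ∀ x, 0 < x → x ≤ D → p x → x ∈ S) (a : ℝ) :
    shiftLaw D {b | p (b + a)} ≤ (ENNReal.ofReal D)⁻¹ * volume S := by
  have hper : Function.Periodic ({x | p x}.indicator (1 : ℝ → ℝ≥0∞)) D := by
    intro x
    by_cases h : p x
    · simp [h, (hp x).2 h]
    · simp [h, mt (hp x).1 h]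
  have h1 := lintegral_shiftLaw_add hD hper a
  have h2 : ∫⁻ b, {x | p x}.indicator (1 : ℝ → ℝ≥0∞) (b + a) ∂(shiftLaw D) =
      shiftLaw D {b | p (b + a)} := by
    have : MeasurableSet {b | p (b + a)} := (measurable_add_const a) hm
    rw [← lintegral_indicator_one this]
    rfl
  rw [← h2, h1, lintegral_shiftLaw]
  gcongr
  rw [lintegral_indicator_one hm, Measure.restrict_apply hm]
  exact measure_mono fun x hx => hS x hx.2.1 hx.2.2 hx.1

theorem measurableSet_floor_eq (D c : ℝ) : MeasurableSet {x : ℝ | ⌊x / D⌋ = ⌊(x + c) / D⌋} :=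
  measurableSet_eq_fun (by fun_prop) (by fun_prop)

theorem inv_ofReal_mul_ofReal {D : ℝ} (hD : 0 < D) (x : ℝ) :
    (ENNReal.ofReal D)⁻¹ * ENNReal.ofReal x = ENNReal.ofReal (x / D) := by
  rw [ENNReal.ofReal_div_of_pos hD, mul_comm, div_eq_mul_inv]

/-- Two numbers fall into the same cell of a randomly shifted partition with probability at most
`1 - |a - b| / D`. -/
theorem shiftLaw_floor_eq_le {D : ℝ} (hD : 0 < D) (a b : ℝ) :
    shiftLaw D {s | ⌊(a + s) / D⌋ = ⌊(b + s) / D⌋} ≤ ENNReal.ofReal (1 - |a - b| / D) := by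
  wlog hab : a ≤ b generalizing a b with H
  · have := H b a (le_of_not_ge hab)
    rw [abs_sub_comm]
    simpa only [eq_comm] using this
  -- The endpoint `D` of the period (0, D] already belongs to the next cell; the null set `{D}`
  -- takes care of it.
  have h := shiftLaw_add_le hD (p := fun x => ⌊x / D⌋ = ⌊(x + (b - a)) / D⌋)
    (S := Set.Ico 0 (D - (b - a)) ∪ {D}) ?_ (measurableSet_floor_eq D (b - a)) ?_ a
  · have hset : {s | ⌊(a + s) / D⌋ = ⌊(b + s) / D⌋} =
        {s | ⌊(s + a) / D⌋ = ⌊(s + a + (b - a)) / D⌋} := by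
      ext s
      simp only [Set.mem_ofPred_eq]
      rw [show s + a + (b - a) = b + s by ring, add_comm s a]
    rw [hset]
    refine h.trans ?_
    have hv : volume (Set.Ico 0 (D - (b - a)) ∪ {D}) ≤ ENNReal.ofReal (D - (b - a)) := by
      refine (measure_union_le _ _).trans ?_
      simp
    refine (mul_le_mul_right hv _).trans ?_
    rw [inv_ofReal_mul_ofReal hD, abs_of_nonpos (by linarith)]
    refine ENNReal.ofReal_le_ofReal (le_of_eq ?_)
    field_simp
    ring
  · intro x
    rw [show x + D + (b - a) = x + (b - a) + D by ring, floor_add_div hD, floor_add_div hD]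
    omega
  · intro x hx hxD hfl
    rcases eq_or_lt_of_le hxD with rfl | hlt
    · right; rfl
    · left
      refine ⟨hx.le, ?_⟩
      have h0 : ⌊x / D⌋ = 0 := by
        rw [Int.floor_eq_zero_iff]
        exact ⟨by positivity, (div_lt_one hD).2 hlt⟩
      rw [h0] at hfl
      have := (Int.floor_eq_zero_iff.1 hfl.symm).2
      rw [div_lt_one hD] at this
      linarith

/-- Two numbers are separated by a randomly shifted partition with probability at most
`|a - b| / D`. -/
theorem shiftLaw_floor_ne_le {D : ℝ} (hD : 0 < D) (a b : ℝ) :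
    shiftLaw D {s | ⌊(a + s) / D⌋ ≠ ⌊(b + s) / D⌋} ≤ ENNReal.ofReal (|a - b| / D) := by
  wlog hab : a ≤ b generalizing a b with H
  · have := H b a (le_of_not_ge hab)
    rw [abs_sub_comm]
    simpa only [ne_comm] using this
  have h := shiftLaw_add_le hD (p := fun x => ⌊x / D⌋ ≠ ⌊(x + (b - a)) / D⌋)
    (S := Set.Icc (D - (b - a)) D) ?_ (measurableSet_floor_eq D (b - a)).compl ?_ a
  · have hset : {s | ⌊(a + s) / D⌋ ≠ ⌊(b + s) / D⌋} =
        {s | ⌊(s + a) / D⌋ ≠ ⌊(s + a + (b - a)) / D⌋} := by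
      ext s
      simp only [Set.mem_ofPred_eq]
      rw [show s + a + (b - a) = b + s by ring, add_comm s a]
    rw [hset]
    refine h.trans ?_
    rw [Real.volume_Icc, inv_ofReal_mul_ofReal hD, abs_of_nonpos (by linarith)]
    refine ENNReal.ofReal_le_ofReal (le_of_eq ?_)
    ring
  · intro x
    rw [show x + D + (b - a) = x + (b - a) + D by ring, floor_add_div hD, floor_add_div hD]
    omega
  · intro x hx hxD hfl
    refine ⟨?_, hxD⟩
    by_contra hlt
    refine hfl ?_
    have h1 : ⌊x / D⌋ = 0 := by
      rw [Int.floor_eq_zero_iff]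
      exact ⟨by positivity, (div_lt_one hD).2 (by linarith)⟩
    have h2 : ⌊(x + (b - a)) / D⌋ = 0 := by
      rw [Int.floor_eq_zero_iff]
      exact ⟨div_nonneg (by linarith) hD.le, (div_lt_one hD).2 (by linarith)⟩
    rw [h1, h2]

/-! ### Collision probabilities of a hash function -/

theorem hash_eq (w D : ℝ) (h : HashFn ι) (x : ι → ℝ) :
    hash w D h x = ⌊((h.1 ⬝ᵥ x) / w + h.2) / D⌋ := rfl

theorem measurable_hash (w D : ℝ) (x : ι → ℝ) : Measurable fun h : HashFn ι => hash w D h x := by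
  unfold hash; fun_prop

theorem hashLaw_eq (D : ℝ) : hashLaw ι D = (normalVec ι).prod (shiftLaw D) := rfl

theorem isProbabilityMeasure_hashLaw {D : ℝ} (hD : 0 < D) :
    IsProbabilityMeasure (hashLaw ι D) := by
  have := isProbabilityMeasure_shiftLaw hD
  rw [hashLaw_eq]; infer_instance

theorem hashLaw_apply {D : ℝ} (hD : 0 < D) {s : Set (HashFn ι)} (hs : MeasurableSet s) :
    hashLaw ι D s = ∫⁻ v, shiftLaw D {b | (v, b) ∈ s} ∂(normalVec ι) := by
  have := isProbabilityMeasure_shiftLaw hD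
  rw [hashLaw_eq, Measure.prod_apply hs]
  rfl

/-- From `|g| ≤ (1 + g ^ 2) / 2` and unit variance. The exact value √(2/π) is not needed, since the
bound serves only to control the rounding of radii. -/
theorem lintegral_abs_gaussianReal_le : ∫⁻ g, ENNReal.ofReal |g| ∂(gaussianReal 0 1) ≤ 1 := by
  have h2 : ∫ g, g ^ 2 ∂(gaussianReal 0 1) = 1 := by
    have h := variance_fun_id_gaussianReal (μ := 0) (v := 1)
    rw [variance_eq_integral (by fun_prop)] at h
    simpa using h
  have hint : Integrable (fun g : ℝ => g ^ 2) (gaussianReal 0 1) :=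
    (memLp_id_gaussianReal 2).integrable_sq
  calc ∫⁻ g, ENNReal.ofReal |g| ∂(gaussianReal 0 1)
      ≤ ∫⁻ g, ENNReal.ofReal ((1 + g ^ 2) / 2) ∂(gaussianReal 0 1) := by
        refine lintegral_mono fun g => ENNReal.ofReal_le_ofReal ?_
        nlinarith [sq_nonneg (|g| - 1), sq_abs g]
    _ = ENNReal.ofReal (∫ g, (1 + g ^ 2) / 2 ∂(gaussianReal 0 1)) := by
        rw [ofReal_integral_eq_lintegral_ofReal]
        · exact ((integrable_const 1).add hint).div_const 2
        · exact ae_of_all _ fun g => by positivity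
    _ = 1 := by
        rw [integral_div, integral_add (integrable_const 1) hint, h2]
        simp

/-- Close points are rarely separated by a hash function. -/
theorem hashLaw_ne_le {w D : ℝ} (hw : 0 < w) (hD : 0 < D) (x y : ι → ℝ) :
    hashLaw ι D {h | hash w D h x ≠ hash w D h y} ≤
      ENNReal.ofReal (euclNorm (x - y) / (w * D)) := by
  have hm : MeasurableSet {h : HashFn ι | hash w D h x ≠ hash w D h y} :=
    (measurableSet_eq_fun (measurable_hash w D x) (measurable_hash w D y)).compl
  rw [hashLaw_apply hD hm]
  calc ∫⁻ v, shiftLaw D {b | (v, b) ∈ {h : HashFn ι | hash w D h x ≠ hash w D h y}} ∂(normalVec ι)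
      ≤ ∫⁻ v, ENNReal.ofReal (|v ⬝ᵥ (x - y)| / (w * D)) ∂(normalVec ι) := by
        refine lintegral_mono fun v => ?_
        refine (shiftLaw_floor_ne_le hD ((v ⬝ᵥ x) / w) ((v ⬝ᵥ y) / w)).trans ?_
        rw [← sub_div, ← dotProduct_sub, abs_div, abs_of_pos hw, div_div]
    _ = ∫⁻ g, ENNReal.ofReal (|euclNorm (x - y) * g| / (w * D)) ∂(gaussianReal 0 1) :=
        lintegral_dotProduct_normalVec' (f := fun g => ENNReal.ofReal (|g| / (w * D)))
          (by fun_prop) _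
    _ = ∫⁻ g, ENNReal.ofReal (euclNorm (x - y) / (w * D)) * ENNReal.ofReal |g|
          ∂(gaussianReal 0 1) := by
        refine lintegral_congr fun g => ?_
        rw [← ENNReal.ofReal_mul (div_nonneg (euclNorm_nonneg _) (by positivity)), abs_mul,
          abs_of_nonneg (euclNorm_nonneg _)]
        congr 1; ring
    _ ≤ ENNReal.ofReal (euclNorm (x - y) / (w * D)) := by
        rw [lintegral_const_mul _ (by fun_prop)]
        exact mul_le_of_le_one_right' lintegral_abs_gaussianReal_le

/-! ### The truncated first absolute moment -/

theorem gaussianPDFReal_zero_one (x : ℝ) :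
    gaussianPDFReal 0 1 x = (√(2 * Real.pi))⁻¹ * Real.exp (-x ^ 2 / 2) := by
  simp [gaussianPDFReal]

theorem integral_mul_gaussianPDFReal (D : ℝ) :
    ∫ x in (0 : ℝ)..D, x * gaussianPDFReal 0 1 x =
      (√(2 * Real.pi))⁻¹ * (1 - Real.exp (-D ^ 2 / 2)) := by
  have hd : ∀ x : ℝ, HasDerivAt (fun x => -((√(2 * Real.pi))⁻¹ * Real.exp (-x ^ 2 / 2)))
      (x * gaussianPDFReal 0 1 x) x := by
    intro x
    have h1 : HasDerivAt (fun x : ℝ => -x ^ 2 / 2) (-x) x := by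
      refine (((hasDerivAt_pow 2 x).neg).div_const 2).congr_deriv ?_
      simp
      ring
    refine (((h1.exp).const_mul ((√(2 * Real.pi))⁻¹)).neg).congr_deriv ?_
    rw [gaussianPDFReal_zero_one]; ring
  rw [intervalIntegral.integral_eq_sub_of_hasDerivAt (fun x _ => hd x)]
  · simp; ring
  · refine Continuous.intervalIntegrable ?_ _ _
    simp only [gaussianPDFReal_zero_one]
    fun_prop

/-- The first absolute moment of the normal distribution, truncated at `D`. -/
theorem integral_indicator_abs_gaussianReal {D : ℝ} (hD : 0 < D) :
    ∫ g, (Set.Icc (-D) D).indicator (fun g => |g|) g ∂(gaussianReal 0 1) =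
      √(2 / Real.pi) * (1 - Real.exp (-D ^ 2 / 2)) := by
  have hI : ∀ a b : ℝ, IntervalIntegrable (fun x => |x| * gaussianPDFReal 0 1 x) volume a b := by
    intro a b
    refine Continuous.intervalIntegrable ?_ _ _
    simp only [gaussianPDFReal_zero_one]
    fun_prop
  rw [integral_gaussianReal_eq_integral_smul (by norm_num)]
  have h1 : ∀ x, gaussianPDFReal 0 1 x • (Set.Icc (-D) D).indicator (fun g => |g|) x =
      (Set.Icc (-D) D).indicator (fun x => |x| * gaussianPDFReal 0 1 x) x := by
    intro x
    by_cases hx : x ∈ Set.Icc (-D) D <;> simp [hx, mul_comm]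
  simp_rw [h1]
  rw [integral_indicator measurableSet_Icc, integral_Icc_eq_integral_Ioc,
    ← intervalIntegral.integral_of_le (by linarith),
    ← intervalIntegral.integral_add_adjacent_intervals (hI _ 0) (hI 0 _)]
  have h2 : ∫ x in (0 : ℝ)..D, |x| * gaussianPDFReal 0 1 x =
      (√(2 * Real.pi))⁻¹ * (1 - Real.exp (-D ^ 2 / 2)) := by
    rw [← integral_mul_gaussianPDFReal]
    refine intervalIntegral.integral_congr fun x hx => ?_
    rw [Set.uIcc_of_le hD.le] at hx
    simp only [abs_of_nonneg hx.1]
  have h3 : ∫ x in (-D)..0, |x| * gaussianPDFReal 0 1 x =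
      ∫ x in (0 : ℝ)..D, |x| * gaussianPDFReal 0 1 x := by
    have := intervalIntegral.integral_comp_neg (a := 0) (b := D)
      (fun x => |x| * gaussianPDFReal 0 1 x)
    rw [neg_zero] at this
    rw [← this]
    refine intervalIntegral.integral_congr fun x _ => ?_
    simp [gaussianPDFReal_zero_one]
  rw [h3, h2, ← two_mul, ← mul_assoc]
  congr 1
  have hpi := Real.pi_pos
  rw [Real.sqrt_mul (by norm_num), Real.sqrt_div (by norm_num)]
  have : √2 * √2 = (2 : ℝ) := Real.mul_self_sqrt (by norm_num)
  have h2 : √(2 : ℝ) ≠ 0 := by positivity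
  have h3 : √Real.pi ≠ 0 := by positivity
  field_simp
  nlinarith

theorem one_sub_collisionBound (D : ℝ) :
    1 - collisionBound D = √(2 / Real.pi) * (1 - Real.exp (-D ^ 2 / 2)) / D := by
  rw [collisionBound]; ring

theorem collisionBound_lt_one {D : ℝ} (hD : 0 < D) : collisionBound D < 1 := by
  have h : 0 < 1 - collisionBound D := by
    rw [one_sub_collisionBound]
    have h1 : Real.exp (-D ^ 2 / 2) < 1 := by
      rw [Real.exp_lt_one_iff]
      have : 0 < D ^ 2 := by positivity
      linarith
    have := Real.pi_pos
    refine div_pos (mul_pos (by positivity) (by linarith)) hD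
  linarith

/-- The factor √(2/π) is below 1. If `1 ≤ D` the remaining factor is below 1; otherwise it is at
most `D ^ 2 / 2 < D`. -/
theorem collisionBound_pos {D : ℝ} (hD : 0 < D) : 0 < collisionBound D := by
  have hpi := Real.pi_gt_three
  have h : 1 - collisionBound D < 1 := by
    rw [one_sub_collisionBound, div_lt_one hD]
    have h1 : √(2 / Real.pi) < 1 := by
      rw [Real.sqrt_lt' one_pos, div_lt_iff₀ (by linarith)]
      linarith
    by_cases hD1 : 1 ≤ D
    · have := Real.exp_pos (-D ^ 2 / 2)
      nlinarith [Real.sqrt_nonneg (2 / Real.pi)]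
    · have h2 : 1 - D ^ 2 / 2 ≤ Real.exp (-D ^ 2 / 2) := by
        have := Real.add_one_le_exp (-D ^ 2 / 2)
        linarith
      have h3 : Real.exp (-D ^ 2 / 2) ≤ 1 := by
        rw [Real.exp_le_one_iff]
        nlinarith [sq_nonneg D]
      nlinarith [Real.sqrt_nonneg (2 / Real.pi)]
  linarith

/-- Far points rarely collide under a hash function. -/
theorem hashLaw_eq_le {w D : ℝ} (hw : 0 < w) (hD : 0 < D) (x y : ι → ℝ) {s : ℝ} (hs0 : 0 ≤ s)
    (hs1 : s ≤ 1) (hs : s * w ≤ euclNorm (x - y)) :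
    hashLaw ι D {h | hash w D h x = hash w D h y} ≤
      ENNReal.ofReal (1 - s * (1 - collisionBound D)) := by
  rw [hashLaw_apply hD (measurableSet_eq_fun (measurable_hash w D x) (measurable_hash w D y))]
  have hint : Integrable ((Set.Icc (-D) D).indicator (fun g : ℝ => |g|)) (gaussianReal 0 1) := by
    refine Integrable.indicator ?_ measurableSet_Icc
    exact ((memLp_id_gaussianReal 1).integrable le_rfl).abs
  calc ∫⁻ v, shiftLaw D {b | (v, b) ∈ {h : HashFn ι | hash w D h x = hash w D h y}} ∂(normalVec ι)
      ≤ ∫⁻ v, ENNReal.ofReal (1 - |v ⬝ᵥ (x - y)| / w / D) ∂(normalVec ι) := by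
        refine lintegral_mono fun v => ?_
        refine (shiftLaw_floor_eq_le hD ((v ⬝ᵥ x) / w) ((v ⬝ᵥ y) / w)).trans ?_
        rw [← sub_div, ← dotProduct_sub, abs_div, abs_of_pos hw]
    _ = ∫⁻ g, ENNReal.ofReal (1 - |euclNorm (x - y) * g| / w / D) ∂(gaussianReal 0 1) :=
        lintegral_dotProduct_normalVec' (f := fun g => ENNReal.ofReal (1 - |g| / w / D))
          (by fun_prop) _
    -- For a projection outside `[-D, D]` the collision probability is bounded by 1 only. This loss
    -- produces exactly the constant `g` of the statement, and on `[-D, D]` the integrand stays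
    -- nonnegative because `s ≤ 1`.
    _ ≤ ∫⁻ g, ENNReal.ofReal (1 - s * ((Set.Icc (-D) D).indicator (fun g => |g|) g / D))
          ∂(gaussianReal 0 1) := by
        refine lintegral_mono fun g => ?_
        rw [abs_mul, abs_of_nonneg (euclNorm_nonneg _)]
        by_cases hg : g ∈ Set.Icc (-D) D
        · refine ENNReal.ofReal_le_ofReal ?_
          rw [Set.indicator_of_mem hg, ← mul_div_assoc]
          have : s * |g| ≤ euclNorm (x - y) * |g| / w := by
            rw [le_div_iff₀ hw]
            nlinarith [abs_nonneg g]
          gcongr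
        · rw [Set.indicator_of_notMem hg]
          refine ENNReal.ofReal_le_ofReal ?_
          have : 0 ≤ euclNorm (x - y) * |g| / w / D := by
            have := euclNorm_nonneg (x - y)
            positivity
          simp only [zero_div, mul_zero, sub_zero]
          linarith
    _ = ENNReal.ofReal (∫ g, (1 - s * ((Set.Icc (-D) D).indicator (fun g => |g|) g / D))
          ∂(gaussianReal 0 1)) := by
        rw [ofReal_integral_eq_lintegral_ofReal]
        · exact (integrable_const 1).sub ((hint.div_const D).const_mul s)
        · refine ae_of_all _ fun g => ?_
          by_cases hg : g ∈ Set.Icc (-D) D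
          · simp only [Set.indicator_of_mem hg, Pi.zero_apply]
            have h1 : |g| / D ≤ 1 := (div_le_one hD).2 (abs_le.2 hg)
            have h2 : 0 ≤ |g| / D := by positivity
            nlinarith
          · simp [Set.indicator_of_notMem hg]
    _ = ENNReal.ofReal (1 - s * (1 - collisionBound D)) := by
        rw [integral_sub (integrable_const 1) ((hint.div_const D).const_mul s),
          integral_const_mul, integral_div, integral_indicator_abs_gaussianReal hD,
          one_sub_collisionBound]
        simp

end EntropyNN

end

/-! ### The normal tail, the entropy of a boundary, and a Kraft inequality for cells. -/

noncomputable section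

namespace EntropyNN

open scoped Matrix ENNReal

/-! ### The tail of the normal distribution -/

/-- The density of the standard normal distribution. -/
def phi (x : ℝ) : ℝ := gaussianPDFReal 0 1 x

theorem phi_eq (x : ℝ) : phi x = (√(2 * Real.pi))⁻¹ * Real.exp (-x ^ 2 / 2) :=
  gaussianPDFReal_zero_one x

theorem phi_pos (x : ℝ) : 0 < phi x := gaussianPDFReal_pos _ _ _ one_ne_zero

theorem continuous_phi : Continuous phi := by
  simp only [funext phi_eq]
  fun_prop

theorem integrable_phi : Integrable phi := integrable_gaussianPDFReal 0 1

theorem phi_neg (x : ℝ) : phi (-x) = phi x := by simp [phi_eq]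

theorem integral_phi_Ioi : ∫ x in Set.Ioi (0 : ℝ), phi x = 1 / 2 := by
  have h := integral_gaussian_Ioi (1 / 2)
  have h1 : ∀ x : ℝ, phi x = (√(2 * Real.pi))⁻¹ * Real.exp (-(1 / 2) * x ^ 2) := by
    intro x
    rw [phi_eq]
    congr 2
    ring
  simp_rw [h1]
  rw [integral_const_mul, h]
  have h2 : Real.pi / (1 / 2) = 2 * Real.pi := by ring
  have h3 : √(2 * Real.pi) ≠ 0 := by
    have := Real.pi_pos
    positivity
  rw [h2]
  field_simp

theorem Phi_eq (x : ℝ) : Phi x = 1 / 2 - ∫ t in (0 : ℝ)..x, phi t := by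
  have h2 : (√2 : ℝ) ≠ 0 := by positivity
  have h1 : ∫ t in (0 : ℝ)..x, phi t =
      (√(2 * Real.pi))⁻¹ * (√2 * ∫ t in (0 : ℝ)..(x / √2), Real.exp (-t ^ 2)) := by
    have := intervalIntegral.integral_comp_div (a := 0) (b := x) (fun t => Real.exp (-t ^ 2)) h2
    rw [zero_div, smul_eq_mul] at this
    rw [← this, ← intervalIntegral.integral_const_mul]
    refine intervalIntegral.integral_congr fun t _ => ?_
    simp only [phi_eq, div_pow]
    rw [Real.sq_sqrt (by norm_num), neg_div]
  rw [h1, Phi, erf, Real.sqrt_mul (by norm_num)]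
  have h3 : √Real.pi ≠ 0 := by
    have := Real.pi_pos
    positivity
  field_simp

theorem Phi_eq_integral_Ioi (x : ℝ) : Phi x = ∫ t in Set.Ioi x, phi t := by
  have := intervalIntegral.integral_interval_add_Ioi (a := 0) (b := x)
    integrable_phi.integrableOn integrable_phi.integrableOn
  rw [integral_phi_Ioi] at this
  rw [Phi_eq]
  linarith

theorem Phi_zero : Phi 0 = 1 / 2 := by simp [Phi_eq]

theorem hasDerivAt_Phi (x : ℝ) : HasDerivAt Phi (-phi x) x := by
  have h := (intervalIntegral.integral_hasDerivAt_right
    (continuous_phi.intervalIntegrable 0 x)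
    continuous_phi.stronglyMeasurable.stronglyMeasurableAtFilter continuous_phi.continuousAt)
  have h2 := h.const_sub (1 / 2)
  rwa [← funext Phi_eq] at h2

theorem continuous_Phi : Continuous Phi :=
  continuous_iff_continuousAt.2 fun x => (hasDerivAt_Phi x).continuousAt

theorem strictAnti_Phi : StrictAnti Phi := by
  refine strictAnti_of_hasDerivAt_neg (fun x => hasDerivAt_Phi x) fun x => ?_
  have := phi_pos x
  linarith

theorem Phi_neg (x : ℝ) : Phi (-x) = 1 - Phi x := by
  rw [Phi_eq, Phi_eq]
  have := intervalIntegral.integral_comp_neg (a := 0) (b := x) phi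
  rw [neg_zero] at this
  simp only [phi_neg] at this
  rw [this, intervalIntegral.integral_symm]
  ring

theorem Phi_nonneg (x : ℝ) : 0 ≤ Phi x := by
  rw [Phi_eq_integral_Ioi]
  exact integral_nonneg fun t => (phi_pos t).le

theorem Phi_pos (x : ℝ) : 0 < Phi x :=
  lt_of_le_of_lt (Phi_nonneg (x + 1)) (strictAnti_Phi (by linarith))

theorem Phi_lt_one (x : ℝ) : Phi x < 1 := by
  have := Phi_pos (-x)
  rw [Phi_neg] at this
  linarith

theorem gaussianReal_Ici (x : ℝ) : gaussianReal 0 1 (Set.Ici x) = ENNReal.ofReal (Phi x) := by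
  rw [gaussianReal_apply_eq_integral _ one_ne_zero, Phi_eq_integral_Ioi, integral_Ici_eq_integral_Ioi]
  rfl

theorem gaussianReal_Iio (x : ℝ) :
    gaussianReal 0 1 (Set.Iio x) = ENNReal.ofReal (1 - Phi x) := by
  rw [← Set.compl_Ici, prob_compl_eq_one_sub measurableSet_Ici, gaussianReal_Ici,
    ENNReal.ofReal_sub _ (Phi_nonneg x), ENNReal.ofReal_one]

/-- The tail bound of Chernoff. -/
theorem Phi_le_exp {x : ℝ} (hx : 0 ≤ x) : Phi x ≤ Real.exp (-x ^ 2 / 2) / 2 := by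
  rw [Phi_eq_integral_Ioi]
  have h1 : ∫ t in Set.Ioi x, phi t = ∫ t in Set.Ioi (0 : ℝ), phi (t + x) := by
    have := (measurePreserving_add_right volume x).setIntegral_preimage_emb
      (MeasurableEquiv.addRight x).measurableEmbedding phi (Set.Ioi x)
    rw [← this]
    congr 2
    ext t
    simp
  rw [h1]
  -- For nonnegative `t` and `x`, `(t + x) ^ 2 ≥ t ^ 2 + x ^ 2`.
  have h2 : ∫ t in Set.Ioi (0 : ℝ), phi (t + x) ≤
      ∫ t in Set.Ioi (0 : ℝ), Real.exp (-x ^ 2 / 2) * phi t := by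
    refine setIntegral_mono_on (integrable_phi.comp_add_right x).integrableOn
      (integrable_phi.const_mul _).integrableOn measurableSet_Ioi fun t ht => ?_
    have ht : 0 < t := ht
    rw [phi_eq, phi_eq, mul_left_comm, ← Real.exp_add]
    gcongr
    nlinarith
  rw [integral_const_mul, integral_phi_Ioi] at h2
  linarith

/-! ### The entropy of the side of a boundary -/

theorem entropy_two (p : ℝ) : entropy ![p, 1 - p] =
    p * -Real.logb 2 p + (1 - p) * -Real.logb 2 (1 - p) := by
  simp [entropy]
  ring

theorem neg_logb_nonneg {p : ℝ} (h0 : 0 < p) (h1 : p < 1) : 0 ≤ -Real.logb 2 p := by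
  have := Real.logb_neg (b := 2) (by norm_num) h0 h1
  linarith

theorem entropy_two_nonneg {p : ℝ} (h0 : 0 < p) (h1 : p < 1) : 0 ≤ entropy ![p, 1 - p] := by
  rw [entropy_two]
  have := neg_logb_nonneg h0 h1
  have := neg_logb_nonneg (p := 1 - p) (by linarith) (by linarith)
  have : 0 ≤ 1 - p := by linarith
  positivity

/-- Apply `log y ≥ 1 - 1 / y` at `y = √p` and at `y = 1 - p`. The bound is crude, but √Φ still has
Gaussian decay, which is all that integrability and the limits at infinity require. -/
theorem entropy_two_le {p : ℝ} (h0 : 0 < p) (h1 : p < 1) :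
    entropy ![p, 1 - p] ≤ 2 / Real.log 2 * √p := by
  have hl : 0 < Real.log 2 := Real.log_pos (by norm_num)
  rw [entropy_two, Real.logb, Real.logb]
  have hs : 0 < √p := Real.sqrt_pos.2 h0
  have hss : √p * √p = p := Real.mul_self_sqrt h0.le
  have e1 : p * -Real.log p ≤ 2 * √p - 2 * p := by
    have h := Real.one_sub_inv_le_log_of_pos hs
    have h2 : Real.log p = 2 * Real.log √p := by
      rw [Real.log_sqrt h0.le]; ring
    have h3 : p * (√p)⁻¹ = √p := by
      field_simp; nlinarith
    rw [h2]
    nlinarith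
  have e2 : (1 - p) * -Real.log (1 - p) ≤ p := by
    have h := Real.one_sub_inv_le_log_of_pos (x := 1 - p) (by linarith)
    have h3 : (1 - p) * (1 - p)⁻¹ = 1 := mul_inv_cancel₀ (by linarith)
    have h4 : 0 < 1 - p := by linarith
    nlinarith
  have h5 : p * -(Real.log p / Real.log 2) + (1 - p) * -(Real.log (1 - p) / Real.log 2) =
      (p * -Real.log p + (1 - p) * -Real.log (1 - p)) / Real.log 2 := by ring
  rw [h5, div_mul_eq_mul_div]
  gcongr
  linarith

/-- The entropy of the side of a boundary at `x` on which a normal variable falls. -/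
def sideEntropy (x : ℝ) : ℝ := entropy ![Phi x, 1 - Phi x]

theorem sideEntropy_nonneg (x : ℝ) : 0 ≤ sideEntropy x :=
  entropy_two_nonneg (Phi_pos x) (Phi_lt_one x)

theorem sideEntropy_neg (x : ℝ) : sideEntropy (-x) = sideEntropy x := by
  simp only [sideEntropy, entropy_two, Phi_neg]
  ring_nf

theorem continuous_sideEntropy : Continuous sideEntropy := by
  have h : ∀ x, sideEntropy x = Phi x * -Real.logb 2 (Phi x) +
    (1 - Phi x) * -Real.logb 2 (1 - Phi x) := fun x => entropy_two _
  rw [funext h]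
  have h1 := continuous_Phi.log fun x => (Phi_pos x).ne'
  have h2 := (continuous_const.sub continuous_Phi).log (f := fun x => 1 - Phi x)
    fun x => (sub_pos.2 (Phi_lt_one x)).ne'
  have h3 := continuous_Phi
  unfold Real.logb
  fun_prop

theorem sqrt_Phi_le {x : ℝ} (hx : 0 ≤ x) : √(Phi x) ≤ Real.exp (-(1 / 4) * x ^ 2) := by
  rw [Real.sqrt_le_left (Real.exp_pos _).le, ← Real.exp_nat_mul]
  refine (Phi_le_exp hx).trans ?_
  have : ((2 : ℕ) : ℝ) * (-(1 / 4) * x ^ 2) = -x ^ 2 / 2 := by push_cast; ring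
  rw [this]
  have := Real.exp_pos (-x ^ 2 / 2)
  linarith

theorem integrableOn_sideEntropy : IntegrableOn sideEntropy (Set.Ioi 0) := by
  have h1 : Integrable fun x : ℝ => 2 / Real.log 2 * Real.exp (-(1 / 4) * x ^ 2) :=
    (integrable_exp_neg_mul_sq (by norm_num)).const_mul _
  refine Integrable.mono' h1.integrableOn continuous_sideEntropy.aestronglyMeasurable ?_
  refine (ae_restrict_iff' measurableSet_Ioi).2 (ae_of_all _ fun x hx => ?_)
  rw [Real.norm_of_nonneg (sideEntropy_nonneg x)]
  refine (entropy_two_le (Phi_pos x) (Phi_lt_one x)).trans ?_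
  have : 0 < Real.log 2 := Real.log_pos (by norm_num)
  gcongr
  exact sqrt_Phi_le (le_of_lt hx)

theorem alpha_eq : alpha = ∫ x in Set.Ioi (0 : ℝ), sideEntropy x := rfl

theorem alpha_nonneg : 0 ≤ alpha := integral_nonneg fun x => sideEntropy_nonneg x

/-- Boundaries lie on both sides of the origin and the entropy is even: this is the source of the
factor 2 in `rho`. -/
theorem lintegral_sideEntropy :
    ∫⁻ x, ENNReal.ofReal (sideEntropy x) = ENNReal.ofReal (2 * alpha) := by
  have h1 : ∫⁻ x in Set.Ioi (0 : ℝ), ENNReal.ofReal (sideEntropy x) = ENNReal.ofReal alpha := by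
    rw [alpha_eq, ofReal_integral_eq_lintegral_ofReal integrableOn_sideEntropy
      (ae_of_all _ sideEntropy_nonneg)]
  have h2 : ∫⁻ x in Set.Iic (0 : ℝ), ENNReal.ofReal (sideEntropy x) = ENNReal.ofReal alpha := by
    rw [← h1, ← restrict_Iio_eq_restrict_Iic]
    have := (Measure.measurePreserving_neg (volume : Measure ℝ)).setLIntegral_comp_preimage_emb
      (MeasurableEquiv.neg ℝ).measurableEmbedding (fun x => ENNReal.ofReal (sideEntropy x))
      (Set.Ioi 0)
    simp only [sideEntropy_neg] at this
    rw [← this]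
    congr 2
    ext x
    simp
  rw [← lintegral_add_compl _ measurableSet_Ioi (μ := volume) (A := Set.Ioi (0 : ℝ)), h1,
    Set.compl_Ioi, h2, ← ENNReal.ofReal_add alpha_nonneg alpha_nonneg, two_mul]

/-- The cost (in bits) of telling on which side of a boundary at `b` the point `g` is. -/
def sideCost (b g : ℝ) : ℝ≥0∞ := ENNReal.ofReal (-Real.logb 2 (if b ≤ g then Phi b else 1 - Phi b))

theorem measurable_sideCost : Measurable fun z : ℝ × ℝ => sideCost z.1 z.2 := by
  unfold sideCost Real.logb
  have h := continuous_Phi.measurable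
  have h1 : MeasurableSet {z : ℝ × ℝ | z.1 ≤ z.2} := measurableSet_le measurable_fst measurable_snd
  have h2 : Measurable fun z : ℝ × ℝ => if z.1 ≤ z.2 then Phi z.1 else 1 - Phi z.1 :=
    Measurable.ite h1 (h.comp measurable_fst) ((h.comp measurable_fst).const_sub 1)
  exact (((Real.measurable_log.comp h2).div_const _).neg).ennreal_ofReal

theorem lintegral_sideCost (b : ℝ) :
    ∫⁻ g, sideCost b g ∂(gaussianReal 0 1) = ENNReal.ofReal (sideEntropy b) := by
  have h0 := Phi_pos b
  have h1 := Phi_lt_one b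
  rw [← lintegral_add_compl _ measurableSet_Ici (A := Set.Ici b)]
  have e1 : ∫⁻ g in Set.Ici b, sideCost b g ∂(gaussianReal 0 1) =
      ENNReal.ofReal (-Real.logb 2 (Phi b)) * ENNReal.ofReal (Phi b) := by
    rw [setLIntegral_congr_fun measurableSet_Ici (g := fun _ => ENNReal.ofReal (-Real.logb 2 (Phi b)))]
    · rw [setLIntegral_const, gaussianReal_Ici]
    · intro g hg
      simp only [sideCost]
      rw [if_pos (Set.mem_Ici.1 hg)]
  have e2 : ∫⁻ g in (Set.Ici b)ᶜ, sideCost b g ∂(gaussianReal 0 1) =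
      ENNReal.ofReal (-Real.logb 2 (1 - Phi b)) * ENNReal.ofReal (1 - Phi b) := by
    rw [setLIntegral_congr_fun measurableSet_Ici.compl
      (g := fun _ => ENNReal.ofReal (-Real.logb 2 (1 - Phi b)))]
    · rw [setLIntegral_const, Set.compl_Ici, gaussianReal_Iio]
    · intro g hg
      simp only [sideCost]
      rw [if_neg (fun h => hg (Set.mem_Ici.2 h))]
  have n1 := neg_logb_nonneg h0 h1
  have n2 := neg_logb_nonneg (p := 1 - Phi b) (by linarith) (by linarith)
  have h3 : 0 ≤ 1 - Phi b := by linarith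
  rw [e1, e2, ← ENNReal.ofReal_mul n1, ← ENNReal.ofReal_mul n2,
    ← ENNReal.ofReal_add (by positivity) (by positivity), sideEntropy, entropy_two]
  congr 1
  ring

end EntropyNN

end

noncomputable section

namespace EntropyNN

open scoped Matrix ENNReal

/-! ### The cost of a cell -/

/-- The probability that a normal variable falls on the same side of the boundary at `(j D - s) / θ`
as the cell with index `y`. -/
def sideProb (D θ s : ℝ) (y j : ℤ) : ℝ :=
  if j ≤ y then Phi ((j * D - s) / θ) else 1 - Phi ((j * D - s) / θ)

theorem sideProb_pos (D θ s : ℝ) (y j : ℤ) : 0 < sideProb D θ s y j := by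
  have h1 := Phi_pos ((j * D - s) / θ)
  have h2 := Phi_lt_one ((j * D - s) / θ)
  unfold sideProb
  split <;> linarith

theorem sideProb_lt_one (D θ s : ℝ) (y j : ℤ) : sideProb D θ s y j < 1 := by
  have h1 := Phi_pos ((j * D - s) / θ)
  have h2 := Phi_lt_one ((j * D - s) / θ)
  unfold sideProb
  split <;> linarith

/-- The cost of describing the cell `y` by telling for each boundary on which side of it the cell
is. -/
def cellCost (D θ s : ℝ) (y : ℤ) : ℝ≥0∞ :=
  ∑' j : ℤ, ENNReal.ofReal (-Real.logb 2 (sideProb D θ s y j))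

/-- The boundary with index `j` separates the cells `j - 1` and `j`; in the coordinate `g` it sits
at `(j * D - s) / θ`. -/
theorem cellCost_floor {D θ : ℝ} (hD : 0 < D) (hθ : 0 < θ) (s g : ℝ) :
    cellCost D θ s ⌊(θ * g + s) / D⌋ = ∑' j : ℤ, sideCost ((j * D - s) / θ) g := by
  refine tsum_congr fun j => ?_
  have : j ≤ ⌊(θ * g + s) / D⌋ ↔ (j * D - s) / θ ≤ g := by
    rw [Int.le_floor, le_div_iff₀ hD, div_le_iff₀ hθ]
    constructor <;> intro h <;> linarith
  simp only [sideProb, sideCost, this]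

/-- The translates of one period tile the line. A uniform shift thus turns a sum over all boundaries
into an integral over all positions of a single boundary. -/
theorem tsum_lintegral_Ioc {D : ℝ} (hD : 0 < D) (f : ℝ → ℝ≥0∞) :
    ∑' j : ℤ, ∫⁻ s in Set.Ioc 0 D, f (j * D - s) = ∫⁻ x, f x := by
  have h1 : ∫⁻ x, f x = ∫⁻ x, f (-x) := by
    have := (Measure.measurePreserving_neg (volume : Measure ℝ)).lintegral_comp_emb
      (MeasurableEquiv.neg ℝ).measurableEmbedding f
    exact this.symm
  have h2 : ∀ j : ℤ, ∫⁻ s in Set.Ioc 0 D, f (j * D - s) =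
      ∫⁻ x in Set.Ioc ((-j) • D) ((-j + 1) • D), f (-x) := by
    intro j
    have := (measurePreserving_add_right volume (-(j * D))).setLIntegral_comp_preimage_emb
      (MeasurableEquiv.addRight (-(j * D))).measurableEmbedding (fun x => f (-x))
      (Set.Ioc ((-j) • D) ((-j + 1) • D))
    rw [← this]
    have hset : (fun x => x + -(j * D)) ⁻¹' Set.Ioc ((-j) • D) ((-j + 1) • D) = Set.Ioc 0 D := by
      ext x
      simp only [Set.mem_preimage, Set.mem_Ioc, zsmul_eq_mul]
      push_cast
      constructor <;> rintro ⟨h1, h2⟩ <;> constructor <;> linarith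
    rw [hset]
    refine lintegral_congr fun s => ?_
    congr 1; ring
  have hdis : Pairwise (Function.onFun Disjoint fun j : ℤ => Set.Ioc (j • D) ((j + 1) • D)) := by
    simpa using Set.pairwise_disjoint_Ioc_add_zsmul (0 : ℝ) D
  rw [h1, ← setLIntegral_univ (fun x => f (-x)), ← iUnion_Ioc_zsmul hD,
    lintegral_iUnion (fun _ => measurableSet_Ioc) hdis]
  simp_rw [h2]
  exact (Equiv.neg ℤ).tsum_eq fun j : ℤ => ∫⁻ x in Set.Ioc (j • D) ((j + 1) • D), f (-x)

theorem lintegral_comp_div {θ : ℝ} (hθ : 0 < θ) {f : ℝ → ℝ≥0∞} (hf : Measurable f) :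
    ∫⁻ x, f (x / θ) = ENNReal.ofReal θ * ∫⁻ x, f x := by
  have h := Real.smul_map_volume_mul_right (a := θ⁻¹) (inv_ne_zero hθ.ne')
  have h2 : ∫⁻ x, f x = ENNReal.ofReal θ⁻¹ * ∫⁻ x, f (x / θ) := by
    conv_lhs => rw [← h]
    rw [lintegral_smul_measure, lintegral_map hf (by fun_prop), abs_of_pos (inv_pos.2 hθ)]
    rfl
  rw [h2, ← mul_assoc, ← ENNReal.ofReal_mul hθ.le, mul_inv_cancel₀ hθ.ne', ENNReal.ofReal_one,
    one_mul]

/-- The expected cost of the cell of a normal variable of standard deviation `θ` in a randomly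
shifted partition into cells of width `D`. -/
theorem lintegral_cellCost {D θ : ℝ} (hD : 0 < D) (hθ : 0 < θ) :
    ∫⁻ g, ∫⁻ s, cellCost D θ s ⌊(θ * g + s) / D⌋ ∂(shiftLaw D) ∂(gaussianReal 0 1) =
      ENNReal.ofReal (2 * alpha * θ / D) := by
  have hm : ∀ g, Measurable fun b => sideCost b g := fun g =>
    measurable_sideCost.comp (measurable_id.prodMk measurable_const)
  have h1 : ∀ g, ∫⁻ s, cellCost D θ s ⌊(θ * g + s) / D⌋ ∂(shiftLaw D) =
      (ENNReal.ofReal D)⁻¹ * (ENNReal.ofReal θ * ∫⁻ b, sideCost b g) := by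
    intro g
    simp_rw [cellCost_floor hD hθ]
    rw [lintegral_shiftLaw, lintegral_tsum (β := ℤ) (f := fun j s => sideCost ((j * D - s) / θ) g) fun j =>
        ((hm g).comp (g := fun b => sideCost b g) (f := fun s => (j * D - s) / θ)
          (by fun_prop)).aemeasurable,
      tsum_lintegral_Ioc hD fun x => sideCost (x / θ) g, lintegral_comp_div hθ (hm g)]
  have hm2 : Measurable fun g => ∫⁻ b, sideCost b g :=
    Measurable.lintegral_prod_left' (f := fun z : ℝ × ℝ => sideCost z.1 z.2) measurable_sideCost
  simp_rw [h1]
  -- By Tonelli the mean over `g` is taken at a fixed boundary `b`, where it is the entropy of the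
  -- side.
  rw [lintegral_const_mul _ (hm2.const_mul _), lintegral_const_mul _ hm2,
    lintegral_lintegral_swap (f := fun g b => sideCost b g)
      ((measurable_sideCost.comp measurable_swap).aemeasurable)]
  simp_rw [lintegral_sideCost]
  rw [lintegral_sideEntropy, ← ENNReal.ofReal_mul hθ.le, inv_ofReal_mul_ofReal hD]
  congr 1
  ring

/-! ### The weight of a cell -/

/-- The weight `2 ^ (-cost)` of a cell. -/
def cellWeight (D θ s : ℝ) (y : ℤ) : ℝ≥0∞ :=
  if cellCost D θ s y = ∞ then 0 else ENNReal.ofReal ((2 : ℝ) ^ (-(cellCost D θ s y).toReal))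

/-- For independent events of probabilities `p j`, the summand of `i` is the probability that among
the first `m` events precisely those with `j < i` occur. Different `i` give disjoint outcomes. -/
theorem sum_prod_step_le_one (p : ℕ → ℝ) (h0 : ∀ j, 0 ≤ p j) (h1 : ∀ j, p j ≤ 1) (m : ℕ) :
    ∑ i ∈ Finset.range (m + 1), ∏ j ∈ Finset.range m, (if j < i then p j else 1 - p j) ≤ 1 := by
  induction m with
  | zero => simp
  | succ m ih =>
    rw [Finset.sum_range_succ]
    have e1 : ∀ i ∈ Finset.range (m + 1), ∏ j ∈ Finset.range (m + 1),
        (if j < i then p j else 1 - p j) =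
        (∏ j ∈ Finset.range m, (if j < i then p j else 1 - p j)) * (1 - p m) := by
      intro i hi
      rw [Finset.prod_range_succ, if_neg]
      have := Finset.mem_range.1 hi
      omega
    rw [Finset.sum_congr rfl e1, ← Finset.sum_mul, Finset.prod_range_succ, if_pos (Nat.lt_succ_self m)]
    have e2 : ∏ j ∈ Finset.range m, (if j < m + 1 then p j else 1 - p j) ≤ 1 := by
      refine Finset.prod_le_one (fun j _ => ?_) fun j _ => ?_
      · split <;> linarith [h0 j, h1 j]
      · split <;> linarith [h0 j, h1 j]
    nlinarith [h0 m, h1 m]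

/-- Every boundary contributes a nonnegative cost, so forgetting all but finitely many of them can
only increase the weight. -/
theorem cellWeight_le_prod (D θ s : ℝ) (y : ℤ) (F : Finset ℤ) :
    cellWeight D θ s y ≤ ENNReal.ofReal (∏ j ∈ F, sideProb D θ s y j) := by
  unfold cellWeight
  split
  · exact zero_le
  · rename_i hne
    refine ENNReal.ofReal_le_ofReal ?_
    have hpos : 0 < ∏ j ∈ F, sideProb D θ s y j :=
      Finset.prod_pos fun j _ => sideProb_pos D θ s y j
    have hn : ∀ j, 0 ≤ -Real.logb 2 (sideProb D θ s y j) := fun j =>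
      neg_logb_nonneg (sideProb_pos D θ s y j) (sideProb_lt_one D θ s y j)
    have h1 : ∑ j ∈ F, -Real.logb 2 (sideProb D θ s y j) ≤ (cellCost D θ s y).toReal := by
      rw [← ENNReal.ofReal_le_iff_le_toReal hne, ENNReal.ofReal_sum_of_nonneg fun j _ => hn j]
      exact ENNReal.sum_le_tsum F
    have h2 : Real.logb 2 (∏ j ∈ F, sideProb D θ s y j) =
        ∑ j ∈ F, Real.logb 2 (sideProb D θ s y j) :=
      Real.logb_prod _ _ fun j _ => (sideProb_pos D θ s y j).ne'
    rw [← Real.le_logb_iff_rpow_le (by norm_num) hpos, h2]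
    rw [Finset.sum_neg_distrib] at h1
    linarith

/-- Kraft's inequality. The sides of the boundaries are treated as if they were independent; each
cell corresponds to one monotone pattern of sides, and `sum_prod_step_le_one` sums the probabilities
of these patterns. -/
theorem sum_cellWeight_le_one (D θ s : ℝ) (F : Finset ℤ) : ∑ y ∈ F, cellWeight D θ s y ≤ 1 := by
  obtain ⟨N, hN⟩ : ∃ N : ℕ, ∀ y ∈ F, |y| ≤ N := by
    refine ⟨∑ y ∈ F, y.natAbs, fun y hy => ?_⟩
    have : y.natAbs ≤ ∑ y ∈ F, y.natAbs :=
      Finset.single_le_sum (f := fun y : ℤ => y.natAbs) (fun _ _ => Nat.zero_le _) hy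
    rw [Int.abs_eq_natAbs]
    exact_mod_cast this
  -- Numbering of the cells from `-N` to `N` by `e`, and of the `2 * N` boundaries between them by
  -- `e'`, so that `e' j` separates `e j` from `e (j + 1)`.
  set e : ℕ ↪ ℤ := ⟨fun i => (i : ℤ) - N, fun a b h => by simpa using h⟩
  set e' : ℕ ↪ ℤ := ⟨fun i => (i : ℤ) - N + 1, fun a b h => by simpa using h⟩
  have hsub : F ⊆ (Finset.range (2 * N + 1)).map e := by
    intro y hy
    have := abs_le.1 (hN y hy)
    rw [Finset.mem_map]
    refine ⟨(y + N).toNat, ?_, ?_⟩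
    · rw [Finset.mem_range]; omega
    · show (((y + N).toNat : ℕ) : ℤ) - N = y
      omega
  set p : ℕ → ℝ := fun j => Phi ((e' j * D - s) / θ)
  calc ∑ y ∈ F, cellWeight D θ s y
      ≤ ∑ y ∈ (Finset.range (2 * N + 1)).map e, cellWeight D θ s y :=
        Finset.sum_le_sum_of_subset hsub
    _ = ∑ i ∈ Finset.range (2 * N + 1), cellWeight D θ s (e i) := Finset.sum_map _ _ _
    _ ≤ ∑ i ∈ Finset.range (2 * N + 1), ENNReal.ofReal
          (∏ j ∈ Finset.range (2 * N), (if j < i then p j else 1 - p j)) := by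
        refine Finset.sum_le_sum fun i _ => ?_
        refine (cellWeight_le_prod D θ s (e i) ((Finset.range (2 * N)).map e')).trans ?_
        rw [Finset.prod_map]
        refine ENNReal.ofReal_le_ofReal (le_of_eq (Finset.prod_congr rfl fun j _ => ?_))
        have : e' j ≤ e i ↔ j < i := by
          show (j : ℤ) - N + 1 ≤ (i : ℤ) - N ↔ j < i
          omega
        simp only [sideProb, this, p]
    _ = ENNReal.ofReal (∑ i ∈ Finset.range (2 * N + 1),
          ∏ j ∈ Finset.range (2 * N), (if j < i then p j else 1 - p j)) := by
        rw [ENNReal.ofReal_sum_of_nonneg]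
        intro i _
        refine Finset.prod_nonneg fun j _ => ?_
        have h1 := Phi_pos ((e' j * D - s) / θ)
        have h2 := Phi_lt_one ((e' j * D - s) / θ)
        simp only [p]
        split <;> linarith
    _ ≤ 1 := by
        rw [ENNReal.ofReal_le_one]
        exact sum_prod_step_le_one p (fun j => Phi_nonneg _) (fun j => (Phi_lt_one _).le) _

/-- The weight of a vector of cells. -/
def cellWeightVec {k : ℕ} (D θ : ℝ) (s : Fin k → ℝ) (y : Fin k → ℤ) : ℝ≥0∞ :=
  ∏ i, cellWeight D θ (s i) (y i)

theorem tsum_cellWeightVec_le_one {k : ℕ} (D θ : ℝ) (s : Fin k → ℝ) :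
    ∑' y, cellWeightVec D θ s y ≤ 1 := by
  classical
  rw [ENNReal.tsum_eq_iSup_sum]
  refine iSup_le fun F => ?_
  calc ∑ y ∈ F, cellWeightVec D θ s y
      ≤ ∑ y ∈ Fintype.piFinset fun i => F.image fun y => y i, cellWeightVec D θ s y := by
        refine Finset.sum_le_sum_of_subset fun y hy => ?_
        rw [Fintype.mem_piFinset]
        exact fun i => Finset.mem_image_of_mem _ hy
    _ = ∏ i, ∑ z ∈ F.image fun y => y i, cellWeight D θ (s i) z := by
        rw [Finset.prod_univ_sum]
        rfl
    _ ≤ 1 := Finset.prod_le_one' fun i _ => sum_cellWeight_le_one D θ (s i) _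

theorem le_cellWeightVec {k : ℕ} (D θ : ℝ) (s : Fin k → ℝ) (y : Fin k → ℤ) {B : ℝ} (hB : 0 ≤ B)
    (h : ∑ i, cellCost D θ (s i) (y i) ≤ ENNReal.ofReal B) :
    ENNReal.ofReal ((2 : ℝ) ^ (-B)) ≤ cellWeightVec D θ s y := by
  have hne : ∀ i, cellCost D θ (s i) (y i) ≠ ∞ := fun i =>
    ne_top_of_le_ne_top ENNReal.ofReal_ne_top
      ((Finset.single_le_sum (f := fun i => cellCost D θ (s i) (y i)) (fun _ _ => zero_le)
        (Finset.mem_univ i)).trans h)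
  have h1 : ∑ i, (cellCost D θ (s i) (y i)).toReal ≤ B := by
    rw [← ENNReal.toReal_sum fun i _ => hne i]
    exact ENNReal.toReal_le_of_le_ofReal hB h
  have h2 : cellWeightVec D θ s y =
      ENNReal.ofReal (∏ i, (2 : ℝ) ^ (-(cellCost D θ (s i) (y i)).toReal)) := by
    rw [ENNReal.ofReal_prod_of_nonneg fun i _ => by positivity]
    refine Finset.prod_congr rfl fun i _ => ?_
    rw [cellWeight, if_neg (hne i)]
  rw [h2, ← Real.rpow_sum_of_pos (by norm_num)]
  refine ENNReal.ofReal_le_ofReal ?_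
  refine Real.rpow_le_rpow_of_exponent_le (by norm_num) ?_
  rw [Finset.sum_neg_distrib]
  linarith

theorem measurable_cellCost (D θ : ℝ) : Measurable fun z : ℝ × ℤ => cellCost D θ z.1 z.2 := by
  unfold cellCost
  refine Measurable.tsum fun j => ?_
  have h := continuous_Phi.measurable
  have h2 : Measurable fun z : ℝ × ℤ => sideProb D θ z.1 z.2 j := by
    unfold sideProb
    refine Measurable.ite (measurableSet_le measurable_const measurable_snd) ?_ ?_
    · exact h.comp (by fun_prop)
    · exact (h.comp (by fun_prop)).const_sub 1
  unfold Real.logb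
  exact (((Real.measurable_log.comp h2).div_const _).neg).ennreal_ofReal

end EntropyNN

end

/-! ### Rotation invariance and the collision of sample points with a near point. -/

noncomputable section

namespace EntropyNN

open scoped Matrix ENNReal

variable {ι : Type} [Fintype ι] {k : ℕ}

/-! ### The law of a hash vector -/

/-- The law of `k` independent hash functions. -/
def hashVecLaw (ι : Type) [Fintype ι] (k : ℕ) (D : ℝ) : Measure (Fin k → HashFn ι) :=
  Measure.pi fun _ => hashLaw ι D

theorem isProbabilityMeasure_hashVecLaw {D : ℝ} (hD : 0 < D) :
    IsProbabilityMeasure (hashVecLaw ι k D) := by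
  have := isProbabilityMeasure_hashLaw (ι := ι) hD
  unfold hashVecLaw; infer_instance

/-- Moving the origin to `q`, and reducing the shift of a hash function modulo `D`. -/
def recenter (w D : ℝ) (q : ι → ℝ) (h : HashFn ι) : HashFn ι :=
  (h.1, D * Int.fract ((h.2 + (h.1 ⬝ᵥ q) / w) / D))

theorem hash_recenter {w D : ℝ} (hD : D ≠ 0) (q x : ι → ℝ) (h : HashFn ι) :
    hash w D h (q + x) = hash w D (recenter w D q h) x + ⌊(h.2 + (h.1 ⬝ᵥ q) / w) / D⌋ := by
  rw [hash_eq, hash_eq, ← Int.floor_add_intCast]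
  congr 1
  have h1 := Int.fract_add_floor ((h.2 + (h.1 ⬝ᵥ q) / w) / D)
  simp only [recenter]
  rw [add_div (h.1 ⬝ᵥ x / w), mul_div_cancel_left₀ _ hD, add_assoc, h1, dotProduct_add]
  ring

theorem hash_recenter_eq_iff {w D : ℝ} (hD : D ≠ 0) (q x y : ι → ℝ) (h : HashFn ι) :
    hash w D h (q + x) = hash w D h (q + y) ↔
      hash w D (recenter w D q h) x = hash w D (recenter w D q h) y := by
  rw [hash_recenter hD, hash_recenter hD, add_left_inj]

theorem measurable_mul_fract (D : ℝ) : Measurable fun b : ℝ => D * Int.fract (b / D) :=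
  (measurable_fract.comp (measurable_id.div_const D)).const_mul D

theorem measurePreserving_shift {D : ℝ} (hD : 0 < D) (a : ℝ) :
    MeasurePreserving (fun b => D * Int.fract ((b + a) / D)) (shiftLaw D) (shiftLaw D) := by
  have hm : Measurable fun b : ℝ => D * Int.fract ((b + a) / D) :=
    (measurable_mul_fract D).comp (measurable_add_const a)
  refine ⟨hm, Measure.ext_of_lintegral _ fun f hf => ?_⟩
  rw [lintegral_map hf hm]
  have hper : Function.Periodic (fun b => f (D * Int.fract (b / D))) D := by
    intro b
    simp only
    rw [add_div, div_self hD.ne', Int.fract_add_one]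
  rw [lintegral_shiftLaw_add hD hper a, lintegral_shiftLaw, lintegral_shiftLaw]
  congr 1
  -- At the endpoint `b = D` the fractional part drops to 0; the open interval avoids this null
  -- exception.
  rw [← restrict_Ioo_eq_restrict_Ioc]
  refine setLIntegral_congr_fun measurableSet_Ioo fun b hb => ?_
  have : Int.fract (b / D) = b / D :=
    Int.fract_eq_self.2 ⟨div_nonneg hb.1.le hD.le, (div_lt_one hD).2 hb.2⟩
  simp only [this, mul_div_cancel₀ _ hD.ne']

/-- Given the direction of projection, the shift is translated modulo `D` by a fixed amount, which
preserves the uniform law. Hence the query point may be taken as the origin. -/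
theorem measurePreserving_recenter {D : ℝ} (hD : 0 < D) (w : ℝ) (q : ι → ℝ) :
    MeasurePreserving (recenter w D q) (hashLaw ι D) (hashLaw ι D) := by
  have := isProbabilityMeasure_shiftLaw hD
  rw [hashLaw_eq]
  refine (MeasurePreserving.id (normalVec ι)).skew_product
    (g := fun v b => D * Int.fract ((b + (v ⬝ᵥ q) / w) / D)) ?_ ?_
  · have h1 : Measurable fun z : (ι → ℝ) × ℝ => z.2 + (z.1 ⬝ᵥ q) / w :=
      measurable_snd.add (((measurable_dotProduct q).comp measurable_fst).div_const w)
    exact (measurable_mul_fract D).comp h1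
  · exact ae_of_all _ fun v => (measurePreserving_shift hD ((v ⬝ᵥ q) / w)).map_eq

theorem measurePreserving_recenterVec {D : ℝ} (hD : 0 < D) (w : ℝ) (q : ι → ℝ) :
    MeasurePreserving (fun (H : Fin k → HashFn ι) i => recenter w D q (H i)) (hashVecLaw ι k D)
      (hashVecLaw ι k D) := by
  have := isProbabilityMeasure_hashLaw (ι := ι) hD
  exact measurePreserving_pi _ _ fun _ => measurePreserving_recenter hD w q

theorem hashVec_recenter_eq_iff {w D : ℝ} (hD : D ≠ 0) (q x y : ι → ℝ) (H : Fin k → HashFn ι) :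
    hashVec w D H (q + x) = hashVec w D H (q + y) ↔
      hashVec w D (fun i => recenter w D q (H i)) x =
        hashVec w D (fun i => recenter w D q (H i)) y := by
  simp only [funext_iff, hashVec]
  exact forall_congr' fun i => hash_recenter_eq_iff hD q x y (H i)

/-! ### Random points on a sphere -/

theorem spherePoint_eq (q : ι → ℝ) (t : ℝ) (u : ι → ℝ) :
    spherePoint q t u = q + (t / euclNorm u) • u := rfl

theorem spherePoint_eq_add (q : ι → ℝ) (t : ℝ) (u : ι → ℝ) :
    spherePoint q t u = q + spherePoint 0 t u := by
  rw [spherePoint_eq, spherePoint_eq, zero_add]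

theorem measurable_euclNorm : Measurable (euclNorm : (ι → ℝ) → ℝ) := by
  unfold euclNorm dotProduct; fun_prop

theorem measurable_spherePoint (q : ι → ℝ) (t : ℝ) : Measurable (spherePoint q t) := by
  refine measurable_pi_lambda _ fun i => ?_
  have := measurable_euclNorm (ι := ι)
  have h : ∀ u, spherePoint q t u i = q i + t / euclNorm u * u i := fun u => rfl
  simp only [h]
  fun_prop

theorem measurable_hash_uncurry (w D : ℝ) :
    Measurable fun z : HashFn ι × (ι → ℝ) => hash w D z.1 z.2 := by
  unfold hash; fun_prop

theorem measurable_hashVec_uncurry (w D : ℝ) :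
    Measurable fun z : (Fin k → HashFn ι) × (ι → ℝ) => hashVec w D z.1 z.2 := by
  refine measurable_pi_lambda _ fun i => ?_
  have h : Measurable fun z : (Fin k → HashFn ι) × (ι → ℝ) => (z.1 i, z.2) := by fun_prop
  have h2 := (measurable_hash_uncurry (ι := ι) w D).comp h
  simpa only [Function.comp_def, hashVec] using h2

theorem measurable_hashVec {Ω : Type} [MeasurableSpace Ω] (w D : ℝ) {f : Ω → Fin k → HashFn ι}
    {g : Ω → ι → ℝ} (hf : Measurable f) (hg : Measurable g) :
    Measurable fun z => hashVec w D (f z) (g z) := by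
  have h := (measurable_hashVec_uncurry (ι := ι) (k := k) w D).comp (hf.prodMk hg)
  simpa only [Function.comp_def] using h

/-- The probability that a random point on the sphere of radius `t` collides with `x`. -/
def hitProb (w D t : ℝ) (H : Fin k → HashFn ι) (x : ι → ℝ) : ℝ≥0∞ :=
  normalVec ι {u | hashVec w D H (spherePoint 0 t u) = hashVec w D H x}

theorem measurable_hitProb {Ω : Type} [MeasurableSpace Ω] (w D t : ℝ) {f : Ω → Fin k → HashFn ι}
    {g : Ω → ι → ℝ} (hf : Measurable f) (hg : Measurable g) :
    Measurable fun z => hitProb w D t (f z) (g z) := by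
  have hs : MeasurableSet {z : Ω × (ι → ℝ) |
      hashVec w D (f z.1) (spherePoint 0 t z.2) = hashVec w D (f z.1) (g z.1)} :=
    measurableSet_eq_fun
      (measurable_hashVec w D (hf.comp measurable_fst)
        ((measurable_spherePoint 0 t).comp measurable_snd))
      (measurable_hashVec w D (hf.comp measurable_fst) (hg.comp measurable_fst))
  exact measurable_measure_prodMk_left hs

theorem measurable_cellWeightVec (D θ : ℝ) :
    Measurable fun z : (Fin k → ℝ) × (Fin k → ℤ) => cellWeightVec D θ z.1 z.2 := by
  have h : Measurable fun z : ℝ × ℤ => cellWeight D θ z.1 z.2 := by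
    have hc := measurable_cellCost D θ
    unfold cellWeight
    refine Measurable.ite (hc (measurableSet_singleton ∞)) measurable_const ?_
    have := hc.ennreal_toReal
    fun_prop
  unfold cellWeightVec
  refine Finset.measurable_prod _ fun i _ => ?_
  have h1 : Measurable fun z : (Fin k → ℝ) × (Fin k → ℤ) => (z.1 i, z.2 i) := by fun_prop
  have h2 := h.comp h1
  simpa only [Function.comp_def] using h2

/-- A random variable seldom takes a value that it takes with small probability relative to given
weights. -/
theorem measure_lt_weight_le {Ω Y : Type} [MeasurableSpace Ω] [Countable Y] (μ : Measure Ω)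
    (f : Ω → Y) {W : Y → ℝ≥0∞} (hW : ∑' y, W y ≤ 1) (δ : ℝ≥0∞) :
    μ {ω | μ {ω' | f ω' = f ω} < δ * W (f ω)} ≤ δ := by
  classical
  -- A bad outcome takes a value `y` of probability below `δ * W y`. Each such value contributes
  -- less than `δ * W y`, so all of them together contribute at most `δ`.
  have hsub : {ω | μ {ω' | f ω' = f ω} < δ * W (f ω)} ⊆
      ⋃ y, if μ {ω' | f ω' = y} < δ * W y then {ω' | f ω' = y} else ∅ := by
    intro ω hω
    have hω : μ {ω' | f ω' = f ω} < δ * W (f ω) := hω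
    rw [Set.mem_iUnion]
    refine ⟨f ω, ?_⟩
    rw [if_pos hω]
    rfl
  calc μ {ω | μ {ω' | f ω' = f ω} < δ * W (f ω)}
      ≤ ∑' y, μ (if μ {ω' | f ω' = y} < δ * W y then {ω' | f ω' = y} else ∅) :=
        (measure_mono hsub).trans (measure_iUnion_le _)
    _ ≤ ∑' y, δ * W y := by
        refine ENNReal.tsum_le_tsum fun y => ?_
        split
        · rename_i h; exact h.le
        · simp
    _ = δ * ∑' y, W y := ENNReal.tsum_mul_left
    _ ≤ δ := mul_le_of_le_one_right' hW

/-- The event that a random point of the sphere rarely collides with the point in direction `e`,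
relative to the weight of the cell of that point. -/
def lightEvent (w D t : ℝ) (δ : ℝ≥0∞) (H : Fin k → HashFn ι) (x : ι → ℝ) : Prop :=
  hitProb w D t H x < δ * cellWeightVec D (t / w) (fun i => (H i).2) (hashVec w D H x)

theorem measurableSet_lightEvent {Ω : Type} [MeasurableSpace Ω] (w D t : ℝ) (δ : ℝ≥0∞)
    {f : Ω → Fin k → HashFn ι} {g : Ω → ι → ℝ} (hf : Measurable f) (hg : Measurable g) :
    MeasurableSet {z | lightEvent w D t δ (f z) (g z)} := by
  refine measurableSet_lt (measurable_hitProb w D t hf hg) (Measurable.const_mul ?_ δ)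
  have h1 : Measurable fun z i => (f z i).2 := by fun_prop
  have h2 := (measurable_cellWeightVec D (t / w)).comp (h1.prodMk (measurable_hashVec w D hf hg))
  simpa only [Function.comp_def] using h2

/-- The involution exchanging `a` and `b`, applied to all directions of projection, preserves the
law of the hash functions and moves to the hashed points by self-adjointness. The law of the sample
vector is invariant as well, and the shifts are untouched. -/
theorem lightEvent_congr {w D t : ℝ} {δ : ℝ≥0∞} {a b : ι → ℝ}
    (ha : euclNorm a = 1) (hb : euclNorm b = 1) (hD : 0 < D) :
    hashVecLaw ι k D {H | lightEvent w D t δ H (t • a)} =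
      hashVecLaw ι k D {H | lightEvent w D t δ H (t • b)} := by
  obtain ⟨R, hR, hdot, hinv, hsmul, hab⟩ := exists_orthogonal_involution ha hb
  have hP := isProbabilityMeasure_shiftLaw hD
  have hP2 := isProbabilityMeasure_hashLaw (ι := ι) hD
  have hRh : MeasurePreserving (fun h : HashFn ι => (R h.1, h.2)) (hashLaw ι D) (hashLaw ι D) := by
    rw [hashLaw_eq]
    exact hR.prod (MeasurePreserving.id _)
  have hRH : MeasurePreserving (fun (H : Fin k → HashFn ι) i => (R (H i).1, (H i).2))
      (hashVecLaw ι k D) (hashVecLaw ι k D) := measurePreserving_pi _ _ fun _ => hRh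
  have hhash : ∀ (H : Fin k → HashFn ι) x,
      hashVec w D (fun i => (R (H i).1, (H i).2)) x = hashVec w D H (R x) := by
    intro H x
    funext i
    simp only [hashVec, hash_eq, hdot]
  have hnorm : ∀ u, euclNorm (R u) = euclNorm u := by
    intro u
    rw [euclNorm, euclNorm, hdot, hinv]
  have hsph : ∀ u, R (spherePoint 0 t u) = spherePoint 0 t (R u) := by
    intro u
    rw [spherePoint_eq, spherePoint_eq, zero_add, zero_add, hsmul, hnorm]
  have hba : R b = a := by rw [← hab, hinv]
  have hms : MeasurableSet {H : Fin k → HashFn ι | lightEvent w D t δ H (t • b)} :=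
    measurableSet_lightEvent w D t δ measurable_id measurable_const
  rw [← hRH.measure_preimage hms.nullMeasurableSet]
  congr 1
  ext H
  show lightEvent w D t δ H (t • a) ↔
    lightEvent w D t δ (fun i => (R (H i).1, (H i).2)) (t • b)
  have hhit : hitProb w D t (fun i => (R (H i).1, (H i).2)) (t • b) = hitProb w D t H (t • a) := by
    unfold hitProb
    have hm : MeasurableSet {u | hashVec w D H (spherePoint 0 t u) = hashVec w D H (t • a)} :=
      measurableSet_eq_fun (measurable_hashVec w D measurable_const (measurable_spherePoint 0 t))
        measurable_const
    rw [← hR.measure_preimage hm.nullMeasurableSet]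
    congr 1
    ext u
    show hashVec w D _ _ = hashVec w D _ _ ↔ hashVec w D H _ = hashVec w D H _
    rw [hhash, hhash, hsph, hsmul, hba]
  unfold lightEvent
  rw [hhit, hhash, hsmul, hba]

theorem ae_euclNorm_ne_zero [Nonempty ι] : ∀ᵐ u ∂(normalVec ι), euclNorm u ≠ 0 := by
  classical
  obtain ⟨i⟩ := ‹Nonempty ι›
  have ha : euclNorm (Pi.single i (1 : ℝ)) = 1 := by
    simp [euclNorm]
  have h : gaussianReal 0 1 {0} = 0 := by
    have := nullSingletonClass_gaussianReal (μ := 0) (v := 1) one_ne_zero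
    exact measure_singleton 0
  rw [← map_dotProduct_normalVec ha, Measure.map_apply (measurable_dotProduct _)
    (measurableSet_singleton _)] at h
  rw [ae_iff]
  refine measure_mono_null (fun u hu => ?_) h
  have hu : euclNorm u = 0 := not_not.1 hu
  have : u = 0 := by
    rw [euclNorm_eq, norm_eq_zero] at hu
    simpa using congrArg WithLp.ofLp hu
  simp [this]

/-- Replace the fixed direction by a random one. For fixed hash functions `measure_lt_weight_le` and
the Kraft inequality then bound the probability by `δ`; after exchanging the integrals,
`lightEvent_congr` shows that each direction contributes the same value. -/
theorem measure_lightEvent_le [Nonempty ι] {w D t : ℝ} (hD : 0 < D) (δ : ℝ≥0∞) {e : ι → ℝ}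
    (he : euclNorm e = 1) :
    hashVecLaw ι k D {H | lightEvent w D t δ H (t • e)} ≤ δ := by
  have hP := isProbabilityMeasure_hashVecLaw (ι := ι) (k := k) hD
  have hms : MeasurableSet {z : (Fin k → HashFn ι) × (ι → ℝ) |
      lightEvent w D t δ z.1 (spherePoint 0 t z.2)} :=
    measurableSet_lightEvent w D t δ measurable_fst ((measurable_spherePoint 0 t).comp measurable_snd)
  have h1 : ((hashVecLaw ι k D).prod (normalVec ι)) {z : (Fin k → HashFn ι) × (ι → ℝ) |
      lightEvent w D t δ z.1 (spherePoint 0 t z.2)} ≤ δ := by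
    rw [Measure.prod_apply hms]
    calc _ ≤ ∫⁻ _, δ ∂(hashVecLaw ι k D) := by
          refine lintegral_mono fun H => ?_
          exact measure_lt_weight_le (normalVec ι) (fun u => hashVec w D H (spherePoint 0 t u))
            (tsum_cellWeightVec_le_one D (t / w) fun i => (H i).2) δ
      _ = δ := by simp
  rw [Measure.prod_apply_symm hms] at h1
  refine le_trans (le_of_eq ?_) h1
  have h2 : ∀ᵐ u ∂(normalVec ι), hashVecLaw ι k D ((fun H => (H, u)) ⁻¹'
      {z : (Fin k → HashFn ι) × (ι → ℝ) | lightEvent w D t δ z.1 (spherePoint 0 t z.2)}) =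
      hashVecLaw ι k D {H | lightEvent w D t δ H (t • e)} := by
    filter_upwards [ae_euclNorm_ne_zero (ι := ι)] with u hu
    have hu1 : euclNorm ((euclNorm u)⁻¹ • u) = 1 := by
      rw [euclNorm_smul, abs_of_nonneg (inv_nonneg.2 (euclNorm_nonneg u)), inv_mul_cancel₀ hu]
    rw [lightEvent_congr he hu1 hD]
    congr 1
    ext H
    show lightEvent w D t δ H (spherePoint 0 t u) ↔ lightEvent w D t δ H _
    rw [spherePoint_eq, zero_add, smul_smul, div_eq_mul_inv]
  rw [lintegral_congr_ae h2]
  simp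

end EntropyNN

end

noncomputable section

namespace EntropyNN

open scoped Matrix ENNReal

variable {ι : Type} [Fintype ι] {k : ℕ}

theorem lintegral_hashVecLaw_eval {D : ℝ} (hD : 0 < D) (i : Fin k) {f : HashFn ι → ℝ≥0∞}
    (hf : Measurable f) :
    ∫⁻ H, f (H i) ∂(hashVecLaw ι k D) = ∫⁻ h, f h ∂(hashLaw ι D) := by
  have := isProbabilityMeasure_hashLaw (ι := ι) hD
  exact (measurePreserving_eval (fun _ : Fin k => hashLaw ι D) i).lintegral_comp hf

theorem measurable_cellCost_hash (w D θ : ℝ) (x : ι → ℝ) :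
    Measurable fun h : HashFn ι => cellCost D θ h.2 (hash w D h x) := by
  have h := (measurable_cellCost D θ).comp
    ((measurable_snd (α := ι → ℝ)).prodMk (measurable_hash w D x))
  simpa only [Function.comp_def] using h

theorem lintegral_cost {w D t : ℝ} (hw : 0 < w) (hD : 0 < D) (ht : 0 < t) {e : ι → ℝ}
    (he : euclNorm e = 1) :
    ∫⁻ H, ∑ i : Fin k, cellCost D (t / w) (H i).2 (hash w D (H i) (t • e)) ∂(hashVecLaw ι k D) =
      k * ENNReal.ofReal (2 * alpha * (t / w) / D) := by
  have hP := isProbabilityMeasure_shiftLaw hD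
  have hm := measurable_cellCost_hash w D (t / w) (t • e)
  have h1 : ∫⁻ h : HashFn ι, cellCost D (t / w) h.2 (hash w D h (t • e)) ∂(hashLaw ι D) =
      ENNReal.ofReal (2 * alpha * (t / w) / D) := by
    rw [hashLaw_eq, lintegral_prod _ hm.aemeasurable, ← lintegral_cellCost hD (div_pos ht hw)]
    have hm2 : Measurable fun z : ℝ × ℝ => cellCost D (t / w) z.2 ⌊(t / w * z.1 + z.2) / D⌋ := by
      have h2 : Measurable fun z : ℝ × ℝ => (z.2, ⌊(t / w * z.1 + z.2) / D⌋) := by fun_prop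
      have h3 := (measurable_cellCost D (t / w)).comp h2
      simpa only [Function.comp_def] using h3
    have hm3 : Measurable fun g =>
        ∫⁻ s, cellCost D (t / w) s ⌊(t / w * g + s) / D⌋ ∂(shiftLaw D) := hm2.lintegral_prod_right'
    rw [← lintegral_dotProduct_normalVec hm3 he]
    refine lintegral_congr fun v => lintegral_congr fun s => ?_
    simp only [hash_eq, dotProduct_smul, smul_eq_mul]
    rw [mul_div_right_comm]
  have hmi : ∀ i : Fin k, Measurable fun H : Fin k → HashFn ι =>
      cellCost D (t / w) (H i).2 (hash w D (H i) (t • e)) := fun i => by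
    simpa only [Function.comp_def] using
      hm.comp (measurable_pi_apply (X := fun _ : Fin k => HashFn ι) i)
  rw [lintegral_finsetSum _ fun i _ => hmi i]
  have h2 : ∀ i : Fin k, ∫⁻ H : Fin k → HashFn ι, cellCost D (t / w) (H i).2
      (hash w D (H i) (t • e)) ∂(hashVecLaw ι k D) = ENNReal.ofReal (2 * alpha * (t / w) / D) :=
    fun i => (lintegral_hashVecLaw_eval hD i hm).trans h1
  simp only [h2]
  simp

/-- A random point of the sphere collides with a given point of the sphere with probability at least
`δ 2 ^ (-B)`, for most choices of the hash functions. -/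
theorem measure_hitProb_lt_le [Nonempty ι] {w D t B : ℝ} (hw : 0 < w) (hD : 0 < D) (ht : 0 < t)
    (hB : 0 < B) (δ : ℝ≥0∞) {e : ι → ℝ} (he : euclNorm e = 1) :
    hashVecLaw ι k D {H | hitProb w D t H (t • e) < δ * ENNReal.ofReal ((2 : ℝ) ^ (-B))} ≤
      δ + k * ENNReal.ofReal (2 * alpha * (t / w) / D) / ENNReal.ofReal B := by
  set f : (Fin k → HashFn ι) → ℝ≥0∞ := fun H =>
    ∑ i : Fin k, cellCost D (t / w) (H i).2 (hash w D (H i) (t • e)) with hf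
  have hfm : Measurable f := by
    refine Finset.measurable_sum _ fun i _ => ?_
    have h := (measurable_cellCost_hash w D (t / w) (t • e)).comp
      (measurable_pi_apply (X := fun _ : Fin k => HashFn ι) i)
    simpa only [Function.comp_def] using h
  -- A small collision probability means that either the cell of the point is light relative to its
  -- weight, or its cost is at least `B`. The second case is handled by Markov's inequality.
  have hsub : {H | hitProb w D t H (t • e) < δ * ENNReal.ofReal ((2 : ℝ) ^ (-B))} ⊆
      {H | lightEvent w D t δ H (t • e)} ∪ {H | ENNReal.ofReal B ≤ f H} := by
    intro H hH
    by_cases hc : ENNReal.ofReal B ≤ f H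
    · exact Or.inr hc
    · left
      have hH : hitProb w D t H (t • e) < δ * ENNReal.ofReal ((2 : ℝ) ^ (-B)) := hH
      refine lt_of_lt_of_le hH ?_
      gcongr
      exact le_cellWeightVec D (t / w) _ _ hB.le (not_le.1 hc).le
  refine (measure_mono hsub).trans ((measure_union_le _ _).trans ?_)
  gcongr
  · exact measure_lightEvent_le hD δ he
  · rw [← lintegral_cost hw hD ht he]
    exact meas_ge_le_lintegral_div hfm.aemeasurable (by simpa using hB) ENNReal.ofReal_ne_top

theorem measure_hashVec_ne_le {w D : ℝ} (hw : 0 < w) (hD : 0 < D) (x y : ι → ℝ) :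
    hashVecLaw ι k D {H | hashVec w D H x ≠ hashVec w D H y} ≤
      k * ENNReal.ofReal (euclNorm (x - y) / (w * D)) := by
  have hP := isProbabilityMeasure_hashLaw (ι := ι) hD
  have hsub : {H : Fin k → HashFn ι | hashVec w D H x ≠ hashVec w D H y} ⊆
      ⋃ i, {H | hash w D (H i) x ≠ hash w D (H i) y} := by
    intro H hH
    obtain ⟨i, hi⟩ := Function.ne_iff.1 hH
    exact Set.mem_iUnion.2 ⟨i, hi⟩
  have h1 : ∀ i : Fin k, hashVecLaw ι k D {H | hash w D (H i) x ≠ hash w D (H i) y} ≤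
      ENNReal.ofReal (euclNorm (x - y) / (w * D)) := by
    intro i
    have hm : MeasurableSet {h : HashFn ι | hash w D h x ≠ hash w D h y} :=
      (measurableSet_eq_fun (measurable_hash w D x) (measurable_hash w D y)).compl
    have := (measurePreserving_eval (fun _ : Fin k => hashLaw ι D) i).measure_preimage
      hm.nullMeasurableSet
    exact (le_of_eq this).trans (hashLaw_ne_le hw hD x y)
  calc _ ≤ ∑ i : Fin k, hashVecLaw ι k D {H | hash w D (H i) x ≠ hash w D (H i) y} :=
        (measure_mono hsub).trans (measure_iUnion_fintype_le _ _)
    _ ≤ ∑ i : Fin k, ENNReal.ofReal (euclNorm (x - y) / (w * D)) := Finset.sum_le_sum fun i _ => h1 i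
    _ = _ := by simp

theorem exists_sphereRadius {r s : ℝ} (hr : 0 < r) (hs0 : 0 ≤ s) (hs : s ≤ r) {J : ℕ} (hJ : 0 < J) :
    ∃ j : Fin J, |s - sphereRadius r J j| ≤ r / J := by
  have hJ' : (0 : ℝ) < J := by exact_mod_cast hJ
  have hle : s * J / r ≤ J := by
    rw [div_le_iff₀ hr]; nlinarith
  have hnn : 0 ≤ s * J / r := by positivity
  have hs' : s = r * (s * J / r) / J := by field_simp
  -- The sphere with index `j` has radius `r * (j + 1) / J`, so rounding up yields the index `⌈s * J
  -- / r⌉₊ - 1`. When the ceiling is 0, that is for `s = 0`, the innermost sphere is used.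
  rcases Nat.eq_zero_or_pos ⌈s * J / r⌉₊ with h0 | hpos
  · refine ⟨⟨0, hJ⟩, ?_⟩
    have h1 : s * J / r ≤ 0 := by
      have := Nat.le_ceil (s * J / r)
      rw [h0] at this
      exact_mod_cast this
    have h2 : s * J / r = 0 := le_antisymm h1 hnn
    have h3 : s = 0 := by rw [hs', h2]; simp
    rw [h3, sphereRadius]
    simp only [zero_add, Nat.cast_one, mul_one, zero_sub, abs_neg]
    rw [abs_of_pos (div_pos hr hJ')]
  · have hcl : ⌈s * J / r⌉₊ ≤ J := Nat.ceil_le.2 hle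
    refine ⟨⟨⌈s * J / r⌉₊ - 1, by omega⟩, ?_⟩
    have h1 := Nat.le_ceil (s * J / r)
    have h2 := Nat.ceil_lt_add_one hnn
    have h3 : ((⌈s * J / r⌉₊ - 1 + 1 : ℕ) : ℝ) = ⌈s * J / r⌉₊ := by
      congr 1; omega
    have h4 : s - sphereRadius r J ⟨⌈s * J / r⌉₊ - 1, by omega⟩ =
        r / J * (s * J / r - ⌈s * J / r⌉₊) := by
      rw [sphereRadius, h3]
      field_simp
    rw [h4, abs_mul, abs_of_pos (div_pos hr hJ')]
    refine mul_le_of_le_one_right (by positivity) ?_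
    rw [abs_le]
    constructor <;> linarith

theorem sphereRadius_pos {r : ℝ} (hr : 0 < r) {J : ℕ} (j : Fin J) : 0 < sphereRadius r J j := by
  have : (0 : ℝ) < J := by exact_mod_cast j.pos
  unfold sphereRadius
  positivity

theorem sphereRadius_le {r : ℝ} (hr : 0 < r) {J : ℕ} (j : Fin J) : sphereRadius r J j ≤ r := by
  have : (0 : ℝ) < J := by exact_mod_cast j.pos
  have h : ((j.val + 1 : ℕ) : ℝ) ≤ J := by exact_mod_cast j.2
  rw [sphereRadius, div_le_iff₀ this]
  gcongr

theorem exists_direction [Nonempty ι] (x : ι → ℝ) :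
    ∃ e : ι → ℝ, euclNorm e = 1 ∧ x = euclNorm x • e := by
  classical
  by_cases hx : euclNorm x = 0
  · obtain ⟨i⟩ := ‹Nonempty ι›
    refine ⟨Pi.single i 1, by simp [euclNorm], ?_⟩
    have : x = 0 := by
      rw [euclNorm_eq, norm_eq_zero] at hx
      simpa using congrArg WithLp.ofLp hx
    rw [hx, this]; simp
  · refine ⟨(euclNorm x)⁻¹ • x, ?_, ?_⟩
    · rw [euclNorm_smul, abs_of_nonneg (inv_nonneg.2 (euclNorm_nonneg x)), inv_mul_cancel₀ hx]
    · rw [smul_smul, mul_inv_cancel₀ hx, one_smul]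

/-- For most choices of the hash functions, the random points of one of the spheres collide with a
given near point with probability at least `δ 2 ^ (-B)`. -/
theorem exists_radius_measure_le [Nonempty ι] {c D r B : ℝ} (hc : 0 < c) (hD : 0 < D) (hr : 0 < r)
    (hB : 0 < B) (δ : ℝ≥0∞) {J : ℕ} (hJ : 0 < J) (q x : ι → ℝ) (hx : euclNorm (x - q) ≤ r) :
    ∃ j : Fin J, hashVecLaw ι k D {H | normalVec ι {u | hashVec (c * r) D H x =
      hashVec (c * r) D H (spherePoint q (sphereRadius r J j) u)} <
        δ * ENNReal.ofReal ((2 : ℝ) ^ (-B))} ≤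
      δ + k * ENNReal.ofReal (2 * alpha / (c * D)) / ENNReal.ofReal B +
        k * ENNReal.ofReal (1 / (c * D * J)) := by
  have hw : 0 < c * r := mul_pos hc hr
  have hJ' : (0 : ℝ) < J := by exact_mod_cast hJ
  obtain ⟨j, hj⟩ := exists_sphereRadius hr (euclNorm_nonneg (x - q)) hx hJ
  obtain ⟨e, he, hxe⟩ := exists_direction (x - q)
  refine ⟨j, ?_⟩
  set t := sphereRadius r J j with ht
  have htpos : 0 < t := sphereRadius_pos hr j
  have htr : t ≤ r := sphereRadius_le hr j
  set τ := δ * ENNReal.ofReal ((2 : ℝ) ^ (-B))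
  set T : (Fin k → HashFn ι) → (Fin k → HashFn ι) := fun H i => recenter (c * r) D q (H i)
  have hT : MeasurePreserving T (hashVecLaw ι k D) (hashVecLaw ι k D) :=
    measurePreserving_recenterVec hD (c * r) q
  have hms : MeasurableSet {H : Fin k → HashFn ι | hitProb (c * r) D t H (t • e) < τ} :=
    measurableSet_lt (measurable_hitProb _ _ _ measurable_id measurable_const) measurable_const
  -- The near point is moved radially to the sphere of radius `t`, by at most `r / J`. Either some
  -- hash function separates it from its new position, or the two are interchangeable and, after
  -- recentering at `q`, the estimate for points of a sphere applies.
  have hsub : {H | normalVec ι {u | hashVec (c * r) D H x =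
      hashVec (c * r) D H (spherePoint q t u)} < τ} ⊆
      T ⁻¹' {H | hitProb (c * r) D t H (t • e) < τ} ∪
        {H | hashVec (c * r) D H x ≠ hashVec (c * r) D H (q + t • e)} := by
    intro H hH
    by_cases hne : hashVec (c * r) D H x = hashVec (c * r) D H (q + t • e)
    · left
      have hH : normalVec ι {u | hashVec (c * r) D H x =
        hashVec (c * r) D H (spherePoint q t u)} < τ := hH
      show hitProb (c * r) D t (T H) (t • e) < τ
      refine lt_of_le_of_lt (le_of_eq ?_) hH
      unfold hitProb
      congr 1
      ext u
      show _ = _ ↔ _ = _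
      rw [hne, spherePoint_eq_add q, hashVec_recenter_eq_iff hD.ne', eq_comm]
    · exact Or.inr hne
  refine (measure_mono hsub).trans ((measure_union_le _ _).trans ?_)
  rw [hT.measure_preimage hms.nullMeasurableSet]
  gcongr
  · refine (measure_hitProb_lt_le hw hD htpos hB δ he).trans ?_
    -- The mean cost increases with the radius, so the outermost sphere `t = r` is the worst case.
    have hle : 2 * alpha * (t / (c * r)) / D ≤ 2 * alpha / (c * D) := by
      have h1 : 2 * alpha / (c * D) = 2 * alpha * (r / (c * r)) / D := by field_simp
      have h2 : 0 ≤ 2 * alpha := by have := alpha_nonneg; positivity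
      rw [h1]
      gcongr
    have := ENNReal.ofReal_le_ofReal hle
    gcongr
  · refine (measure_hashVec_ne_le hw hD x (q + t • e)).trans ?_
    have h1 : x - (q + t • e) = (euclNorm (x - q) - t) • e := by
      rw [sub_smul, ← hxe]; abel
    rw [h1, euclNorm_smul, he, mul_one]
    refine mul_le_mul_right (ENNReal.ofReal_le_ofReal ?_) _
    calc |euclNorm (x - q) - t| / (c * r * D) ≤ r / J / (c * r * D) := by gcongr
      _ = 1 / (c * D * J) := by field_simp

end EntropyNN

end

/-! ### Far points: concentration of random directions. -/

noncomputable section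

namespace EntropyNN

open scoped Matrix ENNReal

/-! ### Random directions are nearly orthogonal to a fixed direction -/

/-- The expectation equals 1/√3, and e < 3. -/
theorem lintegral_exp_neg_sq_gaussianReal :
    ∫⁻ g, ENNReal.ofReal (Real.exp (-g ^ 2)) ∂(gaussianReal 0 1) ≤
      ENNReal.ofReal (Real.exp (-(1 / 2))) := by
  have hb : ∀ g : ℝ, ‖Real.exp (-g ^ 2)‖ ≤ 1 := by
    intro g
    rw [Real.norm_of_nonneg (Real.exp_pos _).le, Real.exp_le_one_iff]
    nlinarith [sq_nonneg g]
  have hint : Integrable (fun g : ℝ => Real.exp (-g ^ 2)) (gaussianReal 0 1) :=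
    Integrable.of_bound (by fun_prop) 1 (ae_of_all _ hb)
  rw [← ofReal_integral_eq_lintegral_ofReal hint (ae_of_all _ fun g => (Real.exp_pos _).le)]
  refine ENNReal.ofReal_le_ofReal ?_
  rw [integral_gaussianReal_eq_integral_smul one_ne_zero]
  have h1 : ∀ x : ℝ, gaussianPDFReal 0 1 x • Real.exp (-x ^ 2) =
      (√(2 * Real.pi))⁻¹ * Real.exp (-(3 / 2) * x ^ 2) := by
    intro x
    rw [gaussianPDFReal_zero_one, smul_eq_mul, mul_assoc, ← Real.exp_add]
    ring_nf
  simp_rw [h1]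
  have hpi := Real.pi_pos
  rw [integral_const_mul, integral_gaussian, ← Real.sqrt_inv, ← Real.sqrt_mul (by positivity),
    Real.sqrt_le_left (Real.exp_pos _).le, ← Real.exp_nat_mul]
  have h2 : (2 * Real.pi)⁻¹ * (Real.pi / (3 / 2)) = 1 / 3 := by field_simp
  have h3 : ((2 : ℕ) : ℝ) * -(1 / 2) = -1 := by norm_num
  rw [h2, h3, Real.exp_neg, inv_eq_one_div]
  exact one_div_le_one_div_of_le (Real.exp_pos 1) (by linarith [Real.exp_one_lt_d9])

/-- A standard normal vector is seldom short. -/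
theorem normalVec_sum_sq_lt_le (d m : ℕ) :
    normalVec (Coord d m) {u | ∑ i : Fin m, u (Sum.inr i) ^ 2 ≤ m / 4} ≤
      ENNReal.ofReal (Real.exp (-(m / 4))) := by
  set X : Coord d m → (Coord d m → ℝ) → ℝ≥0∞ := fun i u => ENNReal.ofReal (Real.exp (-(u i) ^ 2))
  have hX : ∀ i, Measurable (X i) := fun i => by
    have : Measurable fun u : Coord d m → ℝ => Real.exp (-(u i) ^ 2) := by fun_prop
    exact this.ennreal_ofReal
  have hind : iIndepFun X (normalVec (Coord d m)) := by
    have h := iIndepFun_pi (μ := fun _ : Coord d m => gaussianReal 0 1)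
      (X := fun _ (g : ℝ) => ENNReal.ofReal (Real.exp (-g ^ 2))) (fun _ => by fun_prop)
    exact h
  have hprod : ∫⁻ u, ∏ i : Fin m, X (Sum.inr i) u ∂(normalVec (Coord d m)) ≤
      ENNReal.ofReal (Real.exp (-(1 / 2))) ^ m := by
    have h := lintegral_prod_eq_prod_lintegral_of_indepFun
      (Finset.univ.map ⟨Sum.inr, Sum.inr_injective⟩ : Finset (Coord d m)) X hind hX
    simp only [Finset.prod_map, Function.Embedding.coeFn_mk] at h
    rw [h]
    have h2 : ∀ i : Fin m, ∫⁻ u, X (Sum.inr i) u ∂(normalVec (Coord d m)) ≤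
        ENNReal.ofReal (Real.exp (-(1 / 2))) := by
      intro i
      have := (measurePreserving_eval (fun _ : Coord d m => gaussianReal 0 1)
        (Sum.inr i)).lintegral_comp (f := fun g => ENNReal.ofReal (Real.exp (-g ^ 2)))
        (by fun_prop)
      exact (le_of_eq this).trans lintegral_exp_neg_sq_gaussianReal
    calc _ ≤ ∏ _i : Fin m, ENNReal.ofReal (Real.exp (-(1 / 2))) :=
          Finset.prod_le_prod' fun i _ => h2 i
      _ = _ := by simp
  -- Chernoff's method: the mean of exp(-∑ u²) is at most exp(-m/2), while on the event it is at
  -- least exp(-m/4). Only the appended coordinates are used, so the bound does not depend on `d`.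
  have hsub : {u : Coord d m → ℝ | ∑ i : Fin m, u (Sum.inr i) ^ 2 ≤ m / 4} ⊆
      {u | ENNReal.ofReal (Real.exp (-(m / 4))) ≤ ∏ i : Fin m, X (Sum.inr i) u} := by
    intro u hu
    have hu : ∑ i : Fin m, u (Sum.inr i) ^ 2 ≤ m / 4 := hu
    show _ ≤ ∏ i : Fin m, ENNReal.ofReal (Real.exp (-(u (Sum.inr i)) ^ 2))
    rw [← ENNReal.ofReal_prod_of_nonneg fun _ _ => (Real.exp_pos _).le, ← Real.exp_sum]
    refine ENNReal.ofReal_le_ofReal (Real.exp_le_exp.2 ?_)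
    rw [Finset.sum_neg_distrib]
    linarith
  have hpos : 0 < Real.exp (-((m : ℝ) / 4)) := Real.exp_pos _
  calc _ ≤ _ := measure_mono hsub
    _ ≤ (∫⁻ u, ∏ i : Fin m, X (Sum.inr i) u ∂(normalVec (Coord d m))) /
          ENNReal.ofReal (Real.exp (-(m / 4))) :=
        meas_ge_le_lintegral_div (Finset.measurable_prod _ fun i _ => hX _).aemeasurable
          (by simpa using hpos) ENNReal.ofReal_ne_top
    _ ≤ ENNReal.ofReal (Real.exp (-(1 / 2))) ^ m / ENNReal.ofReal (Real.exp (-(m / 4))) := by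
        gcongr
    _ = ENNReal.ofReal (Real.exp (-(m / 4))) := by
        rw [← ENNReal.ofReal_pow (Real.exp_pos _).le, ← ENNReal.ofReal_div_of_pos hpos,
          ← Real.exp_nat_mul, ← Real.exp_sub]
        congr 2; ring

theorem normalVec_dotProduct_gt_le {ι : Type} [Fintype ι] {a : ι → ℝ} (ha : euclNorm a = 1) {l : ℝ}
    (hl : 0 ≤ l) : normalVec ι {u | l ≤ u ⬝ᵥ a} ≤ ENNReal.ofReal (Real.exp (-l ^ 2 / 2)) := by
  have h : normalVec ι {u | l ≤ u ⬝ᵥ a} = gaussianReal 0 1 (Set.Ici l) := by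
    rw [← map_dotProduct_normalVec ha, Measure.map_apply (measurable_dotProduct a) measurableSet_Ici]
    rfl
  rw [h, gaussianReal_Ici]
  refine ENNReal.ofReal_le_ofReal ((Phi_le_exp hl).trans ?_)
  have := Real.exp_pos (-l ^ 2 / 2)
  linarith

theorem dotProduct_le_euclNorm {ι : Type} [Fintype ι] (x : ι → ℝ) {a : ι → ℝ}
    (ha : euclNorm a = 1) : x ⬝ᵥ a ≤ euclNorm x := by
  have h := real_inner_le_norm (WithLp.toLp 2 a) (WithLp.toLp 2 x)
  rw [← euclNorm_eq, ← euclNorm_eq, ha, one_mul, EuclideanSpace.inner_toLp_toLp] at h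
  simpa using h

variable {k : ℕ}

theorem measure_hashVec_eq_le {ι : Type} [Fintype ι] {w D : ℝ} (hw : 0 < w) (hD : 0 < D)
    (x y : ι → ℝ) {s : ℝ} (hs0 : 0 ≤ s) (hs1 : s ≤ 1) (hs : s * w ≤ euclNorm (x - y)) :
    hashVecLaw ι k D {H | hashVec w D H x = hashVec w D H y} ≤
      ENNReal.ofReal (1 - s * (1 - collisionBound D)) ^ k := by
  have hP := isProbabilityMeasure_hashLaw (ι := ι) hD
  have h : {H : Fin k → HashFn ι | hashVec w D H x = hashVec w D H y} =
      Set.univ.pi fun _ => {h | hash w D h x = hash w D h y} := by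
    ext H
    simp only [Set.mem_pi, Set.mem_univ, forall_const]
    exact funext_iff
  rw [h, hashVecLaw, Measure.pi_pi, Finset.prod_const, Finset.card_univ, Fintype.card_fin]
  gcongr
  exact hashLaw_eq_le hw hD x y hs0 hs1 hs

/-- A random point of a sphere around `q` is hardly closer to a far point than `q` is. -/
theorem le_euclNorm_sub_spherePoint {ι : Type} [Fintype ι] {q y a u : ι → ℝ} {w t ε : ℝ}
    (ht : 0 ≤ t) (htw : t ≤ w) (hε : 0 ≤ ε) (ha : euclNorm a = 1)
    (hya : y - q = euclNorm (y - q) • a) (hy : w ≤ euclNorm (y - q)) (hu : 0 < euclNorm u)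
    (hua : u ⬝ᵥ a ≤ ε * euclNorm u) : (1 - ε) * w ≤ euclNorm (y - spherePoint q t u) := by
  -- Only components along `a` are compared: that of `y - q` is at least `w`, that of the
  -- displacement is at most `ε * t ≤ ε * w`.
  refine le_trans ?_ (dotProduct_le_euclNorm _ ha)
  have haa : a ⬝ᵥ a = 1 := by rw [← euclNorm_mul_self, ha, one_mul]
  have h1 : y - spherePoint q t u = euclNorm (y - q) • a - (t / euclNorm u) • u := by
    rw [← hya, spherePoint_eq]; abel
  rw [h1, sub_dotProduct, smul_dotProduct, smul_dotProduct, haa, smul_eq_mul, smul_eq_mul, mul_one]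
  have h2 : t / euclNorm u * (u ⬝ᵥ a) ≤ w * ε := by
    rw [div_mul_eq_mul_div, div_le_iff₀ hu]
    calc t * (u ⬝ᵥ a) ≤ t * (ε * euclNorm u) := by gcongr
      _ ≤ w * (ε * euclNorm u) := by
        have : 0 ≤ ε * euclNorm u := by positivity
        gcongr
      _ = w * ε * euclNorm u := by ring
  nlinarith

/-- A random point of a sphere around the query point seldom collides with a far point. -/
theorem measure_far_collision_le {d m n : ℕ} (hd : 0 < d) (hn : 1 ≤ n) {w D t : ℝ} (hw : 0 < w)
    (hD : 0 < D) (ht : 0 ≤ t) (htw : t ≤ w)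
    (hk : collisionBound D ^ k ≤ 1 / n)
    (hm : 8 * Real.log n * ((k * ((1 - collisionBound D) / collisionBound D)) ^ 2 + 1) ≤ m)
    (hm1 : 1 ≤ m)
    (q y : Fin d → ℝ) (hy : w ≤ euclNorm (padded m y - padded m q)) :
    ((hashVecLaw (Coord d m) k D).prod (normalVec (Coord d m)))
      {z | hashVec w D z.1 (padded m y) = hashVec w D z.1 (spherePoint (padded m q) t z.2)} ≤
      ENNReal.ofReal (5 / n) := by
  have hn' : (1 : ℝ) ≤ n := by exact_mod_cast hn
  have hln : 0 ≤ Real.log n := Real.log_nonneg hn'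
  have hm' : (1 : ℝ) ≤ m := by exact_mod_cast hm1
  have hne : Nonempty (Coord d m) := ⟨Sum.inl ⟨0, hd⟩⟩
  have hP := isProbabilityMeasure_hashVecLaw (ι := Coord d m) (k := k) hD
  set g := collisionBound D with hg
  have hg0 : 0 < g := collisionBound_pos hD
  have hg1 : g < 1 := collisionBound_lt_one hD
  -- Chosen so that the tail bound exp(-l²/2) equals 1/n.
  set l := √(2 * Real.log n) with hl
  have hl0 : 0 ≤ l := Real.sqrt_nonneg _
  have hl2 : l ^ 2 = 2 * Real.log n := Real.sq_sqrt (by positivity)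
  -- Outside the bad set `u ⬝ᵥ a < l` and the norm of `u` is at least √m / 2, so the cosine of the
  -- angle is at most `2 * l / √m`.
  set ε := 2 * l / √m with hε
  have hsm : 0 < √(m : ℝ) := Real.sqrt_pos.2 (by linarith)
  have hsm2 : √(m : ℝ) ^ 2 = m := Real.sq_sqrt (by linarith)
  have hε0 : 0 ≤ ε := by positivity
  have hε2 : ε ^ 2 = 8 * Real.log n / m := by
    rw [hε, div_pow, mul_pow, hl2, hsm2]; ring
  -- The lower bound `hm` on the padding is designed for two uses of this: `x = 1`, and `x = k * (1
  -- - g) / g`.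
  have hA : ∀ x : ℝ, 0 ≤ x → 8 * Real.log n * x ^ 2 ≤ m → ε * x ≤ 1 := by
    intro x hx hxm
    rw [← sq_le_one_iff₀ (by positivity), mul_pow, hε2, div_mul_eq_mul_div, div_le_one (by linarith)]
    exact hxm
  have hc0 : 0 ≤ k * ((1 - g) / g) := by
    have : 0 ≤ 1 - g := by linarith
    positivity
  have hε1 : ε ≤ 1 := by
    have := hA 1 zero_le_one (by nlinarith [mul_nonneg hln (sq_nonneg (k * ((1 - g) / g)))])
    linarith
  have hεk : ε * (k * ((1 - g) / g)) ≤ 1 := hA _ hc0 (by nlinarith)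
  -- The loss `ε` of distance multiplies `g ^ k` by at most exp(ε k (1 - g) / g) ≤ e < 3. Together
  -- with the two bad events of probability 1/n this makes 5/n.
  have hgood : (1 - (1 - ε) * (1 - g)) ^ k ≤ 3 / n := by
    have h1 : 1 - (1 - ε) * (1 - g) = g * (1 + ε * ((1 - g) / g)) := by
      field_simp; ring
    have h2 : 1 + ε * ((1 - g) / g) ≤ Real.exp (ε * ((1 - g) / g)) := by
      have := Real.add_one_le_exp (ε * ((1 - g) / g)); linarith
    have h3 : 0 ≤ (1 - g) / g := div_nonneg (by linarith) hg0.le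
    have h4 : (1 + ε * ((1 - g) / g)) ^ k ≤ 3 := by
      calc (1 + ε * ((1 - g) / g)) ^ k ≤ Real.exp (ε * ((1 - g) / g)) ^ k := by gcongr
        _ = Real.exp (k * (ε * ((1 - g) / g))) := (Real.exp_nat_mul _ _).symm
        _ ≤ Real.exp 1 := by
          refine Real.exp_le_exp.2 ?_
          linarith
        _ ≤ 3 := by linarith [Real.exp_one_lt_d9]
    rw [h1, mul_pow]
    calc g ^ k * (1 + ε * ((1 - g) / g)) ^ k ≤ 1 / n * 3 := by gcongr
      _ = 3 / n := by ring
  obtain ⟨a, ha, hya⟩ := exists_direction (padded m y - padded m q)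
  set bad : Set (Coord d m → ℝ) := {u | l ≤ u ⬝ᵥ a} ∪ {u | ∑ i : Fin m, u (Sum.inr i) ^ 2 ≤ m / 4}
    with hbad
  have hexp : ∀ x : ℝ, Real.log n ≤ x → Real.exp (-x) ≤ 1 / n := by
    intro x hx
    rw [Real.exp_neg, ← one_div]
    refine one_div_le_one_div_of_le (by linarith) ?_
    rwa [← Real.log_le_iff_le_exp (by linarith)]
  have hbadle : normalVec (Coord d m) bad ≤ ENNReal.ofReal (2 / n) := by
    refine (measure_union_le _ _).trans ?_
    have e : ENNReal.ofReal (2 / n) = ENNReal.ofReal (1 / n) + ENNReal.ofReal (1 / n) := by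
      rw [← ENNReal.ofReal_add (by positivity) (by positivity)]
      congr 1; ring
    rw [e]
    refine add_le_add ?_ ?_
    · refine (normalVec_dotProduct_gt_le ha hl0).trans (ENNReal.ofReal_le_ofReal ?_)
      rw [hl2, neg_div]
      exact hexp _ (by linarith)
    · refine (normalVec_sum_sq_lt_le d m).trans (ENNReal.ofReal_le_ofReal ?_)
      exact hexp _ (by nlinarith [mul_nonneg hln (sq_nonneg (k * ((1 - g) / g)))])
  have hms : MeasurableSet {z : (Fin k → HashFn (Coord d m)) × (Coord d m → ℝ) |
      hashVec w D z.1 (padded m y) = hashVec w D z.1 (spherePoint (padded m q) t z.2)} :=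
    measurableSet_eq_fun (measurable_hashVec w D measurable_fst measurable_const)
      (measurable_hashVec w D measurable_fst ((measurable_spherePoint _ t).comp measurable_snd))
  have hbm : MeasurableSet bad := by
    refine MeasurableSet.union ?_ ?_
    · exact measurableSet_le measurable_const (measurable_dotProduct a)
    · exact measurableSet_le (by fun_prop) measurable_const
  rw [Measure.prod_apply_symm hms]
  calc _ ≤ ∫⁻ u, (ENNReal.ofReal (3 / n) + bad.indicator 1 u) ∂(normalVec (Coord d m)) := by
        refine lintegral_mono fun u => ?_
        by_cases hu : u ∈ bad
        · rw [Set.indicator_of_mem hu]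
          exact prob_le_one.trans le_add_self
        · rw [Set.indicator_of_notMem hu, add_zero]
          rw [hbad, Set.mem_union, not_or] at hu
          have hu1 : u ⬝ᵥ a < l := not_le.1 hu.1
          have hu2 : (m : ℝ) / 4 < ∑ i : Fin m, u (Sum.inr i) ^ 2 := not_le.1 hu.2
          have hun : √(m : ℝ) / 2 ≤ euclNorm u := by
            unfold euclNorm
            refine Real.le_sqrt_of_sq_le ?_
            rw [div_pow, hsm2, dotProduct, Fintype.sum_sum_type]
            have h1 : 0 ≤ ∑ i : Fin d, u (Sum.inl i) * u (Sum.inl i) :=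
              Finset.sum_nonneg fun i _ => mul_self_nonneg _
            simp only [← sq] at h1 ⊢
            linarith
          have hu0 : 0 < euclNorm u := lt_of_lt_of_le (by positivity) hun
          have hua : u ⬝ᵥ a ≤ ε * euclNorm u := by
            refine hu1.le.trans ?_
            calc l = ε * (√(m : ℝ) / 2) := by rw [hε]; field_simp
              _ ≤ ε * euclNorm u := by gcongr
          have hdist := le_euclNorm_sub_spherePoint ht htw hε0 ha hya hy hu0 hua
          refine (measure_hashVec_eq_le hw hD (padded m y) (spherePoint (padded m q) t u)
            (s := 1 - ε) (by linarith) (by linarith) hdist).trans ?_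
          rw [← ENNReal.ofReal_pow (by nlinarith)]
          exact ENNReal.ofReal_le_ofReal hgood
    _ = ENNReal.ofReal (3 / n) + normalVec (Coord d m) bad := by
        rw [lintegral_add_left measurable_const, lintegral_indicator_one hbm]
        simp
    _ ≤ ENNReal.ofReal (3 / n) + ENNReal.ofReal (2 / n) := by gcongr
    _ = ENNReal.ofReal (5 / n) := by
        rw [← ENNReal.ofReal_add (by positivity) (by positivity)]
        congr 1; ring

end EntropyNN

end

/-! ### Failure probabilities of a table and of the whole search. -/

noncomputable section

namespace EntropyNN

open scoped Matrix ENNReal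

variable {k : ℕ}

theorem euclNorm_padded_sub {d : ℕ} (m : ℕ) (p q : EuclideanSpace ℝ (Fin d)) :
    euclNorm (padded m (fun j => p j) - padded m fun j => q j) = dist p q := by
  rw [EuclideanSpace.dist_eq, euclNorm, dotProduct, Fintype.sum_sum_type]
  simp [padded, Real.dist_eq, sq]

/-- The probability that none of the sample points collides with a near point. -/
theorem measure_no_hit_le {ι : Type} [Fintype ι] [Nonempty ι] {c D r B δ η : ℝ} (hc : 0 < c)
    (hD : 0 < D) (hr : 0 < r) (hB : 0 < B) (hδ : 0 < δ) (hδ1 : δ ≤ 1) {J S : ℕ} (hJ : 0 < J)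
    (hη : 0 < η)
    (h1 : δ + k * (2 * alpha / (c * D)) / B + k * (1 / (c * D * J)) ≤ 1 - 3 * η)
    (h2 : Real.exp (-(δ * (2 : ℝ) ^ (-B) * S)) ≤ η)
    (q x : ι → ℝ) (hx : euclNorm (x - q) ≤ r) :
    ((hashVecLaw ι k D).prod (Measure.pi fun _ : Fin J × Fin S => normalVec ι))
      {z | ∀ a, hashVec (c * r) D z.1 x ≠
        hashVec (c * r) D z.1 (spherePoint q (sphereRadius r J a.1) (z.2 a))} ≤
      ENNReal.ofReal (1 - 2 * η) := by
  classical
  have hP := isProbabilityMeasure_hashVecLaw (ι := ι) (k := k) hD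
  have hJ' : (0 : ℝ) < J := by exact_mod_cast hJ
  have hα := alpha_nonneg
  obtain ⟨j, hj⟩ := exists_radius_measure_le (k := k) hc hD hr hB (ENNReal.ofReal δ) hJ q x hx
  set t := sphereRadius r J j
  set w := c * r
  set τ := δ * (2 : ℝ) ^ (-B) with hτ
  have hτ0 : 0 < τ := by positivity
  have hτ1 : τ ≤ 1 := by
    have : (2 : ℝ) ^ (-B) ≤ 1 := Real.rpow_le_one_of_one_le_of_nonpos (by norm_num) (by linarith)
    have h0 : (0 : ℝ) < (2 : ℝ) ^ (-B) := by positivity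
    nlinarith
  rw [← ENNReal.ofReal_mul hδ.le] at hj
  set light : Set (Fin k → HashFn ι) := {H | normalVec ι {u | hashVec w D H x =
    hashVec w D H (spherePoint q t u)} < ENNReal.ofReal τ} with hlight
  have hlm : MeasurableSet light := by
    have hs : MeasurableSet {z : (Fin k → HashFn ι) × (ι → ℝ) |
        hashVec w D z.1 x = hashVec w D z.1 (spherePoint q t z.2)} :=
      measurableSet_eq_fun (measurable_hashVec w D measurable_fst measurable_const)
        (measurable_hashVec w D measurable_fst ((measurable_spherePoint q t).comp measurable_snd))
    exact measurableSet_lt (measurable_measure_prodMk_left hs) measurable_const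
  have hle : hashVecLaw ι k D light ≤ ENNReal.ofReal (1 - 3 * η) := by
    refine hj.trans ?_
    rw [← ENNReal.ofReal_natCast k, ← ENNReal.ofReal_mul (by positivity),
      ← ENNReal.ofReal_div_of_pos hB, ← ENNReal.ofReal_mul (by positivity),
      ← ENNReal.ofReal_add (by positivity) (by positivity),
      ← ENNReal.ofReal_add (by positivity) (by positivity)]
    exact ENNReal.ofReal_le_ofReal h1
  have hms : MeasurableSet {z : (Fin k → HashFn ι) × (Fin J × Fin S → ι → ℝ) | ∀ a,
      hashVec w D z.1 x ≠ hashVec w D z.1 (spherePoint q (sphereRadius r J a.1) (z.2 a))} := by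
    have : ∀ a : Fin J × Fin S, MeasurableSet
        {z : (Fin k → HashFn ι) × (Fin J × Fin S → ι → ℝ) | hashVec w D z.1 x ≠
          hashVec w D z.1 (spherePoint q (sphereRadius r J a.1) (z.2 a))} := fun a =>
      (measurableSet_eq_fun (measurable_hashVec w D measurable_fst measurable_const)
        (measurable_hashVec w D measurable_fst ((measurable_spherePoint q _).comp
          ((measurable_pi_apply a).comp measurable_snd)))).compl
    have h := MeasurableSet.iInter this
    convert h using 1
    ext z
    simp
  have hsec : ∀ H, H ∉ light → (Measure.pi fun _ : Fin J × Fin S => normalVec ι) {u | ∀ a,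
      hashVec w D H x ≠ hashVec w D H (spherePoint q (sphereRadius r J a.1) (u a))} ≤
        ENNReal.ofReal η := by
    intro H hH
    have hH : ENNReal.ofReal τ ≤ normalVec ι {u | hashVec w D H x =
      hashVec w D H (spherePoint q t u)} := not_lt.1 hH
    set A : Set (ι → ℝ) := {u | hashVec w D H x ≠ hashVec w D H (spherePoint q t u)}
    have hAm : MeasurableSet {u | hashVec w D H x = hashVec w D H (spherePoint q t u)} :=
      measurableSet_eq_fun measurable_const
        (measurable_hashVec w D measurable_const (measurable_spherePoint q t))
    have hA : normalVec ι A ≤ ENNReal.ofReal (1 - τ) := by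
      have : normalVec ι A = 1 - normalVec ι {u | hashVec w D H x =
        hashVec w D H (spherePoint q t u)} := prob_compl_eq_one_sub hAm
      rw [this, ENNReal.ofReal_sub _ hτ0.le, ENNReal.ofReal_one]
      exact tsub_le_tsub_left hH 1
    -- Only the `S` independent samples on the sphere with index `j` are counted on; those of the
    -- other spheres are ignored.
    have hsub : {u : Fin J × Fin S → ι → ℝ | ∀ a, hashVec w D H x ≠
        hashVec w D H (spherePoint q (sphereRadius r J a.1) (u a))} ⊆
        Set.univ.pi fun a => if a.1 = j then A else Set.univ := by
      intro u hu a _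
      show u a ∈ if a.1 = j then A else Set.univ
      by_cases ha : a.1 = j
      · rw [if_pos ha]
        have := hu a
        rw [ha] at this
        exact this
      · rw [if_neg ha]; trivial
    refine (measure_mono hsub).trans ?_
    rw [Measure.pi_pi, Fintype.prod_prod_type, Finset.prod_eq_single j]
    · simp only [if_true, Finset.prod_const, Finset.card_univ, Fintype.card_fin]
      calc normalVec ι A ^ S ≤ ENNReal.ofReal (1 - τ) ^ S := by gcongr
        _ = ENNReal.ofReal ((1 - τ) ^ S) := (ENNReal.ofReal_pow (by linarith) S).symm
        _ ≤ ENNReal.ofReal η := by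
          refine ENNReal.ofReal_le_ofReal (le_trans ?_ h2)
          have h3 : 1 - τ ≤ Real.exp (-τ) := by linarith [Real.add_one_le_exp (-τ)]
          calc (1 - τ) ^ S ≤ Real.exp (-τ) ^ S := by
                have : 0 ≤ 1 - τ := by linarith
                gcongr
            _ = Real.exp (-(τ * S)) := by rw [← Real.exp_nat_mul]; congr 1; ring
    · intro b _ hb
      simp [hb]
    · simp
  rw [Measure.prod_apply hms]
  calc _ ≤ ∫⁻ H, (light.indicator 1 H + ENNReal.ofReal η) ∂(hashVecLaw ι k D) := by
        refine lintegral_mono fun H => ?_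
        by_cases hH : H ∈ light
        · rw [Set.indicator_of_mem hH]
          exact prob_le_one.trans le_self_add
        · rw [Set.indicator_of_notMem hH, zero_add]
          exact hsec H hH
    _ = hashVecLaw ι k D light + ENNReal.ofReal η := by
        rw [lintegral_add_right _ measurable_const, lintegral_indicator_one hlm]
        simp
    _ ≤ ENNReal.ofReal (1 - 3 * η) + ENNReal.ofReal η := by gcongr
    _ = ENNReal.ofReal (1 - 2 * η) := by
        have h3 : 0 ≤ 1 - 3 * η := le_trans (by positivity) h1
        rw [← ENNReal.ofReal_add h3 hη.le]
        congr 1; ring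

/-- The probability that too many far points collide with sample points. -/
theorem measure_budget_le {d m n J S budget : ℕ} (hd : 0 < d) (hn : 1 ≤ n) {w D r η : ℝ}
    (hw : 0 < w) (hD : 0 < D) (hr : 0 < r) (hrw : r ≤ w) (hη : 0 ≤ η)
    (hk : collisionBound D ^ k ≤ 1 / n)
    (hm : 8 * Real.log n * ((k * ((1 - collisionBound D) / collisionBound D)) ^ 2 + 1) ≤ m)
    (hm1 : 1 ≤ m) (hb0 : 0 < budget) (hb : 5 * (J * S : ℕ) ≤ η * budget)
    (P : Fin n → EuclideanSpace ℝ (Fin d)) (q : EuclideanSpace ℝ (Fin d)) :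
    ((hashVecLaw (Coord d m) k D).prod
      (Measure.pi fun _ : Fin J × Fin S => normalVec (Coord d m)))
      {z | budget ≤ ∑ a, farCount w D z.1 (fun i => padded m fun j => P i j)
        (fun i => w < dist (P i) q)
        (spherePoint (padded m fun j => q j) (sphereRadius r J a.1) (z.2 a))} ≤
      ENNReal.ofReal η := by
  classical
  have hP := isProbabilityMeasure_hashVecLaw (ι := Coord d m) (k := k) hD
  set E : Fin J × Fin S → Fin n → Set ((Fin k → HashFn (Coord d m)) ×
      (Fin J × Fin S → Coord d m → ℝ)) := fun a i =>
    if w < dist (P i) q then {z | hashVec w D z.1 (padded m fun j => P i j) =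
      hashVec w D z.1 (spherePoint (padded m fun j => q j) (sphereRadius r J a.1) (z.2 a))} else ∅
    with hE
  have hEm : ∀ a i, MeasurableSet (E a i) := by
    intro a i
    simp only [hE]
    split
    · exact measurableSet_eq_fun (measurable_hashVec w D measurable_fst measurable_const)
        (measurable_hashVec w D measurable_fst ((measurable_spherePoint _ _).comp
          ((measurable_pi_apply a).comp measurable_snd)))
    · exact MeasurableSet.empty
  have hEle : ∀ a i, ((hashVecLaw (Coord d m) k D).prod
      (Measure.pi fun _ : Fin J × Fin S => normalVec (Coord d m))) (E a i) ≤
      ENNReal.ofReal (5 / n) := by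
    intro a i
    simp only [hE]
    split
    · rename_i hfar
      have hmp := (MeasurePreserving.id (hashVecLaw (Coord d m) k D)).prod
        (measurePreserving_eval (fun _ : Fin J × Fin S => normalVec (Coord d m)) a)
      have hms : MeasurableSet {z : (Fin k → HashFn (Coord d m)) × (Coord d m → ℝ) |
          hashVec w D z.1 (padded m fun j => P i j) = hashVec w D z.1
            (spherePoint (padded m fun j => q j) (sphereRadius r J a.1) z.2)} :=
        measurableSet_eq_fun (measurable_hashVec w D measurable_fst measurable_const)
          (measurable_hashVec w D measurable_fst
            ((measurable_spherePoint _ _).comp measurable_snd))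
      have h1 := hmp.measure_preimage hms.nullMeasurableSet
      refine (le_of_eq h1).trans ?_
      refine measure_far_collision_le hd hn hw hD (sphereRadius_pos hr a.1).le
        ((sphereRadius_le hr a.1).trans hrw) hk hm hm1 _ _ ?_
      rw [euclNorm_padded_sub]
      exact hfar.le
    · simp
  set f : (Fin k → HashFn (Coord d m)) × (Fin J × Fin S → Coord d m → ℝ) → ℝ≥0∞ := fun z =>
    ∑ a, ∑ i, (E a i).indicator 1 z with hf
  have hfm : Measurable f := Finset.measurable_sum _ fun a _ => Finset.measurable_sum _ fun i _ =>
    measurable_one.indicator (hEm a i)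
  have hcount : ∀ z, ((∑ a, farCount w D z.1 (fun i => padded m fun j => P i j)
        (fun i => w < dist (P i) q) (spherePoint (padded m fun j => q j)
          (sphereRadius r J a.1) (z.2 a)) : ℕ) : ℝ≥0∞) = f z := by
    intro z
    rw [hf, Nat.cast_sum]
    refine Finset.sum_congr rfl fun a _ => ?_
    rw [farCount, Nat.card_eq_fintype_card, Fintype.card_subtype, Finset.card_filter, Nat.cast_sum]
    refine Finset.sum_congr rfl fun i _ => ?_
    by_cases h1 : w < dist (P i) q
    · by_cases h2 : hashVec w D z.1 (padded m fun j => P i j) = hashVec w D z.1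
        (spherePoint (padded m fun j => q j) (sphereRadius r J a.1) (z.2 a))
      · simp [hE, h1, h2]
      · simp [hE, h1, h2]
    · simp [hE, h1]
  -- Each of the `J * S` samples meets each of at most `n` far points with probability at most 5/n.
  -- Linearity of expectation suffices, although the samples of a table share its hash functions.
  have hint : ∫⁻ z, f z ∂((hashVecLaw (Coord d m) k D).prod
      (Measure.pi fun _ : Fin J × Fin S => normalVec (Coord d m))) ≤
      ENNReal.ofReal (5 * (J * S : ℕ)) := by
    rw [hf, lintegral_finsetSum _ fun a _ => Finset.measurable_sum _ fun i _ =>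
      measurable_one.indicator (hEm a i)]
    have h1 : ∀ a, ∫⁻ z, ∑ i, (E a i).indicator 1 z ∂((hashVecLaw (Coord d m) k D).prod
        (Measure.pi fun _ : Fin J × Fin S => normalVec (Coord d m))) ≤ ENNReal.ofReal 5 := by
      intro a
      rw [lintegral_finsetSum _ fun i _ => measurable_one.indicator (hEm a i)]
      have hn' : (n : ℝ) ≠ 0 := by
        have : n ≠ 0 := by omega
        exact_mod_cast this
      calc _ ≤ ∑ _i : Fin n, ENNReal.ofReal (5 / n) := by
            refine Finset.sum_le_sum fun i _ => ?_
            rw [lintegral_indicator_one (hEm a i)]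
            exact hEle a i
        _ = ENNReal.ofReal 5 := by
            rw [Finset.sum_const, Finset.card_univ, Fintype.card_fin, nsmul_eq_mul,
              ← ENNReal.ofReal_natCast, ← ENNReal.ofReal_mul (by positivity)]
            congr 1
            field_simp
    calc _ ≤ ∑ _a : Fin J × Fin S, ENNReal.ofReal 5 := Finset.sum_le_sum fun a _ => h1 a
      _ = ENNReal.ofReal (5 * (J * S : ℕ)) := by
          rw [Finset.sum_const, Finset.card_univ, Fintype.card_prod, Fintype.card_fin,
            Fintype.card_fin, nsmul_eq_mul, ← ENNReal.ofReal_natCast,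
            ← ENNReal.ofReal_mul (by positivity), mul_comm]
  have hsub : {z : (Fin k → HashFn (Coord d m)) × (Fin J × Fin S → Coord d m → ℝ) |
      budget ≤ ∑ a, farCount w D z.1 (fun i => padded m fun j => P i j)
        (fun i => w < dist (P i) q) (spherePoint (padded m fun j => q j)
          (sphereRadius r J a.1) (z.2 a))} ⊆ {z | (budget : ℝ≥0∞) ≤ f z} := by
    intro z hz
    show (budget : ℝ≥0∞) ≤ f z
    rw [← hcount z]
    exact_mod_cast hz
  refine (measure_mono hsub).trans ((meas_ge_le_lintegral_div hfm.aemeasurable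
    (by exact_mod_cast hb0.ne') (ENNReal.natCast_ne_top _)).trans ?_)
  refine ENNReal.div_le_of_le_mul (hint.trans ?_)
  rw [← ENNReal.ofReal_natCast budget, ← ENNReal.ofReal_mul hη]
  exact ENNReal.ofReal_le_ofReal hb

/-- The failure probability of a table. -/
theorem measure_tableFail_le {d n : ℕ} {prm : Params} (hd : 0 < d) (hn : 1 ≤ n)
    {c D r B δ η : ℝ} (hc : 1 ≤ c) (hD : 0 < D) (hr : 0 < r) (hB : 0 < B) (hδ : 0 < δ)
    (hδ1 : δ ≤ 1) (hJ : 0 < prm.radii) (hη : 0 < η)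
    (hk : collisionBound D ^ k ≤ 1 / n)
    (hm : 8 * Real.log n * ((k * ((1 - collisionBound D) / collisionBound D)) ^ 2 + 1) ≤ prm.pad)
    (hm1 : 1 ≤ prm.pad)
    (h1 : δ + k * (2 * alpha / (c * D)) / B + k * (1 / (c * D * prm.radii)) ≤ 1 - 3 * η)
    (h2 : Real.exp (-(δ * (2 : ℝ) ^ (-B) * prm.samples)) ≤ η)
    (hb0 : 0 < prm.budget) (hb : 5 * (prm.radii * prm.samples : ℕ) ≤ η * prm.budget)
    (P : Fin n → EuclideanSpace ℝ (Fin d)) (q : EuclideanSpace ℝ (Fin d))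
    (hq : ∃ i, dist (P i) q ≤ r) :
    ((hashVecLaw (Coord d prm.pad) k D).prod
      (Measure.pi fun _ : Fin prm.radii × Fin prm.samples => normalVec (Coord d prm.pad)))
      {z | tableFail (c * r) D r P q z.1 z.2} ≤ ENNReal.ofReal (1 - η) := by
  obtain ⟨i, hi⟩ := hq
  have hne : Nonempty (Coord d prm.pad) := ⟨Sum.inl ⟨0, hd⟩⟩
  have hrw : r ≤ c * r := le_mul_of_one_le_left hr.le hc
  have hα := alpha_nonneg
  have hη2 : 0 ≤ 1 - 3 * η := le_trans (by positivity) h1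
  have e1 := measure_budget_le (J := prm.radii) (S := prm.samples) hd hn
    (mul_pos (by linarith) hr) hD hr hrw hη.le hk hm hm1 hb0 hb P q
  have e2 := measure_no_hit_le (by linarith) hD hr hB hδ hδ1 hJ hη h1 h2
    (padded prm.pad fun j => q j) (padded prm.pad fun j => P i j)
    (by rw [euclNorm_padded_sub]; exact hi)
  refine (measure_mono ?_).trans ((measure_union_le _ _).trans ((add_le_add e1 e2).trans ?_))
  · intro z hz
    rcases hz with hz | hz
    · exact Or.inl hz
    -- One point within `r` is enough: if a sample hits its bucket, the second alternative of
    -- `tableFail` is excluded.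
    · exact Or.inr fun a => hz a i (hi.trans hrw)
  rw [← ENNReal.ofReal_add hη.le (by linarith)]
  exact ENNReal.ofReal_le_ofReal (by linarith)

/-- The failure probability of the search. -/
theorem measure_search_none_le {d n : ℕ} {prm : Params} {c D r p : ℝ} (hD : 0 < D)
    (hw : 0 ≤ c * r) (hp : 0 ≤ p)
    (P : Fin n → EuclideanSpace ℝ (Fin d)) (q : EuclideanSpace ℝ (Fin d))
    (h : ((hashVecLaw (Coord d prm.pad) k D).prod
      (Measure.pi fun _ : Fin prm.radii × Fin prm.samples => normalVec (Coord d prm.pad)))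
      {z | tableFail (c * r) D r P q z.1 z.2} ≤ ENNReal.ofReal p) :
    ((buildLaw d k prm D).prod (searchLaw d prm))
      {ω | (search c D r (build (c * r) D P ω.1) q ω.2).val = none} ≤
      ENNReal.ofReal (p ^ prm.tables) := by
  have hP := isProbabilityMeasure_hashVecLaw (ι := Coord d prm.pad) (k := k) hD
  -- The seeds of construction and search are regrouped table by table; the tables are then
  -- independent and the failure probabilities multiply.
  have hmp := measurePreserving_arrowProdEquivProdArrow (Fin k → HashFn (Coord d prm.pad))
    (Fin prm.radii × Fin prm.samples → Coord d prm.pad → ℝ) (Fin prm.tables)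
    (fun _ => hashVecLaw (Coord d prm.pad) k D) (fun _ => Measure.pi fun _ => normalVec _)
  have hsub : {ω : BuildSeed d k prm × SearchSeed d prm |
      (search c D r (build (c * r) D P ω.1) q ω.2).val = none} ⊆
      {ω | ∀ l, tableFail (c * r) D r P q (ω.1 l) (ω.2 l)} :=
    fun ω hω l => search_none hw P ω.1 q ω.2 hω l
  refine (measure_mono hsub).trans ?_
  have h2 := hmp.measure_preimage_equiv
    {ω | ∀ l, tableFail (c * r) D r P q (ω.1 l) (ω.2 l)}
  refine (le_of_eq h2.symm).trans ?_
  have h3 : (MeasurableEquiv.arrowProdEquivProdArrow (Fin k → HashFn (Coord d prm.pad))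
      (Fin prm.radii × Fin prm.samples → Coord d prm.pad → ℝ) (Fin prm.tables)) ⁻¹'
      {ω | ∀ l, tableFail (c * r) D r P q (ω.1 l) (ω.2 l)} =
      Set.univ.pi fun _ => {z | tableFail (c * r) D r P q z.1 z.2} := by
    ext ω
    simp only [Set.mem_pi, Set.mem_univ, forall_const]
    rfl
  rw [h3, Measure.pi_pi, Finset.prod_const, Finset.card_univ, Fintype.card_fin,
    ENNReal.ofReal_pow hp]
  gcongr

end EntropyNN

end

/-! ### Choice of the parameters and asymptotic bounds. -/

noncomputable section

namespace EntropyNN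

/-! ### Polylogarithmic bounds -/

/-- A nonnegative function that is bounded by a polynomial of the logarithm. -/
def PolyLog (f : ℕ → ℝ) : Prop :=
  (∀ n, 2 ≤ n → 0 ≤ f n) ∧ ∃ K : ℕ, ∀ n, 2 ≤ n → f n ≤ K * Real.logb 2 n ^ K

theorem one_le_logb {n : ℕ} (hn : 2 ≤ n) : 1 ≤ Real.logb 2 n := by
  have hn' : (2 : ℝ) ≤ n := by exact_mod_cast hn
  rw [Real.le_logb_iff_rpow_le (by norm_num) (by linarith), Real.rpow_one]
  exact hn'

theorem mul_pow_logb_mono {n K L : ℕ} (hn : 2 ≤ n) (h : K ≤ L) :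
    (K : ℝ) * Real.logb 2 n ^ K ≤ L * Real.logb 2 n ^ L := by
  have h1 := one_le_logb hn
  have h2 : (K : ℝ) ≤ L := by exact_mod_cast h
  exact mul_le_mul h2 (pow_le_pow_right₀ h1 h) (by positivity) (by positivity)

namespace PolyLog

theorem mono {f g : ℕ → ℝ} (hg : PolyLog g) (h0 : ∀ n, 2 ≤ n → 0 ≤ f n)
    (h : ∀ n, 2 ≤ n → f n ≤ g n) : PolyLog f := by
  obtain ⟨_, K, hK⟩ := hg
  exact ⟨h0, K, fun n hn => (h n hn).trans (hK n hn)⟩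

theorem const {a : ℝ} (ha : 0 ≤ a) : PolyLog fun _ => a := by
  refine ⟨fun _ _ => ha, ⌈a⌉₊, fun n hn => (Nat.le_ceil a).trans ?_⟩
  exact le_mul_of_one_le_right (Nat.cast_nonneg _) (one_le_pow₀ (one_le_logb hn))

theorem logb : PolyLog fun n => Real.logb 2 n := by
  refine ⟨fun n hn => zero_le_one.trans (one_le_logb hn), 1, fun n _ => ?_⟩
  simp

theorem add {f g : ℕ → ℝ} (hf : PolyLog f) (hg : PolyLog g) : PolyLog fun n => f n + g n := by
  obtain ⟨hf0, K, hK⟩ := hf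
  obtain ⟨hg0, L, hL⟩ := hg
  refine ⟨fun n hn => add_nonneg (hf0 n hn) (hg0 n hn), K + L, fun n hn => ?_⟩
  have h1 := one_le_logb hn
  have h2 : Real.logb 2 n ^ K ≤ Real.logb 2 n ^ (K + L) := pow_le_pow_right₀ h1 (by omega)
  have h3 : Real.logb 2 n ^ L ≤ Real.logb 2 n ^ (K + L) := pow_le_pow_right₀ h1 (by omega)
  push_cast
  have h4 := mul_le_mul_of_nonneg_left h2 (Nat.cast_nonneg (α := ℝ) K)
  have h5 := mul_le_mul_of_nonneg_left h3 (Nat.cast_nonneg (α := ℝ) L)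
  linarith [hK n hn, hL n hn]

theorem mul {f g : ℕ → ℝ} (hf : PolyLog f) (hg : PolyLog g) : PolyLog fun n => f n * g n := by
  obtain ⟨hf0, K, hK⟩ := hf
  obtain ⟨hg0, L, hL⟩ := hg
  -- The same number serves as coefficient and as exponent, so it has to dominate both `K * L` and
  -- `K + L`.
  refine ⟨fun n hn => mul_nonneg (hf0 n hn) (hg0 n hn), K * L + (K + L), fun n hn => ?_⟩
  have h1 := one_le_logb hn
  calc f n * g n ≤ (K * Real.logb 2 n ^ K) * (L * Real.logb 2 n ^ L) :=
        mul_le_mul (hK n hn) (hL n hn) (hg0 n hn) (by positivity)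
    _ = (K * L : ℕ) * Real.logb 2 n ^ (K + L) := by push_cast; ring
    _ ≤ (K * L + (K + L) : ℕ) * Real.logb 2 n ^ (K * L + (K + L)) := by
        refine mul_le_mul ?_ (pow_le_pow_right₀ h1 (by omega)) (by positivity) (by positivity)
        exact_mod_cast Nat.le_add_right _ _

theorem const_mul {f : ℕ → ℝ} {a : ℝ} (ha : 0 ≤ a) (hf : PolyLog f) : PolyLog fun n => a * f n :=
  (const ha).mul hf

theorem ceil {f : ℕ → ℝ} (hf : PolyLog f) : PolyLog fun n => (⌈f n⌉₊ : ℝ) :=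
  (hf.add (const zero_le_one)).mono (fun _ _ => Nat.cast_nonneg _)
    fun n hn => (Nat.ceil_lt_add_one (hf.1 n hn)).le

end PolyLog

theorem log_le_logb {n : ℕ} (hn : 2 ≤ n) : Real.log n ≤ Real.logb 2 n := by
  have hn' : (2 : ℝ) ≤ n := by exact_mod_cast hn
  have h0 : 0 ≤ Real.log n := Real.log_nonneg (by linarith)
  have h1 : 0 < Real.log 2 := Real.log_pos (by norm_num)
  rw [Real.logb, le_div_iff₀ h1]
  nlinarith [Real.log_two_lt_d9]

theorem polyLog_log : PolyLog fun n => Real.log n :=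
  PolyLog.logb.mono (fun n hn => Real.log_nonneg (by
    have : (2 : ℝ) ≤ n := by exact_mod_cast hn
    linarith)) fun _ hn => log_le_logb hn

theorem polyLog_size : PolyLog fun n => (n.size : ℝ) := by
  refine (PolyLog.logb.add (PolyLog.const zero_le_one)).mono (fun _ _ => Nat.cast_nonneg _)
    fun n hn => ?_
  have h1 : 0 < n.size := Nat.size_pos.2 (by omega)
  have h2 : 2 ^ (n.size - 1) ≤ n := Nat.lt_size.1 (by omega)
  have hn' : (0 : ℝ) < n := by
    have : 0 < n := by omega
    exact_mod_cast this
  have h3 : ((n.size - 1 : ℕ) : ℝ) ≤ Real.logb 2 n := by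
    rw [Real.le_logb_iff_rpow_le (by norm_num) hn', Real.rpow_natCast]
    exact_mod_cast h2
  have h4 : ((n.size - 1 : ℕ) : ℝ) = n.size - 1 := by
    rw [Nat.cast_sub h1]; simp
  linarith

/-! ### The number of hash functions -/

theorem logb_inv_collisionBound_pos {D : ℝ} (hD : 0 < D) :
    0 < Real.logb 2 (1 / collisionBound D) := by
  refine Real.logb_pos (by norm_num) ?_
  rw [lt_div_iff₀ (collisionBound_pos hD), one_mul]
  exact collisionBound_lt_one hD

theorem numHash_le {D : ℝ} (hD : 0 < D) {n : ℕ} (hn : 2 ≤ n) :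
    (numHash n D : ℝ) ≤ Real.logb 2 n / Real.logb 2 (1 / collisionBound D) + 1 := by
  have h1 := one_le_logb hn
  have h2 := logb_inv_collisionBound_pos hD
  exact (Nat.ceil_lt_add_one (by positivity)).le

theorem polyLog_numHash {D : ℝ} (hD : 0 < D) : PolyLog fun n => (numHash n D : ℝ) := by
  have h2 := logb_inv_collisionBound_pos hD
  refine ((PolyLog.const_mul (inv_nonneg.2 h2.le) PolyLog.logb).add
    (PolyLog.const zero_le_one)).mono (fun _ _ => Nat.cast_nonneg _) fun n hn => ?_
  rw [inv_mul_eq_div]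
  exact numHash_le hD hn

theorem collisionBound_pow_numHash_le {D : ℝ} (hD : 0 < D) {n : ℕ} (hn : 2 ≤ n) :
    collisionBound D ^ numHash n D ≤ 1 / n := by
  have hn' : (0 : ℝ) < n := by
    have : 0 < n := by omega
    exact_mod_cast this
  have hg := collisionBound_pos hD
  have h1 := logb_inv_collisionBound_pos hD
  have h2 : Real.logb 2 n ≤ numHash n D * Real.logb 2 (1 / collisionBound D) := by
    rw [← div_le_iff₀ h1]
    exact Nat.le_ceil _
  have h3 : Real.logb 2 ((1 / collisionBound D) ^ numHash n D) =
      numHash n D * Real.logb 2 (1 / collisionBound D) := Real.logb_pow _ _ _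
  rw [← h3, Real.logb_le_logb (by norm_num) hn' (by positivity), one_div, inv_pow] at h2
  rw [one_div]
  exact (le_inv_comm₀ hn' (by positivity)).1 h2

theorem rho_nonneg {c D : ℝ} (hc : 0 < c) (hD : 0 < D) : 0 ≤ rho c D := by
  have h1 := logb_inv_collisionBound_pos hD
  have h2 := alpha_nonneg
  unfold rho
  positivity

/-- The expected cost of a hash vector. -/
def meanCost (c D : ℝ) (n : ℕ) : ℝ := numHash n D * (2 * alpha / (c * D))

theorem meanCost_nonneg {c D : ℝ} (hc : 0 < c) (hD : 0 < D) (n : ℕ) : 0 ≤ meanCost c D n := by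
  have h2 := alpha_nonneg
  unfold meanCost
  positivity

theorem polyLog_meanCost {c D : ℝ} (hc : 0 < c) (hD : 0 < D) : PolyLog (meanCost c D) := by
  have h2 := alpha_nonneg
  exact (polyLog_numHash hD).mul (PolyLog.const (by positivity))

/-- Without rounding, `numHash` functions have mean cost exactly `rho c D * logb 2 n`. Rounding up
adds at most one function, hence the constant factor `2 ^ (2 * alpha / (c * D))`. -/
theorem two_rpow_meanCost_le {c D : ℝ} (hc : 0 < c) (hD : 0 < D) {n : ℕ} (hn : 2 ≤ n) :
    (2 : ℝ) ^ (meanCost c D n + 1) ≤ 2 * (2 : ℝ) ^ (2 * alpha / (c * D)) * (n : ℝ) ^ rho c D := by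
  have hn' : (0 : ℝ) < n := by
    have : 0 < n := by omega
    exact_mod_cast this
  have h2 := alpha_nonneg
  have h1 := logb_inv_collisionBound_pos hD
  have h3 : meanCost c D n ≤ Real.logb 2 n * rho c D + 2 * alpha / (c * D) := by
    have := mul_le_mul_of_nonneg_right (numHash_le hD hn)
      (show 0 ≤ 2 * alpha / (c * D) by positivity)
    refine this.trans (le_of_eq ?_)
    unfold rho
    field_simp
  have h4 : (n : ℝ) ^ rho c D = (2 : ℝ) ^ (Real.logb 2 n * rho c D) := by
    rw [Real.rpow_mul (by norm_num), Real.rpow_logb (by norm_num) (by norm_num) hn']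
  rw [h4, mul_assoc, ← Real.rpow_add (by norm_num), Real.rpow_add (by norm_num), Real.rpow_one,
    mul_comm]
  have := Real.rpow_le_rpow_of_exponent_le (x := 2) (by norm_num) h3
  rw [add_comm] at this
  linarith

/-! ### The choice of the parameters -/

/-- The parameters of the algorithm. -/
def params (c D : ℝ) (n : ℕ) : Params :=
  let k : ℝ := numHash n D
  -- As threshold for the cost, one above the mean: Markov's inequality leaves probability at least
  -- `1 / M`, and 2^M is within a constant factor of 2^mean.
  let M := meanCost c D n + 1
  -- Makes the probability `k / (c * D * J)` of losing the near point by rounding its radius at most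
  -- `1 / (4 * M)`. The added 1 here, in `pad` and in `budget` ensures positivity.
  let J := ⌈4 * k * M / (c * D)⌉₊ + 1
  -- With δ = 1/(4M) a good table is hit with probability at least δ 2^(-M) per sample, so `6 * M`
  -- hits are expected.
  let S := ⌈24 * M ^ 2 * (2 : ℝ) ^ M⌉₊
  { pad := ⌈8 * Real.log n * ((k * ((1 - collisionBound D) / collisionBound D)) ^ 2 + 1)⌉₊ + 1
    -- A table succeeds with probability at least η = 1/(6M), and (1 - η)^(log n / η) ≤ 1/n.
    tables := ⌈6 * M * Real.log n⌉₊
    radii := J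
    samples := S
    -- At most `5 * J * S` far collisions are expected; dividing by η = 1/(6M) gives the factor `30
    -- * M`.
    budget := ⌈30 * M * (J * S : ℕ)⌉₊ + 1 }

end EntropyNN

end

noncomputable section

namespace EntropyNN

theorem polyLog_meanCost_add_one {c D : ℝ} (hc : 0 < c) (hD : 0 < D) :
    PolyLog fun n => meanCost c D n + 1 :=
  (polyLog_meanCost hc hD).add (PolyLog.const zero_le_one)

theorem polyLog_pad {c D : ℝ} (hD : 0 < D) : PolyLog fun n => ((params c D n).pad : ℝ) := by
  have h1 : 0 ≤ (1 - collisionBound D) / collisionBound D :=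
    div_nonneg (sub_nonneg.2 (collisionBound_lt_one hD).le) (collisionBound_pos hD).le
  have h2 : PolyLog fun n => 8 * Real.log n *
      ((numHash n D * ((1 - collisionBound D) / collisionBound D)) ^ 2 + 1) := by
    simp only [sq]
    have h3 := (polyLog_numHash hD).mul (PolyLog.const h1)
    exact (PolyLog.const_mul (by norm_num) polyLog_log).mul
      ((h3.mul h3).add (PolyLog.const zero_le_one))
  simp only [params, Nat.cast_add, Nat.cast_one]
  exact h2.ceil.add (PolyLog.const zero_le_one)

theorem polyLog_tables {c D : ℝ} (hc : 0 < c) (hD : 0 < D) :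
    PolyLog fun n => ((params c D n).tables : ℝ) :=
  ((PolyLog.const_mul (by norm_num) (polyLog_meanCost_add_one hc hD)).mul polyLog_log).ceil

theorem polyLog_radii {c D : ℝ} (hc : 0 < c) (hD : 0 < D) :
    PolyLog fun n => ((params c D n).radii : ℝ) := by
  simp only [params, Nat.cast_add, Nat.cast_one, div_eq_mul_inv]
  refine PolyLog.add (PolyLog.ceil ?_) (PolyLog.const zero_le_one)
  exact ((PolyLog.const_mul (by norm_num) (polyLog_numHash hD)).mul
    (polyLog_meanCost_add_one hc hD)).mul (PolyLog.const (by positivity))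

theorem one_le_rpow_rho {c D : ℝ} (hc : 0 < c) (hD : 0 < D) {n : ℕ} (hn : 2 ≤ n) :
    1 ≤ (n : ℝ) ^ rho c D := by
  refine Real.one_le_rpow ?_ (rho_nonneg hc hD)
  have : 1 ≤ n := by omega
  exact_mod_cast this

theorem exists_samples_le {c D : ℝ} (hc : 0 < c) (hD : 0 < D) :
    ∃ s : ℕ → ℝ, PolyLog s ∧ ∀ n, 2 ≤ n → ((params c D n).samples : ℝ) ≤ s n * (n : ℝ) ^ rho c D := by
  have hM := polyLog_meanCost_add_one hc hD
  set C : ℝ := 2 * (2 : ℝ) ^ (2 * alpha / (c * D)) with hC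
  have hC0 : 0 ≤ C := by positivity
  refine ⟨fun n => 24 * ((meanCost c D n + 1) * (meanCost c D n + 1)) * C + 1,
    ((PolyLog.const_mul (by norm_num) (hM.mul hM)).mul (PolyLog.const hC0)).add
      (PolyLog.const zero_le_one), fun n hn => ?_⟩
  have h1 := one_le_rpow_rho hc hD hn
  have h2 := two_rpow_meanCost_le hc hD hn
  have h0 := meanCost_nonneg hc hD n
  have h3 : 0 ≤ 24 * (meanCost c D n + 1) ^ 2 * (2 : ℝ) ^ (meanCost c D n + 1) := by positivity
  refine (Nat.ceil_lt_add_one h3).le.trans ?_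
  have h4 : 24 * (meanCost c D n + 1) ^ 2 * (2 : ℝ) ^ (meanCost c D n + 1) ≤
      24 * (meanCost c D n + 1) ^ 2 * (C * (n : ℝ) ^ rho c D) := by gcongr
  nlinarith

theorem exists_budget_le {c D : ℝ} (hc : 0 < c) (hD : 0 < D) :
    ∃ b : ℕ → ℝ, PolyLog b ∧ ∀ n, 2 ≤ n → ((params c D n).budget : ℝ) ≤ b n * (n : ℝ) ^ rho c D := by
  obtain ⟨s, hs, hsle⟩ := exists_samples_le hc hD
  have hM := polyLog_meanCost_add_one hc hD
  have hJ := polyLog_radii hc hD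
  refine ⟨fun n => 30 * (meanCost c D n + 1) * ((params c D n).radii * s n) + 2,
    ((PolyLog.const_mul (by norm_num) hM).mul (hJ.mul hs)).add (PolyLog.const zero_le_two),
    fun n hn => ?_⟩
  have h1 := one_le_rpow_rho hc hD hn
  have h0 := meanCost_nonneg hc hD n
  have hb : ((params c D n).budget : ℝ) = (⌈30 * (meanCost c D n + 1) *
      ((params c D n).radii * (params c D n).samples : ℕ)⌉₊ : ℝ) + 1 := by
    simp [params]
  rw [hb]
  have h3 : 0 ≤ 30 * (meanCost c D n + 1) *
      (((params c D n).radii * (params c D n).samples : ℕ) : ℝ) := by positivity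
  have h4 := (Nat.ceil_lt_add_one h3).le
  have h5 : 30 * (meanCost c D n + 1) * (((params c D n).radii * (params c D n).samples : ℕ) : ℝ) ≤
      30 * (meanCost c D n + 1) * ((params c D n).radii * (s n * (n : ℝ) ^ rho c D)) := by
    push_cast
    have := hsle n hn
    gcongr
  nlinarith

/-! ### The size of the data structure and the search time -/

theorem size_build {n d k : ℕ} {prm : Params} (w D : ℝ) (P : Fin n → EuclideanSpace ℝ (Fin d))
    (ω : BuildSeed d k prm) : (build w D P ω).size =
      n * d + prm.tables * (k * (d + prm.pad + 1) + n * k + n) := by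
  simp [DataStructure.size, Table.size]

/-- The data structure has almost linear size. -/
theorem exists_size_le {c D : ℝ} (hc : 0 < c) (hD : 0 < D) :
    ∃ K : ℕ, ∀ n, 2 ≤ n → ∀ d, 0 < d → ∀ (w : ℝ) (P : Fin n → EuclideanSpace ℝ (Fin d))
      (ω : BuildSeed d (numHash n D) (params c D n)),
      ((build w D P ω).size : ℝ) ≤ K * Real.logb 2 n ^ K * (d * n) := by
  have hk := polyLog_numHash hD
  have hm := polyLog_pad (c := c) hD
  have hT := polyLog_tables hc hD
  have h1 := PolyLog.const zero_le_one
  obtain ⟨_, K, hK⟩ := h1.add (hT.mul (((hk.mul ((h1.add hm).add h1)).add hk).add h1))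
  refine ⟨K, fun n hn d hd w P ω => ?_⟩
  have hd' : (1 : ℝ) ≤ d := by exact_mod_cast hd
  have hn' : (1 : ℝ) ≤ n := by
    have : 1 ≤ n := by omega
    exact_mod_cast this
  refine le_trans ?_ (mul_le_mul_of_nonneg_right (hK n hn) (by positivity))
  rw [size_build]
  push_cast
  set k : ℝ := (numHash n D : ℝ)
  set m : ℝ := ((params c D n).pad : ℝ)
  set T : ℝ := ((params c D n).tables : ℝ)
  have hk0 : 0 ≤ k := hk.1 n hn
  have hm0 : 0 ≤ m := hm.1 n hn
  have hT0 : 0 ≤ T := hT.1 n hn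
  have hdn : (1 : ℝ) ≤ d * n := by nlinarith
  have e1 : k * (d + m + 1) ≤ k * (1 + m + 1) * (d * n) := by
    have h : (d : ℝ) + m + 1 ≤ (1 + m + 1) * d := by nlinarith
    calc k * (d + m + 1) ≤ k * ((1 + m + 1) * d) := by gcongr
      _ ≤ k * ((1 + m + 1) * d) * n := le_mul_of_one_le_right (by positivity) hn'
      _ = _ := by ring
  have e2 : n * k ≤ k * (d * n) := by
    calc (n : ℝ) * k = k * (1 * n) := by ring
      _ ≤ k * (d * n) := by gcongr
  have e3 : (n : ℝ) ≤ 1 * (d * n) := by nlinarith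
  calc n * d + T * (k * (d + m + 1) + n * k + n)
      ≤ n * d + T * (k * (1 + m + 1) * (d * n) + k * (d * n) + 1 * (d * n)) := by gcongr
    _ = _ := by ring

/-- The search time. -/
theorem exists_steps_le {c D : ℝ} (hc : 0 < c) (hD : 0 < D) :
    ∃ K : ℕ, ∀ n, 2 ≤ n → ∀ d, 0 < d → ∀ (r : ℝ)
      (S : DataStructure n d (numHash n D) (params c D n)) (q : EuclideanSpace ℝ (Fin d))
      (ω : SearchSeed d (params c D n)),
      ((search c D r S q ω).steps : ℝ) ≤ K * Real.logb 2 n ^ K * (d * (n : ℝ) ^ rho c D) := by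
  have hk := polyLog_numHash hD
  have hm := polyLog_pad (c := c) hD
  have hT := polyLog_tables hc hD
  have hJ := polyLog_radii hc hD
  obtain ⟨s, hs, hsle⟩ := exists_samples_le hc hD
  obtain ⟨b, hb, hble⟩ := exists_budget_le hc hD
  have hz := polyLog_size
  have hcst : ∀ a : ℕ, PolyLog fun _ => (a : ℝ) := fun a => PolyLog.const (Nat.cast_nonneg a)
  have hA := ((((((hcst 13).mul ((hcst 1).add hm)).add
    (hk.mul (((hcst 5).mul ((hcst 1).add hm)).add (hcst 7)))).add
    (hz.mul (((hcst 4).mul hk).add (hcst 6)))).add (hcst 7)).add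
    (((hcst 3).mul hk).add (hcst 13)))
  have hB := ((hcst 3).mul hk).add (hcst 13)
  obtain ⟨_, K, hK⟩ := ((hcst 8).add ((hcst 3).mul hm)).add
    ((hT.mul (((hJ.mul hs).mul hA).add ((hb.mul hB).add (hcst 2)))).add (hcst 1))
  refine ⟨K, fun n hn d hd r S q ω => ?_⟩
  have hd' : (1 : ℝ) ≤ d := by exact_mod_cast hd
  have hF := one_le_rpow_rho hc hD hn
  set F : ℝ := (n : ℝ) ^ rho c D
  refine le_trans ?_ (mul_le_mul_of_nonneg_right (hK n hn) (by positivity))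
  refine (Nat.cast_le.2 (steps_search c D r S q ω)).trans ?_
  have hS := hsle n hn
  have hbud := hble n hn
  have hk0 := hk.1 n hn
  have hm0 := hm.1 n hn
  have hT0 := hT.1 n hn
  have hJ0 := hJ.1 n hn
  have hs0 := hs.1 n hn
  have hb0 := hb.1 n hn
  have hz0 := hz.1 n hn
  push_cast
  set k : ℝ := (numHash n D : ℝ)
  set m : ℝ := ((params c D n).pad : ℝ)
  set T : ℝ := ((params c D n).tables : ℝ)
  set J : ℝ := ((params c D n).radii : ℝ)
  set z : ℝ := (n.size : ℝ)
  set A : ℝ := 13 * (1 + m) + k * (5 * (1 + m) + 7) + z * (4 * k + 6) + 7 + (3 * k + 13) with hAdef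
  set B : ℝ := 3 * k + 13 with hBdef
  have hA0 : 0 ≤ A := by positivity
  have hB0 : 0 ≤ B := by positivity
  -- Since `1 ≤ d`, the padding and all additive terms can be absorbed into a factor `d` times a
  -- polylogarithm.
  have hdm : (d : ℝ) + m ≤ d * (1 + m) := by nlinarith
  have eB : 3 * k + 6 * d + 7 ≤ d * B := by rw [hBdef]; nlinarith
  have eA : 13 * ((d : ℝ) + m) + k * (5 * (d + m) + 7) + z * (4 * k + 6) + 7 +
      (3 * k + 6 * d + 7) ≤ d * A := by
    have h1 : 5 * ((d : ℝ) + m) + 7 ≤ d * (5 * (1 + m) + 7) := by linarith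
    have h2 : k * (5 * ((d : ℝ) + m) + 7) ≤ d * (k * (5 * (1 + m) + 7)) := by
      calc k * (5 * ((d : ℝ) + m) + 7) ≤ k * (d * (5 * (1 + m) + 7)) := by gcongr
        _ = _ := by ring
    have h3 : z * (4 * k + 6) ≤ d * (z * (4 * k + 6)) := le_mul_of_one_le_left (by positivity) hd'
    calc _ ≤ 13 * (d * (1 + m)) + d * (k * (5 * (1 + m) + 7)) + d * (z * (4 * k + 6)) + d * 7 +
          d * B := by
          have h4 : (7 : ℝ) ≤ d * 7 := by linarith
          gcongr
      _ = d * A := by rw [hAdef, hBdef]; ring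
  have hdF : (1 : ℝ) ≤ d * F := by nlinarith
  have e1 : J * ((params c D n).samples : ℝ) * (13 * ((d : ℝ) + m) + k * (5 * (d + m) + 7) +
      z * (4 * k + 6) + 7 + (3 * k + 6 * d + 7)) ≤ J * s n * A * (d * F) := by
    calc _ ≤ J * (s n * F) * (d * A) := by gcongr
      _ = _ := by ring
  have e2 : ((params c D n).budget : ℝ) * (3 * k + 6 * d + 7) ≤ b n * B * (d * F) := by
    calc _ ≤ b n * F * (d * B) := by gcongr
      _ = _ := by ring
  have e3 : (d : ℝ) ≤ d * F := le_mul_of_one_le_right (by positivity) hF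
  have e4 : m ≤ m * (d * F) := le_mul_of_one_le_right hm0 hdF
  calc _ ≤ (d * F) * 3 + (d * F + m * (d * F)) * 3 + 2 * (d * F) +
        (T * (J * s n * A * (d * F) + b n * B * (d * F) + 2 * (d * F)) + 1 * (d * F)) := by
        have h2 : (2 : ℝ) ≤ 2 * (d * F) := by linarith
        have h1 : (1 : ℝ) ≤ 1 * (d * F) := by linarith
        gcongr
    _ = _ := by ring

/-! ### The success probability -/

/-- The search fails with probability at most `1 / n`. -/
theorem measure_search_params_none_le {c D : ℝ} (hc : 1 ≤ c) (hD : 0 < D) {n d : ℕ} (hn : 2 ≤ n)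
    (hd : 0 < d) {r : ℝ} (hr : 0 < r) (P : Fin n → EuclideanSpace ℝ (Fin d))
    (q : EuclideanSpace ℝ (Fin d)) (hq : ∃ i, dist (P i) q ≤ r) :
    ((buildLaw d (numHash n D) (params c D n) D).prod (searchLaw d (params c D n)))
      {ω | (search c D r (build (c * r) D P ω.1) q ω.2).val = none} ≤ ENNReal.ofReal (1 / n) := by
  have hc0 : 0 < c := by linarith
  have hn' : (1 : ℝ) ≤ n := by
    have : 1 ≤ n := by omega
    exact_mod_cast this
  have hmc := meanCost_nonneg hc0 hD n
  set M := meanCost c D n + 1 with hM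
  have hM1 : 1 ≤ M := by linarith
  have hM0 : 0 < M := by linarith
  have hcD : 0 < c * D := by positivity
  set η := 1 / (6 * M) with hη
  have hη0 : 0 < η := by positivity
  have hη1 : η ≤ 1 := by
    rw [hη, div_le_one (by positivity)]; linarith
  have hJ : 4 * numHash n D * M / (c * D) ≤ ((params c D n).radii : ℝ) := by
    refine (Nat.le_ceil _).trans ?_
    simp only [params, Nat.cast_add, Nat.cast_one]
    linarith
  have hJpos : 0 < (params c D n).radii := Nat.succ_pos _
  have hJ0 : (0 : ℝ) < ((params c D n).radii : ℝ) := by exact_mod_cast hJpos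
  have hS : 24 * M ^ 2 * (2 : ℝ) ^ M ≤ ((params c D n).samples : ℝ) := Nat.le_ceil _
  have hpad : 8 * Real.log n * ((numHash n D * ((1 - collisionBound D) / collisionBound D)) ^ 2 + 1)
      ≤ ((params c D n).pad : ℝ) := by
    refine (Nat.le_ceil _).trans ?_
    simp only [params, Nat.cast_add, Nat.cast_one]
    linarith
  have hbud : 30 * M * ((params c D n).radii * (params c D n).samples : ℕ) ≤
      ((params c D n).budget : ℝ) := by
    refine (Nat.le_ceil _).trans ?_
    simp only [params, Nat.cast_add, Nat.cast_one, hM]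
    linarith
  have hT : 6 * M * Real.log n ≤ ((params c D n).tables : ℝ) := Nat.le_ceil _
  -- From the `1 / M` left by Markov's inequality, the light cells (δ = 1/(4M)) and the rounding of
  -- the radius each take `1 / (4 * M)`; what remains, `1 / (2 * M)`, is 3η.
  have h1 : 1 / (4 * M) + numHash n D * (2 * alpha / (c * D)) / M +
      numHash n D * (1 / (c * D * (params c D n).radii)) ≤ 1 - 3 * η := by
    have e1 : (numHash n D : ℝ) * (2 * alpha / (c * D)) / M = 1 - 1 / M := by
      have : (numHash n D : ℝ) * (2 * alpha / (c * D)) = M - 1 := by rw [hM, meanCost]; ring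
      rw [this]; field_simp
    have e2 : (numHash n D : ℝ) * (1 / (c * D * (params c D n).radii)) ≤ 1 / (4 * M) := by
      rw [div_le_iff₀ hcD] at hJ
      rw [mul_one_div, div_le_div_iff₀ (by positivity) (by positivity)]
      linarith
    have e3 : 3 * η = 1 / M - 1 / (4 * M) - 1 / (4 * M) := by rw [hη]; field_simp; ring
    rw [e1, e3]
    linarith
  have h2 : Real.exp (-(1 / (4 * M) * (2 : ℝ) ^ (-M) * (params c D n).samples)) ≤ η := by
    -- An exponent of `6 * M` suffices because exp(-x) ≤ 1/x.
    have e1 : 6 * M ≤ 1 / (4 * M) * (2 : ℝ) ^ (-M) * (params c D n).samples := by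
      calc 6 * M = 1 / (4 * M) * (2 : ℝ) ^ (-M) * (24 * M ^ 2 * (2 : ℝ) ^ M) := by
            rw [Real.rpow_neg (by norm_num)]
            field_simp
            norm_num
        _ ≤ _ := by gcongr
    rw [Real.exp_neg, hη, ← one_div]
    refine one_div_le_one_div_of_le (by positivity) (e1.trans ?_)
    have := Real.add_one_le_exp (1 / (4 * M) * (2 : ℝ) ^ (-M) * (params c D n).samples)
    linarith
  have hb : 5 * ((params c D n).radii * (params c D n).samples : ℕ) ≤
      η * ((params c D n).budget : ℝ) := by
    calc (5 : ℝ) * ((params c D n).radii * (params c D n).samples : ℕ) =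
          η * (30 * M * ((params c D n).radii * (params c D n).samples : ℕ)) := by
          rw [hη]; field_simp; ring
      _ ≤ _ := by gcongr
  have hδ1 : 1 / (4 * M) ≤ 1 := by
    rw [div_le_one (by positivity)]; linarith
  have htab := measure_tableFail_le hd (by omega) hc hD hr hM0
    (show 0 < 1 / (4 * M) by positivity) hδ1 hJpos hη0 (collisionBound_pow_numHash_le hD hn) hpad
    (Nat.succ_pos _) h1 h2 (Nat.succ_pos _) hb P q hq
  refine (measure_search_none_le hD (by positivity) (by linarith) P q htab).trans
    (ENNReal.ofReal_le_ofReal ?_)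
  have h3 : 1 - η ≤ Real.exp (-η) := by linarith [Real.add_one_le_exp (-η)]
  calc (1 - η) ^ (params c D n).tables ≤ Real.exp (-η) ^ (params c D n).tables := by
        have : 0 ≤ 1 - η := by linarith
        gcongr
    _ = Real.exp (-(η * (params c D n).tables)) := by
        rw [← Real.exp_nat_mul]; congr 1; ring
    _ ≤ Real.exp (-Real.log n) := by
        refine Real.exp_le_exp.2 (neg_le_neg ?_)
        calc Real.log n = η * (6 * M * Real.log n) := by rw [hη]; field_simp
          _ ≤ _ := by gcongr
    _ = 1 / n := by
        rw [Real.exp_neg, Real.exp_log (by linarith), one_div]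

end EntropyNN

end

/-! ### A logarithm-free integral for α and its tail. -/

noncomputable section

namespace EntropyNN

/-! ### The entropy integral -/

theorem hasDerivAt_phi (x : ℝ) : HasDerivAt phi (-x * phi x) x := by
  have h1 : HasDerivAt (fun x : ℝ => -x ^ 2 / 2) (-x) x := by
    refine (((hasDerivAt_id x).pow 2).neg.div_const 2).congr_deriv ?_
    simp
    ring
  have h2 := h1.exp.const_mul ((√(2 * Real.pi))⁻¹)
  rw [← funext phi_eq] at h2
  refine h2.congr_deriv ?_
  rw [phi_eq]
  ring

theorem phi_le (x : ℝ) : phi x ≤ Real.exp (-x ^ 2 / 2) := by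
  rw [phi_eq]
  refine mul_le_of_le_one_left (Real.exp_nonneg _) (inv_le_one_of_one_le₀ ?_)
  rw [Real.one_le_sqrt]
  linarith [Real.pi_gt_three]

theorem tendsto_mul_exp_neg_sq {a : ℝ} (ha : 0 < a) :
    Filter.Tendsto (fun x : ℝ => x * Real.exp (-a * x ^ 2)) Filter.atTop (nhds 0) := by
  have h := tendsto_rpow_abs_mul_exp_neg_mul_sq_cocompact ha 1
  have h2 := h.mono_left atTop_le_cocompact
  refine h2.congr' ?_
  filter_upwards [Filter.eventually_ge_atTop 0] with x hx
  rw [Real.rpow_one, abs_of_nonneg hx]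

theorem tendsto_mul_phi : Filter.Tendsto (fun x => x * phi x) Filter.atTop (nhds 0) := by
  refine tendsto_of_tendsto_of_tendsto_of_le_of_le' tendsto_const_nhds
    (tendsto_mul_exp_neg_sq (a := 1 / 2) (by norm_num)) ?_ ?_
  · filter_upwards [Filter.eventually_ge_atTop 0] with x hx
    exact mul_nonneg hx (phi_pos x).le
  · filter_upwards [Filter.eventually_ge_atTop 0] with x hx
    have := phi_le x
    rw [show -x ^ 2 / 2 = -(1 / 2) * x ^ 2 by ring] at this
    gcongr

theorem tendsto_mul_Phi : Filter.Tendsto (fun x => x * Phi x) Filter.atTop (nhds 0) := by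
  refine tendsto_of_tendsto_of_tendsto_of_le_of_le' tendsto_const_nhds
    (tendsto_mul_exp_neg_sq (a := 1 / 2) (by norm_num)) ?_ ?_
  · filter_upwards [Filter.eventually_ge_atTop 0] with x hx
    exact mul_nonneg hx (Phi_pos x).le
  · filter_upwards [Filter.eventually_ge_atTop 0] with x hx
    have := Phi_le_exp hx
    rw [show -x ^ 2 / 2 = -(1 / 2) * x ^ 2 by ring] at this
    have h2 := Real.exp_nonneg (-(1 / 2) * x ^ 2)
    gcongr
    linarith

theorem tendsto_of_tendsto_mul {f : ℝ → ℝ} (hf : ∀ x, 0 ≤ f x)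
    (h : Filter.Tendsto (fun x => x * f x) Filter.atTop (nhds 0)) :
    Filter.Tendsto f Filter.atTop (nhds 0) := by
  refine tendsto_of_tendsto_of_tendsto_of_le_of_le' tendsto_const_nhds h
    (Filter.Eventually.of_forall hf) ?_
  filter_upwards [Filter.eventually_ge_atTop 1] with x hx
  exact le_mul_of_one_le_left (hf x) hx

theorem tendsto_phi : Filter.Tendsto phi Filter.atTop (nhds 0) :=
  tendsto_of_tendsto_mul (fun x => (phi_pos x).le) tendsto_mul_phi

theorem tendsto_Phi : Filter.Tendsto Phi Filter.atTop (nhds 0) :=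
  tendsto_of_tendsto_mul Phi_nonneg tendsto_mul_Phi

/-- The upper bound for the ratio of Mills. -/
theorem mul_Phi_le_phi (x : ℝ) : x * Phi x ≤ phi x := by
  -- The difference has derivative `-Phi x` and tends to 0 at infinity, so it is nonnegative
  -- everywhere. The lower Mills bound follows the same pattern.
  have h1 : Antitone fun x => phi x - x * Phi x := by
    refine antitone_of_hasDerivAt_nonpos (f' := fun x => -Phi x) (fun x => ?_) fun x => ?_
    · refine ((hasDerivAt_phi x).sub ((hasDerivAt_id x).mul (hasDerivAt_Phi x))).congr_deriv ?_
      simp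
    · simpa using Phi_nonneg x
  have h2 := tendsto_phi.sub tendsto_mul_Phi
  rw [sub_zero] at h2
  linarith [h1.le_of_tendsto h2 x]

/-- The lower bound for the ratio of Mills. -/
theorem mul_phi_le_Phi (x : ℝ) : x * phi x ≤ (x ^ 2 + 1) * Phi x := by
  have h1 : Antitone fun x => Phi x - x * phi x / (x ^ 2 + 1) := by
    refine antitone_of_hasDerivAt_nonpos
      (f' := fun x => -(2 * phi x / (x ^ 2 + 1) ^ 2)) (fun x => ?_) fun x => ?_
    · have h0 : x ^ 2 + 1 ≠ 0 := by positivity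
      have h3 : HasDerivAt (fun x : ℝ => x ^ 2 + 1) (2 * x) x := by
        refine (((hasDerivAt_id x).pow 2).add_const 1).congr_deriv ?_
        simp
      refine ((hasDerivAt_Phi x).sub
        ((((hasDerivAt_id x).mul (hasDerivAt_phi x))).div h3 h0)).congr_deriv ?_
      simp only [id, Pi.mul_apply]
      field_simp
      ring
    · have := phi_pos x
      simp only [Pi.zero_apply, Left.neg_nonpos_iff]
      positivity
  have h2 : Filter.Tendsto (fun x => x * phi x / (x ^ 2 + 1)) Filter.atTop (nhds 0) := by
    refine tendsto_of_tendsto_of_tendsto_of_le_of_le' tendsto_const_nhds tendsto_mul_phi ?_ ?_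
    · filter_upwards [Filter.eventually_ge_atTop 0] with x hx
      have := phi_pos x
      positivity
    · filter_upwards [Filter.eventually_ge_atTop 0] with x hx
      have := phi_pos x
      exact div_le_self (by positivity) (by nlinarith)
  have h3 := h1.le_of_tendsto (by simpa using tendsto_Phi.sub h2) x
  rw [sub_nonneg, div_le_iff₀ (by positivity)] at h3
  linarith

/-- The function whose integral is `alpha * log 2`. -/
def psi (x : ℝ) : ℝ := phi x ^ 2 / (Phi x * (1 - Phi x))

theorem Phi_mul_pos (x : ℝ) : 0 < Phi x * (1 - Phi x) :=
  mul_pos (Phi_pos x) (sub_pos.2 (Phi_lt_one x))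

theorem continuous_psi : Continuous psi :=
  (continuous_phi.pow 2).div₀ (continuous_Phi.mul (continuous_const.sub continuous_Phi))
    fun x => (Phi_mul_pos x).ne'

theorem sideEntropy_mul_log (x : ℝ) : sideEntropy x * Real.log 2 =
    -(Phi x * Real.log (Phi x)) - (1 - Phi x) * Real.log (1 - Phi x) := by
  have : Real.log 2 ≠ 0 := by positivity
  rw [sideEntropy, entropy_two, Real.logb, Real.logb]
  field_simp
  ring

/-- A primitive of the difference of `sideEntropy * log 2` and `psi`. -/
def primitiveDiff (x : ℝ) : ℝ :=
  x * (sideEntropy x * Real.log 2) + phi x * (Real.log (Phi x) - Real.log (1 - Phi x))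

/-- The derivative of the entropy in nats is φ (log Φ - log(1 - Φ)), and φ' = -xφ. The terms with a
factor x cancel, and differentiating the logarithms leaves `-psi`. -/
theorem hasDerivAt_primitiveDiff (x : ℝ) :
    HasDerivAt primitiveDiff (sideEntropy x * Real.log 2 - psi x) x := by
  have h0 := (Phi_pos x).ne'
  have h1 := (sub_pos.2 (Phi_lt_one x)).ne'
  have d0 := hasDerivAt_Phi x
  have d1 := d0.const_sub 1
  have l0 := d0.log h0
  have l1 := d1.log h1
  have e := (d0.mul l0).neg.sub (d1.mul l1)
  have e' : HasDerivAt (fun x => sideEntropy x * Real.log 2)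
      (phi x * (Real.log (Phi x) - Real.log (1 - Phi x))) x := by
    rw [funext sideEntropy_mul_log]
    refine e.congr_deriv ?_
    field_simp
    ring
  refine (((hasDerivAt_id x).mul e').add ((hasDerivAt_phi x).mul (l0.sub l1))).congr_deriv ?_
  simp only [id, psi, Pi.sub_apply]
  field_simp
  ring

theorem primitiveDiff_zero : primitiveDiff 0 = 0 := by
  rw [primitiveDiff, Phi_zero]
  norm_num

/-- For `1 ≤ x` Mills' lower bound gives φ ≤ 2xΦ, so both logarithmic terms are dominated by `x`
times the entropy. Hence `primitiveDiff` vanishes at infinity. -/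
theorem abs_primitiveDiff_le {x : ℝ} (hx : 1 ≤ x) :
    |primitiveDiff x| ≤ 5 * (x * (sideEntropy x * Real.log 2)) := by
  have h0 := Phi_pos x
  have h1 := Phi_lt_one x
  have hh : Phi x ≤ 1 / 2 := by
    rw [← Phi_zero]
    exact strictAnti_Phi.antitone (by linarith)
  have hl0 := Real.log_neg h0 h1
  have hl1 := Real.log_neg (show 0 < 1 - Phi x by linarith) (by linarith)
  have hp := phi_pos x
  have hS := sideEntropy_mul_log x
  set S := sideEntropy x * Real.log 2
  have hm := mul_phi_le_Phi x
  have hp1 : phi x ≤ 1 := (phi_le x).trans (Real.exp_le_one_iff.2 (by nlinarith))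
  have hp2 : phi x ≤ 2 * x * Phi x := by
    have : x * phi x ≤ x * (2 * x * Phi x) := by
      calc _ ≤ _ := hm
        _ ≤ (x ^ 2 + x ^ 2) * Phi x := by gcongr; nlinarith
        _ = _ := by ring
    exact le_of_mul_le_mul_left this (by linarith)
  have a1 : Phi x * -Real.log (Phi x) ≤ S := by nlinarith
  have a2 : (1 - Phi x) * -Real.log (1 - Phi x) ≤ S := by nlinarith
  have hS0 : 0 ≤ S := by nlinarith
  have b1 : phi x * -Real.log (Phi x) ≤ 2 * (x * S) := by
    calc _ ≤ 2 * x * Phi x * -Real.log (Phi x) := by gcongr; linarith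
      _ = 2 * (x * (Phi x * -Real.log (Phi x))) := by ring
      _ ≤ _ := by gcongr
  have b2 : phi x * -Real.log (1 - Phi x) ≤ 2 * (x * S) := by
    calc _ ≤ 1 * -Real.log (1 - Phi x) := by gcongr; linarith
      _ ≤ 2 * S := by nlinarith
      _ ≤ _ := by nlinarith
  have hxS : 0 ≤ x * S := by positivity
  have c1 : 0 ≤ phi x * -Real.log (Phi x) := mul_nonneg hp.le (by linarith)
  have c2 : 0 ≤ phi x * -Real.log (1 - Phi x) := mul_nonneg hp.le (by linarith)
  rw [primitiveDiff, abs_le]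
  constructor <;> linarith

theorem tendsto_primitiveDiff :
    Filter.Tendsto primitiveDiff Filter.atTop (nhds 0) := by
  obtain ⟨C, hC⟩ : ∃ C : ℝ, ∀ x, sideEntropy x ≤ C * √(Phi x) :=
    ⟨_, fun x => entropy_two_le (Phi_pos x) (Phi_lt_one x)⟩
  have hl : 0 < Real.log 2 := by positivity
  have h := (tendsto_mul_exp_neg_sq (a := 1 / 4) (by norm_num)).const_mul (5 * C * Real.log 2)
  rw [mul_zero] at h
  refine squeeze_zero_norm' ?_ h
  filter_upwards [Filter.eventually_ge_atTop 1] with x hx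
  have hC0 : 0 ≤ C := by
    have := (sideEntropy_nonneg x).trans (hC x)
    have h2 := Real.sqrt_pos.2 (Phi_pos x)
    nlinarith
  calc _ ≤ 5 * (x * (sideEntropy x * Real.log 2)) := abs_primitiveDiff_le hx
    _ ≤ 5 * (x * (C * Real.exp (-(1 / 4) * x ^ 2) * Real.log 2)) := by
        have := (hC x).trans (mul_le_mul_of_nonneg_left (sqrt_Phi_le (by linarith)) hC0)
        gcongr
    _ = _ := by ring

theorem integral_sideEntropy_eq (X : ℝ) : ∫ x in (0 : ℝ)..X, sideEntropy x * Real.log 2 =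
    primitiveDiff X + ∫ x in (0 : ℝ)..X, psi x := by
  have h1 := (continuous_sideEntropy.mul_const (Real.log 2)).intervalIntegrable 0 X (μ := volume)
  have h2 := continuous_psi.intervalIntegrable 0 X (μ := volume)
  have h := intervalIntegral.integral_eq_sub_of_hasDerivAt
    (fun x _ => hasDerivAt_primitiveDiff x) (h1.sub h2)
  rw [intervalIntegral.integral_sub h1 h2, primitiveDiff_zero] at h
  linarith

/-- `primitiveDiff` vanishes at both ends. Only this limit of integrals over finite intervals is
needed later, not the integrability of `psi`. -/
theorem tendsto_integral_psi : Filter.Tendsto (fun X => ∫ x in (0 : ℝ)..X, psi x) Filter.atTop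
    (nhds (alpha * Real.log 2)) := by
  have h1 := intervalIntegral_tendsto_integral_Ioi 0
    (integrableOn_sideEntropy.mul_const (Real.log 2)) Filter.tendsto_id
  rw [integral_mul_const, ← alpha_eq] at h1
  have h2 := h1.sub tendsto_primitiveDiff
  rw [sub_zero] at h2
  refine h2.congr fun X => ?_
  rw [id, integral_sideEntropy_eq]
  ring

/-- Together with `psi_le` it squeezes the tail of `psi` between multiples of xφ, whose primitive -φ
is explicit. Both bounds are Mills' inequalities. -/
theorem mul_phi_le_psi {x : ℝ} (hx : 0 ≤ x) : x * phi x ≤ psi x := by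
  rw [psi, le_div_iff₀ (Phi_mul_pos x)]
  have h1 := mul_Phi_le_phi x
  have h2 := phi_pos x
  have h3 := Phi_pos x
  calc x * phi x * (Phi x * (1 - Phi x)) ≤ x * phi x * (Phi x * 1) := by
        gcongr; linarith
    _ = phi x * (x * Phi x) := by ring
    _ ≤ phi x * phi x := by gcongr
    _ = _ := by ring

theorem psi_le {X x : ℝ} (hX : 0 < X) (hx : X ≤ x) :
    psi x ≤ (1 + 1 / X ^ 2) / (1 - Phi X) * (x * phi x) := by
  have hx0 : 0 < x := hX.trans_le hx
  have h2 := phi_pos x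
  have h3 := Phi_pos x
  have h4 : 0 < 1 - Phi X := sub_pos.2 (Phi_lt_one X)
  have h5 : Phi x ≤ Phi X := strictAnti_Phi.antitone hx
  have h1 : phi x ≤ (1 + 1 / X ^ 2) * (x * Phi x) := by
    have h6 : x ^ 2 + 1 ≤ (1 + 1 / X ^ 2) * x ^ 2 := by
      have : 1 ≤ 1 / X ^ 2 * x ^ 2 := by
        rw [one_div_mul_eq_div, one_le_div (by positivity)]
        gcongr
      linarith
    have : x * phi x ≤ x * ((1 + 1 / X ^ 2) * (x * Phi x)) := by
      calc _ ≤ _ := mul_phi_le_Phi x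
        _ ≤ (1 + 1 / X ^ 2) * x ^ 2 * Phi x := by gcongr
        _ = _ := by ring
    exact le_of_mul_le_mul_left this hx0
  rw [psi, div_le_iff₀ (Phi_mul_pos x)]
  calc phi x ^ 2 = phi x * phi x := by ring
    _ ≤ phi x * ((1 + 1 / X ^ 2) * (x * Phi x)) := by gcongr
    _ = (1 + 1 / X ^ 2) / (1 - Phi X) * (x * phi x) * (Phi x * (1 - Phi X)) := by
      field_simp
    _ ≤ _ := by gcongr

theorem integral_mul_phi (X Y : ℝ) : ∫ x in X..Y, x * phi x = phi X - phi Y := by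
  have := intervalIntegral.integral_eq_sub_of_hasDerivAt (a := X) (b := Y)
    (fun x _ => (hasDerivAt_phi x).neg)
    ((continuous_neg.mul continuous_phi).neg.intervalIntegrable _ _)
  simp only [neg_mul, neg_neg, Pi.neg_apply] at this
  rw [this]
  ring

theorem continuous_mul_phi : Continuous fun x => x * phi x := continuous_id.mul continuous_phi

/-- Lower bound for the integral over `[0, ∞)` by the integral over `[0, X]`. -/
theorem le_alpha_mul_log {X : ℝ} (hX : 0 ≤ X) :
    (∫ x in (0 : ℝ)..X, psi x) + phi X ≤ alpha * Real.log 2 := by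
  have h1 : Filter.Tendsto (fun Y => (∫ x in (0 : ℝ)..X, psi x) + (phi X - phi Y)) Filter.atTop
      (nhds ((∫ x in (0 : ℝ)..X, psi x) + (phi X - 0))) :=
    (tendsto_phi.const_sub _).const_add _
  rw [sub_zero] at h1
  refine le_of_tendsto_of_tendsto h1 tendsto_integral_psi ?_
  filter_upwards [Filter.eventually_ge_atTop X] with Y hY
  rw [← intervalIntegral.integral_add_adjacent_intervals
    (continuous_psi.intervalIntegrable 0 X) (continuous_psi.intervalIntegrable X Y),
    ← integral_mul_phi]
  gcongr
  exact intervalIntegral.integral_mono_on hY (continuous_mul_phi.intervalIntegrable _ _)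
    (continuous_psi.intervalIntegrable _ _) fun x hx => mul_phi_le_psi (hX.trans hx.1)

/-- Upper bound for the integral over `[0, ∞)` by the integral over `[0, X]`. -/
theorem alpha_mul_log_le {X : ℝ} (hX : 0 < X) : alpha * Real.log 2 ≤
    (∫ x in (0 : ℝ)..X, psi x) + (1 + 1 / X ^ 2) / (1 - Phi X) * phi X := by
  refine le_of_tendsto tendsto_integral_psi ?_
  filter_upwards [Filter.eventually_ge_atTop X] with Y hY
  have h4 : 0 < 1 - Phi X := sub_pos.2 (Phi_lt_one X)
  rw [← intervalIntegral.integral_add_adjacent_intervals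
    (continuous_psi.intervalIntegrable 0 X) (continuous_psi.intervalIntegrable X Y)]
  gcongr
  calc _ ≤ ∫ x in X..Y, (1 + 1 / X ^ 2) / (1 - Phi X) * (x * phi x) :=
        intervalIntegral.integral_mono_on hY (continuous_psi.intervalIntegrable _ _)
          ((continuous_mul_phi.const_mul _).intervalIntegrable _ _) fun x hx => psi_le hX hx.1
    _ ≤ _ := by
        rw [intervalIntegral.integral_const_mul, integral_mul_phi]
        have := phi_pos Y
        gcongr
        linarith

end EntropyNN

end

/-! ### Verified fixed point integration of `psi`. -/

noncomputable section

namespace EntropyNN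

/-! ### Numerical bounds for the entropy integral -/

/-- The multiple of the density of the normal distribution with value `1` at `0`. -/
def bell (x : ℝ) : ℝ := Real.exp (-x ^ 2 / 2)

/-- The integral of `bell` from `0`. -/
def bellInt (x : ℝ) : ℝ := √(2 * Real.pi) * (1 / 2 - Phi x)

theorem bell_eq (x : ℝ) : bell x = √(2 * Real.pi) * phi x := by
  have : √(2 * Real.pi) ≠ 0 := by
    have := Real.pi_pos
    positivity
  rw [phi_eq, mul_inv_cancel_left₀ this, bell]

theorem bell_pos (x : ℝ) : 0 < bell x := Real.exp_pos _

theorem bell_le_bell {a b : ℝ} (ha : 0 ≤ a) (hab : a ≤ b) : bell b ≤ bell a :=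
  Real.exp_le_exp.2 (by nlinarith)

theorem hasDerivAt_bellInt (x : ℝ) : HasDerivAt bellInt (bell x) x := by
  refine (((hasDerivAt_Phi x).const_sub (1 / 2)).const_mul (√(2 * Real.pi))).congr_deriv ?_
  rw [bell_eq, neg_neg]

theorem bellInt_zero : bellInt 0 = 0 := by simp [bellInt, Phi_zero]

theorem bellInt_mono : Monotone bellInt :=
  monotone_of_hasDerivAt_nonneg hasDerivAt_bellInt fun x => (bell_pos x).le

theorem bellInt_nonneg {x : ℝ} (hx : 0 ≤ x) : 0 ≤ bellInt x :=
  bellInt_zero ▸ bellInt_mono hx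

theorem pi_div_two_sub_bellInt_sq (x : ℝ) :
    Real.pi / 2 - bellInt x ^ 2 = 2 * Real.pi * (Phi x * (1 - Phi x)) := by
  rw [bellInt, mul_pow, Real.sq_sqrt (by linarith [Real.pi_pos])]
  ring

theorem bellInt_sq_lt (x : ℝ) : 0 < Real.pi / 2 - bellInt x ^ 2 := by
  rw [pi_div_two_sub_bellInt_sq]
  exact mul_pos (by linarith [Real.pi_pos]) (Phi_mul_pos x)

/-- Rescaling by √(2π) leaves π as the only constant to be approximated, and gives `bell` and its
integral the exact initial values 1 and 0. -/
theorem psi_eq (x : ℝ) : psi x = bell x ^ 2 / (Real.pi / 2 - bellInt x ^ 2) := by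
  have h0 := Real.pi_pos
  rw [pi_div_two_sub_bellInt_sq, bell_eq, mul_pow, Real.sq_sqrt (by linarith),
    mul_div_mul_left _ _ (by linarith), psi]

theorem exists_bellInt_sub_eq {a h : ℝ} (hh : 0 < h) :
    ∃ y ∈ Set.Ioo a (a + h), bellInt (a + h) - bellInt a = h * bell y := by
  obtain ⟨y, hy, h1⟩ := exists_hasDerivAt_eq_slope bellInt bell (show a < a + h by linarith)
    (fun x _ => (hasDerivAt_bellInt x).continuousAt.continuousWithinAt)
    fun x _ => hasDerivAt_bellInt x
  refine ⟨y, hy, ?_⟩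
  rw [h1, add_sub_cancel_left, mul_div_cancel₀ _ hh.ne']

theorem mul_bell_le {a h : ℝ} (ha : 0 ≤ a) (hh : 0 < h) :
    bellInt a + h * bell (a + h) ≤ bellInt (a + h) := by
  obtain ⟨y, hy, h1⟩ := exists_bellInt_sub_eq (a := a) hh
  have := bell_le_bell (ha.trans hy.1.le) hy.2.le
  nlinarith

theorem le_mul_bell {a h : ℝ} (ha : 0 ≤ a) (hh : 0 < h) :
    bellInt (a + h) ≤ bellInt a + h * bell a := by
  obtain ⟨y, hy, h1⟩ := exists_bellInt_sub_eq (a := a) hh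
  have := bell_le_bell ha hy.1.le
  nlinarith

/-- Monotonicity of `psi` is not used: `bell` decreases and `bellInt` increases, so numerator and
denominator are estimated at opposite ends. -/
theorem le_integral_psi {a h : ℝ} (ha : 0 ≤ a) (hh : 0 < h) :
    h * (bell (a + h) ^ 2 / (Real.pi / 2 - bellInt a ^ 2)) ≤ ∫ x in a..a + h, psi x := by
  have h1 : ∫ _ in a..a + h, bell (a + h) ^ 2 / (Real.pi / 2 - bellInt a ^ 2) ≤
      ∫ x in a..a + h, psi x := by
    refine intervalIntegral.integral_mono_on (by linarith) (by simp)
      (continuous_psi.intervalIntegrable _ _) fun x hx => ?_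
    have h2 := bellInt_nonneg ha
    have h3 := bell_pos (a + h)
    have h4 := bellInt_sq_lt x
    rw [psi_eq]
    have h5 := bellInt_mono hx.1
    have h6 := bell_le_bell (ha.trans hx.1) hx.2
    gcongr
  simpa [mul_div_assoc] using h1

theorem integral_psi_le {a h : ℝ} (ha : 0 ≤ a) (hh : 0 < h) :
    ∫ x in a..a + h, psi x ≤ h * (bell a ^ 2 / (Real.pi / 2 - bellInt (a + h) ^ 2)) := by
  have h1 : ∫ x in a..a + h, psi x ≤
      ∫ _ in a..a + h, bell a ^ 2 / (Real.pi / 2 - bellInt (a + h) ^ 2) := by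
    refine intervalIntegral.integral_mono_on (by linarith)
      (continuous_psi.intervalIntegrable _ _) (by simp) fun x hx => ?_
    have h2 := bellInt_nonneg (ha.trans hx.1)
    have h3 := bell_pos x
    have h4 := bellInt_sq_lt (a + h)
    rw [psi_eq]
    have h5 := bellInt_mono hx.2
    have h6 := bell_le_bell ha hx.1
    gcongr
  simpa [mul_div_assoc] using h1

/-- Passing a number on after its evaluation. -/
def force {α : Type} (n : ℕ) (k : ℕ → α) : α := Nat.rec (k 0) (fun m _ => k (m + 1)) n

theorem force_eq {α : Type} (n : ℕ) (k : ℕ → α) : force n k = k n := by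
  cases n <;> rfl

/-- A check in fixed point arithmetic, in units of `1 / N`, of a lower bound for the integral of
`psi` over consecutive intervals of length `1 / m`. -/
def lowerCheck (N m σ W B k : ℕ) : ℕ → ℕ → ℕ → ℕ → Bool :=
  -- At abscissa x the state holds lower bounds, in units of 1/N, of: `bell x` in `F`; the ratio of
  -- `bell (x + 1 / m)` to `bell x` in `R`; `bellInt x` in `U`; the integral of `psi` up to x in
  -- `S`. `W` is an upper bound of N²π/2, and σ a lower bound of N exp(-1/m²).
  Nat.rec (fun _ _ _ S => Nat.ble B S)
    (fun _ check F R U S =>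
      force (F * R / N) fun F' => force (R * σ / N) fun R' => force (U + F' / m) fun U' =>
      force (S + N * F' ^ 2 / (m * (W - U ^ 2))) fun S' => check F' R' U' S') k

/-- A check in fixed point arithmetic, in units of `1 / N`, of an upper bound for the integral of
`psi` over consecutive intervals of length `1 / m`. -/
def upperCheck (N m σ W B k : ℕ) : ℕ → ℕ → ℕ → ℕ → Bool :=
  Nat.rec (fun _ _ U S => Nat.ble (U ^ 2 + 1) W && Nat.ble S B)
    (fun _ check F R U S =>
      force (F * R / N + 1) fun F' => force (R * σ / N + 1) fun R' =>
      force (U + (F / m + 1)) fun U' =>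
      force (S + (N * F ^ 2 / (m * (W - U' ^ 2)) + 1)) fun S' => check F' R' U' S') k

theorem lowerCheck_succ (N m σ W B k F R U S : ℕ) : lowerCheck N m σ W B (k + 1) F R U S =
    lowerCheck N m σ W B k (F * R / N) (R * σ / N) (U + F * R / N / m)
      (S + N * (F * R / N) ^ 2 / (m * (W - U ^ 2))) := by
  simp only [lowerCheck, force_eq]

theorem upperCheck_succ (N m σ W B k F R U S : ℕ) : upperCheck N m σ W B (k + 1) F R U S =
    upperCheck N m σ W B k (F * R / N + 1) (R * σ / N + 1) (U + (F / m + 1))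
      (S + (N * F ^ 2 / (m * (W - (U + (F / m + 1)) ^ 2)) + 1)) := by
  simp only [upperCheck, force_eq]

theorem le_natCast_div_add_one (a b : ℕ) : (a : ℝ) / b ≤ (a / b + 1 : ℕ) := by
  rw [← Nat.floor_div_eq_div (K := ℝ)]
  push_cast
  exact (Nat.lt_floor_add_one _).le

/-- On an equidistant grid the ratio of consecutive values of `bell` is itself geometric, with the
constant factor of `exp_shift`. The recursion thus needs no exponential beyond its initial data. -/
theorem bell_add (x m : ℝ) :
    bell (x + 1 / m) = bell x * Real.exp (-x / m - 1 / (2 * m ^ 2)) := by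
  rw [bell, bell, ← Real.exp_add]
  congr 1
  ring

theorem exp_shift (x m : ℝ) : Real.exp (-(x + 1 / m) / m - 1 / (2 * m ^ 2)) =
    Real.exp (-x / m - 1 / (2 * m ^ 2)) * Real.exp (-(1 / m ^ 2)) := by
  rw [← Real.exp_add]
  congr 1
  ring

theorem lowerCheck_sound {N m σ W B : ℕ} (hN : 0 < N) (hm : 0 < m)
    (hσ : σ ≤ N * Real.exp (-(1 / (m : ℝ) ^ 2))) (hW : (N : ℝ) ^ 2 * (Real.pi / 2) ≤ W) (k : ℕ) :
    ∀ {x : ℝ} {F R U S : ℕ}, 0 ≤ x → (F : ℝ) ≤ N * bell x →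
    (R : ℝ) ≤ N * Real.exp (-x / m - 1 / (2 * m ^ 2)) → (U : ℝ) ≤ N * bellInt x →
    (S : ℝ) ≤ N * ∫ t in (0 : ℝ)..x, psi t → lowerCheck N m σ W B k F R U S = true →
    (B : ℝ) ≤ N * ∫ t in (0 : ℝ)..x + k / m, psi t := by
  have hN' : (0 : ℝ) < N := by exact_mod_cast hN
  have hm' : (0 : ℝ) < m := by exact_mod_cast hm
  have hh : (0 : ℝ) < 1 / m := by positivity
  induction k with
  | zero =>
    intro x F R U S _ _ _ _ hS h
    have h1 : B ≤ S := Nat.le_of_ble_eq_true h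
    rw [Nat.cast_zero, zero_div, add_zero]
    exact le_trans (by exact_mod_cast h1) hS
  | succ k ih =>
    intro x F R U S hx hF hR hU hS h
    rw [lowerCheck_succ] at h
    have hb := bell_pos x
    have hF' : ((F * R / N : ℕ) : ℝ) ≤ N * bell (x + 1 / m) := by
      refine Nat.cast_div_le.trans ?_
      rw [div_le_iff₀ hN', bell_add, Nat.cast_mul]
      calc _ ≤ (N * bell x) * (N * Real.exp (-x / m - 1 / (2 * m ^ 2))) := by gcongr
        _ = _ := by ring
    have hy : x + (k + 1 : ℕ) / m = x + 1 / m + k / m := by push_cast; ring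
    rw [hy]
    refine ih (by positivity) hF' ?_ ?_ ?_ h
    · refine Nat.cast_div_le.trans ?_
      rw [div_le_iff₀ hN', exp_shift, Nat.cast_mul]
      calc _ ≤ (N * Real.exp (-x / m - 1 / (2 * m ^ 2))) *
            (N * Real.exp (-(1 / (m : ℝ) ^ 2))) := by gcongr
        _ = _ := by ring
    · have h1 := mul_bell_le hx hh
      have h2 : ((F * R / N / m : ℕ) : ℝ) ≤ _ := Nat.cast_div_le
      rw [Nat.cast_add]
      calc _ ≤ N * bellInt x + N * bell (x + 1 / m) / m := by
            refine add_le_add hU (h2.trans ?_)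
            gcongr
        _ = N * (bellInt x + 1 / m * bell (x + 1 / m)) := by ring
        _ ≤ _ := by gcongr
    · generalize F * R / N = F' at hF'
      have hu := bellInt_sq_lt x
      -- Truncated subtraction is harmless here, as it can only enlarge the denominator.
      have hd : N ^ 2 * (Real.pi / 2 - bellInt x ^ 2) ≤ ((W - U ^ 2 : ℕ) : ℝ) := by
        have h3 : (U : ℝ) ^ 2 ≤ N ^ 2 * bellInt x ^ 2 := by
          calc (U : ℝ) ^ 2 ≤ (N * bellInt x) ^ 2 := by gcongr
            _ = _ := by ring
        have h4 : (W : ℝ) ≤ ((W - U ^ 2 : ℕ) : ℝ) + (U : ℝ) ^ 2 := by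
          exact_mod_cast Nat.sub_le_iff_le_add.1 le_rfl
        linarith
      generalize W - U ^ 2 = W' at hd
      have h1 := le_integral_psi hx hh
      rw [← intervalIntegral.integral_add_adjacent_intervals
        (continuous_psi.intervalIntegrable 0 x) (continuous_psi.intervalIntegrable _ _), mul_add,
        Nat.cast_add]
      refine add_le_add hS (Nat.cast_div_le.trans ?_)
      push_cast
      calc (N : ℝ) * F' ^ 2 / (m * W') ≤ N * (N * bell (x + 1 / m)) ^ 2 /
              (m * (N ^ 2 * (Real.pi / 2 - bellInt x ^ 2))) := by gcongr
        _ = N * (1 / m * (bell (x + 1 / m) ^ 2 / (Real.pi / 2 - bellInt x ^ 2))) := by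
            field_simp
        _ ≤ _ := by gcongr

/-- If `W - U ^ 2` were truncated to 0, division by zero would give a term 0 and spoil the upper
bound. Since `U` only grows, the single test at the end excludes this at every earlier step. -/
theorem upperCheck_sq_lt {N m σ W B : ℕ} (k : ℕ) : ∀ {F R U S : ℕ},
    upperCheck N m σ W B k F R U S = true → U ^ 2 + 1 ≤ W := by
  induction k with
  | zero =>
    intro F R U S h
    exact Nat.le_of_ble_eq_true (Bool.and_eq_true_iff.1 h).1
  | succ k ih =>
    intro F R U S h
    rw [upperCheck_succ] at h
    refine le_trans ?_ (ih h)
    gcongr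
    exact Nat.le_add_right _ _

theorem upperCheck_sound {N m σ W B : ℕ} (hN : 0 < N) (hm : 0 < m)
    (hσ : N * Real.exp (-(1 / (m : ℝ) ^ 2)) ≤ σ) (hW : W ≤ (N : ℝ) ^ 2 * (Real.pi / 2)) (k : ℕ) :
    ∀ {x : ℝ} {F R U S : ℕ}, 0 ≤ x → N * bell x ≤ F →
    N * Real.exp (-x / m - 1 / (2 * m ^ 2)) ≤ R → N * bellInt x ≤ U →
    N * (∫ t in (0 : ℝ)..x, psi t) ≤ S → upperCheck N m σ W B k F R U S = true →
    N * (∫ t in (0 : ℝ)..x + k / m, psi t) ≤ B := by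
  have hN' : (0 : ℝ) < N := by exact_mod_cast hN
  have hm' : (0 : ℝ) < m := by exact_mod_cast hm
  have hh : (0 : ℝ) < 1 / m := by positivity
  induction k with
  | zero =>
    intro x F R U S _ _ _ _ hS h
    have h1 : S ≤ B := Nat.le_of_ble_eq_true (Bool.and_eq_true_iff.1 h).2
    rw [Nat.cast_zero, zero_div, add_zero]
    exact hS.trans (by exact_mod_cast h1)
  | succ k ih =>
    intro x F R U S hx hF hR hU hS h
    rw [upperCheck_succ] at h
    have hb := bell_pos x
    have hy : x + (k + 1 : ℕ) / m = x + 1 / m + k / m := by push_cast; ring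
    have hU' : N * bellInt (x + 1 / m) ≤ ((U + (F / m + 1) : ℕ) : ℝ) := by
      have h1 := le_mul_bell hx hh
      rw [Nat.cast_add]
      calc _ ≤ N * (bellInt x + 1 / m * bell x) := by gcongr
        _ = N * bellInt x + N * bell x / m := by ring
        _ ≤ _ := by
          refine add_le_add hU (le_trans ?_ (le_natCast_div_add_one F m))
          gcongr
    have hlt := upperCheck_sq_lt k h
    rw [hy]
    refine ih (by positivity) ?_ ?_ hU' ?_ h
    · refine le_trans ?_ (le_natCast_div_add_one _ _)
      rw [le_div_iff₀ hN', bell_add, Nat.cast_mul]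
      calc _ = (N * bell x) * (N * Real.exp (-x / m - 1 / (2 * m ^ 2))) := by ring
        _ ≤ _ := by gcongr
    · refine le_trans ?_ (le_natCast_div_add_one _ _)
      rw [le_div_iff₀ hN', exp_shift, Nat.cast_mul]
      calc _ = (N * Real.exp (-x / m - 1 / (2 * m ^ 2))) *
            (N * Real.exp (-(1 / (m : ℝ) ^ 2))) := by ring
        _ ≤ _ := by gcongr
    · generalize U + (F / m + 1) = U' at hU' hlt
      have hu := bellInt_sq_lt (x + 1 / m)
      have hu0 := bellInt_nonneg (show 0 ≤ x + 1 / m by positivity)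
      have hd : ((W - U' ^ 2 : ℕ) : ℝ) ≤ N ^ 2 * (Real.pi / 2 - bellInt (x + 1 / m) ^ 2) := by
        have h3 : N ^ 2 * bellInt (x + 1 / m) ^ 2 ≤ (U' : ℝ) ^ 2 := by
          calc _ = (N * bellInt (x + 1 / m)) ^ 2 := by ring
            _ ≤ _ := by gcongr
        rw [Nat.cast_sub (Nat.le_of_succ_le hlt), Nat.cast_pow]
        linarith
      have hW' : 0 < W - U' ^ 2 := Nat.sub_pos_of_lt hlt
      generalize W - U' ^ 2 = W' at hd hW'
      have h1 := integral_psi_le hx hh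
      have hW'' : (0 : ℝ) < W' := by exact_mod_cast hW'
      rw [← intervalIntegral.integral_add_adjacent_intervals
        (continuous_psi.intervalIntegrable 0 x) (continuous_psi.intervalIntegrable _ _), mul_add,
        Nat.cast_add]
      refine add_le_add hS (le_trans ?_ (le_natCast_div_add_one _ _))
      push_cast
      calc _ ≤ N * (1 / m * (bell x ^ 2 / (Real.pi / 2 - bellInt (x + 1 / m) ^ 2))) := by gcongr
        _ = N * (N * bell x) ^ 2 /
              (m * (N ^ 2 * (Real.pi / 2 - bellInt (x + 1 / m) ^ 2))) := by
            field_simp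
        _ ≤ _ := by gcongr

end EntropyNN

end

/-! ### Numerical values for `D = 3` and the main theorem. -/

noncomputable section

namespace EntropyNN

/-! ### The exponent for intervals of width three -/

/-- The step is 2^(-11), so 6144 steps reach 3. The factors σ and R come from exp(-y) ≥ 1 - y at y =
2^(-22) and y = 2^(-23); `W` encodes π/2 < 1.5707965 and the target is 0.8967, where the added 1
rounds the units up. In `upperCheck_true` the summands 2^36 and 2^34 are the terms y² of
`exp_neg_le_of_nonneg`. -/
theorem lowerCheck_true : lowerCheck (2 ^ 80) (2 ^ 11) (2 ^ 80 - 2 ^ 58)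
    (15707965 * (2 ^ 160 / 10 ^ 7 + 1)) (8967 * (2 ^ 80 / 10 ^ 4 + 1)) 6144
    (2 ^ 80) (2 ^ 80 - 2 ^ 57) 0 0 = true := by
  decide +kernel

theorem upperCheck_true : upperCheck (2 ^ 80) (2 ^ 11) (2 ^ 80 - 2 ^ 58 + 2 ^ 36)
    (15707960 * (2 ^ 160 / 10 ^ 7)) (9001 * (2 ^ 80 / 10 ^ 4)) 6144
    (2 ^ 80) (2 ^ 80 - 2 ^ 57 + 2 ^ 34) 0 0 = true := by
  decide +kernel

/-- Since exp(-y) ≤ 1/(1 + y) and (1 + y)(1 - y + y²) = 1 + y³. -/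
theorem exp_neg_le_of_nonneg {y : ℝ} (hy : 0 ≤ y) : Real.exp (-y) ≤ 1 - y + y ^ 2 := by
  have h1 := Real.add_one_le_exp y
  rw [Real.exp_neg]
  refine (inv_anti₀ (by linarith) h1).trans ?_
  rw [inv_le_iff_one_le_mul₀ (by linarith)]
  nlinarith [pow_nonneg hy 3]

theorem le_integral_psi_three : 0.8967 ≤ ∫ x in (0 : ℝ)..3, psi x := by
  have h := lowerCheck_sound (by positivity) (by positivity) ?_ ?_ 6144 le_rfl ?_ ?_ ?_ ?_
    lowerCheck_true
  · have e : ((6144 : ℕ) : ℝ) / ((2 ^ 11 : ℕ) : ℝ) = 3 := by norm_num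
    rw [zero_add, e] at h
    norm_num at h ⊢
    linarith
  · have := Real.add_one_le_exp (-(1 / ((2 ^ 11 : ℕ) : ℝ) ^ 2))
    norm_num at this ⊢
    linarith
  · have := Real.pi_lt_d6
    norm_num at this ⊢
    linarith
  · simp [bell]
  · have := Real.add_one_le_exp (-0 / ((2 ^ 11 : ℕ) : ℝ) - 1 / (2 * ((2 ^ 11 : ℕ) : ℝ) ^ 2))
    norm_num at this ⊢
    linarith
  · simp [bellInt_zero]
  · simp

theorem integral_psi_three_le : ∫ x in (0 : ℝ)..3, psi x ≤ 0.9001 := by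
  have h := upperCheck_sound (by positivity) (by positivity) ?_ ?_ 6144 le_rfl ?_ ?_ ?_ ?_
    upperCheck_true
  · have e : ((6144 : ℕ) : ℝ) / ((2 ^ 11 : ℕ) : ℝ) = 3 := by norm_num
    rw [zero_add, e] at h
    norm_num at h ⊢
    linarith
  · have := exp_neg_le_of_nonneg (y := 1 / ((2 ^ 11 : ℕ) : ℝ) ^ 2) (by positivity)
    norm_num at this ⊢
    linarith
  · have := Real.pi_gt_d6
    norm_num at this ⊢
    linarith
  · simp [bell]
  · have := exp_neg_le_of_nonneg (y := 1 / (2 * ((2 ^ 11 : ℕ) : ℝ) ^ 2)) (by positivity)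
    norm_num at this ⊢
    linarith
  · simp [bellInt_zero]
  · simp

theorem exp_neg_nine_halves : 0.0111 ≤ Real.exp (-9 / 2) ∧ Real.exp (-9 / 2) ≤ 0.01111 := by
  have h := Real.exp_bound (x := -1 / 2) (by rw [abs_le]; norm_num) (n := 8) (by norm_num)
  -- The Taylor estimate is for arguments of absolute value at most 1, so a ninth power is taken.
  have e : Real.exp (-9 / 2) = Real.exp (-1 / 2) ^ 9 := by
    rw [← Real.exp_nat_mul]
    norm_num
  rw [abs_le] at h
  norm_num [Finset.sum_range_succ, Nat.factorial, abs_of_nonneg] at h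
  rw [e]
  have h1 : 0.6065 ≤ Real.exp (-1 / 2) := by norm_num; linarith
  have h2 : Real.exp (-1 / 2) ≤ 0.606535 := by norm_num; linarith
  constructor
  · calc (0.0111 : ℝ) ≤ 0.6065 ^ 9 := by norm_num
      _ ≤ _ := by gcongr
  · calc Real.exp (-1 / 2) ^ 9 ≤ 0.606535 ^ 9 := by gcongr
      _ ≤ _ := by norm_num

theorem inv_sqrt_two_pi : 0.3989 ≤ (√(2 * Real.pi))⁻¹ ∧ (√(2 * Real.pi))⁻¹ ≤ 0.399 := by
  have h1 := Real.pi_gt_d6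
  have h2 := Real.pi_lt_d6
  constructor
  · rw [le_inv_comm₀ (by norm_num) (by positivity), Real.sqrt_le_left (by norm_num)]
    norm_num
    linarith
  · rw [inv_le_comm₀ (by positivity) (by norm_num), Real.le_sqrt (by norm_num)]
    · norm_num
      linarith
    · positivity

theorem phi_three : 0.0044 ≤ phi 3 ∧ phi 3 ≤ 0.00444 := by
  obtain ⟨h1, h2⟩ := exp_neg_nine_halves
  obtain ⟨h3, h4⟩ := inv_sqrt_two_pi
  rw [phi_eq, show -(3 : ℝ) ^ 2 / 2 = -9 / 2 by norm_num]
  constructor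
  · calc (0.0044 : ℝ) ≤ 0.3989 * 0.0111 := by norm_num
      _ ≤ _ := by gcongr
  · calc _ ≤ (0.399 : ℝ) * 0.01111 := by gcongr
      _ ≤ _ := by norm_num

theorem le_alpha_mul_log_two : 0.9011 ≤ alpha * Real.log 2 := by
  have h1 := le_alpha_mul_log (X := 3) (by norm_num)
  have h2 := le_integral_psi_three
  have h3 := phi_three.1
  linarith

theorem alpha_mul_log_two_le : alpha * Real.log 2 ≤ 0.9051 := by
  have h1 := alpha_mul_log_le (X := 3) (by norm_num)
  have h2 := integral_psi_three_le
  have h3 := phi_three.2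
  -- Mills' upper bound gives Φ(3) ≤ φ(3)/3 ≤ 0.00148.
  have h4 : Phi 3 ≤ 0.0015 := by linarith [mul_Phi_le_phi 3]
  have h5 : (1 + 1 / (3 : ℝ) ^ 2) / (1 - Phi 3) * phi 3 ≤
      (1 + 1 / (3 : ℝ) ^ 2) / (1 - 0.0015) * 0.00444 := by
    have := phi_pos 3
    gcongr
  norm_num at h1 h2 h5 ⊢
  linarith

theorem collisionBound_three : 0.7365 ≤ collisionBound 3 ∧ collisionBound 3 ≤ 0.7371 := by
  obtain ⟨h1, h2⟩ := exp_neg_nine_halves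
  obtain ⟨h3, h4⟩ := inv_sqrt_two_pi
  have e : √(2 / Real.pi) = 2 * (√(2 * Real.pi))⁻¹ := by
    have := Real.pi_pos
    rw [← Real.sqrt_inv, Real.sqrt_eq_iff_mul_self_eq (by positivity) (by positivity)]
    rw [mul_mul_mul_comm, Real.mul_self_sqrt (by positivity)]
    field_simp
  rw [collisionBound, e, show -(3 : ℝ) ^ 2 / 2 = -9 / 2 by norm_num]
  constructor <;> norm_num at * <;> nlinarith

theorem log_inv_collisionBound_three :
    0.3048 ≤ Real.log (1 / collisionBound 3) ∧ Real.log (1 / collisionBound 3) ≤ 0.3064 := by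
  obtain ⟨h1, h2⟩ := collisionBound_three
  have h0 : 0 < collisionBound 3 := lt_of_lt_of_le (by norm_num) h1
  rw [one_div, Real.log_inv]
  constructor
  · rw [le_neg, Real.log_le_iff_le_exp h0]
    have h := Real.exp_bound (x := -0.3048) (by rw [abs_le]; norm_num) (n := 8) (by norm_num)
    rw [abs_le] at h
    norm_num [Finset.sum_range_succ, Nat.factorial, abs_of_nonneg] at h h2 ⊢
    linarith
  · rw [neg_le, Real.le_log_iff_exp_le h0]
    have h := Real.exp_bound (x := -0.3064) (by rw [abs_le]; norm_num) (n := 8) (by norm_num)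
    rw [abs_le] at h
    norm_num [Finset.sum_range_succ, Nat.factorial, abs_of_nonneg] at h h1 ⊢
    linarith

/-- For intervals of width three the exponent is `1.97 / c`, up to an error of `0.01 / c`. -/
theorem abs_mul_rho_three_sub_lt {c : ℝ} (hc : 0 < c) : |c * rho c 3 - 1.97| < 0.01 := by
  obtain ⟨h1, h2⟩ := log_inv_collisionBound_three
  have h3 := le_alpha_mul_log_two
  have h4 := alpha_mul_log_two_le
  have hl : 0 < Real.log 2 := by positivity
  have hL : 0 < Real.log (1 / collisionBound 3) := lt_of_lt_of_le (by norm_num) h1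
  -- In natural logarithms the bounds give a value between 2 · 0.9011 / (3 · 0.3064) > 1.96 and 2 ·
  -- 0.9051 / (3 · 0.3048) < 1.98.
  have e : c * rho c 3 = 2 * (alpha * Real.log 2) / (3 * Real.log (1 / collisionBound 3)) := by
    rw [rho, Real.logb]
    field_simp
  rw [e, abs_lt, sub_lt_iff_lt_add, lt_sub_iff_add_lt, lt_div_iff₀ (by positivity),
    div_lt_iff₀ (by positivity)]
  constructor <;> linarith

end EntropyNN

end

theorem mainTheorem3 :
    (∀ D : ℝ, 0 < D → ∀ c : ℝ, 1 < c → ∃ K : ℕ, ∀ n : ℕ, 2 ≤ n → ∃ prm : EntropyNN.Params,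
      ∀ (d : ℕ), 0 < d → ∀ (P : Fin n → EuclideanSpace ℝ (Fin d)) (r : ℝ), 0 < r →
        -- the size of the data structure
        (∀ ω : EntropyNN.BuildSeed d (EntropyNN.numHash n D) prm,
          ((EntropyNN.build (c * r) D P ω).size : ℝ) ≤ K * d * Real.logb 2 n ^ K * n) ∧
        ∀ q : EuclideanSpace ℝ (Fin d),
          -- the search time
          (∀ (ω : EntropyNN.BuildSeed d (EntropyNN.numHash n D) prm)
            (ω' : EntropyNN.SearchSeed d prm),
            ((EntropyNN.search c D r (EntropyNN.build (c * r) D P ω) q ω').steps : ℝ) ≤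
              K * d * Real.logb 2 n ^ K * (n : ℝ) ^ EntropyNN.rho c D) ∧
          -- every answer is correct
          (∀ (ω : EntropyNN.BuildSeed d (EntropyNN.numHash n D) prm)
            (ω' : EntropyNN.SearchSeed d prm) (i : Fin n),
            (EntropyNN.search c D r (EntropyNN.build (c * r) D P ω) q ω').val = some i →
              dist (P i) q ≤ c * r) ∧
          -- with high probability there is an answer if some point is at distance at most `r`
          ((∃ i, dist (P i) q ≤ r) →
            ((EntropyNN.buildLaw d (EntropyNN.numHash n D) prm D).prod
              (EntropyNN.searchLaw d prm))
              {ω | (EntropyNN.search c D r (EntropyNN.build (c * r) D P ω.1) q ω.2).val = none} ≤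
                ENNReal.ofReal (1 / n))) ∧
    -- the exponent for `D = 3`
    ∀ c : ℝ, 1 < c → |c * EntropyNN.rho c 3 - 1.97| < 0.01 := by
  refine ⟨fun D hD c hc => ?_, fun c hc =>
    EntropyNN.abs_mul_rho_three_sub_lt (zero_lt_one.trans hc)⟩
  obtain ⟨K₁, hK₁⟩ := EntropyNN.exists_size_le (zero_lt_one.trans hc) hD
  obtain ⟨K₂, hK₂⟩ := EntropyNN.exists_steps_le (zero_lt_one.trans hc) hD
  refine ⟨max K₁ K₂, fun n hn => ⟨EntropyNN.params c D n, fun d hd P r hr => ⟨fun ω => ?_,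
    fun q => ⟨fun ω ω' => ?_, fun ω ω' i h => ?_, fun hq => ?_⟩⟩⟩⟩
  · refine (hK₁ n hn d hd (c * r) P ω).trans ?_
    have := EntropyNN.mul_pow_logb_mono hn (le_max_left K₁ K₂)
    calc _ ≤ ((max K₁ K₂ : ℕ) : ℝ) * Real.logb 2 n ^ max K₁ K₂ * (d * n) := by gcongr
      _ = _ := by ring
  · refine (hK₂ n hn d hd r _ q ω').trans ?_
    have := EntropyNN.mul_pow_logb_mono hn (le_max_right K₁ K₂)
    calc _ ≤ ((max K₁ K₂ : ℕ) : ℝ) * Real.logb 2 n ^ max K₁ K₂ *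
          (d * (n : ℝ) ^ EntropyNN.rho c D) := by gcongr
      _ = _ := by ring
  · exact EntropyNN.search_sound (mul_nonneg (zero_le_one.trans hc.le) hr.le) P ω q ω' i h
  · exact EntropyNN.measure_search_params_none_le hc.le hD hn hd hr P q hq
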